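/- Let $d\ge 2$, $L>0$, $g>0$, $\rho_+>\rho_->0$, and let $A=(\rho_+-\rho_-)/(\rho_++\rho_-)$ be the Atwood number. Write $x=(y,z)$ for the points of the column $[0,L]^{d-1}\times\mathbb R$, let $\mathbf e_z$ be the vertical unit vector, put $\rho_0(z)=\rho_+$ for $z\ge 0$ and $\rho_0(z)=\rho_-$ for $z<0$, and let $$⨍ f\,dx=\frac1{L^{d-1}}\int_{[0,L]^{d-1}\times\mathbb R} f\,dx .$$ Consider the system $$\rho_t+\mathbf u\cdot\nabla\rho-\Delta\rho=0,\qquad \rho\,(\mathbf u_t+(\mathbf u\cdot\nabla)\mathbf u)-(\nabla\rho\cdot\nabla)\mathbf u+\nabla p+\rho g\,\mathbf e_z=0,\qquad \nabla\cdot\mathbf u=0$$ on the column, with $\rho,\mathbf u,p$ $L$-periodic in each component of $y$. A classical solution is a triple $(\rho,\mathbf u,p)$ that satisfies the system pointwise for all $t>0$, where for $t>0$ the function $\rho$ is $C^1$ in $(t,x)$ and $C^2$ in $x$ with second derivatives continuous in $(t,x)$, $\mathbf u$ is $C^1$ in $(t,x)$ and $p$ is $C^1$ in $x$. The initial density $\rho(\cdot,0)$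 is measurable with values in $[\rho_-,\rho_+]$ and is attained in $L^1_{\rm loc}$ as $t\downarrow 0$; $\mathbf u$ is continuous on $t\ge0$. Moreover, for every $T>0$, $\rho$ and $\mathbf u$ are bounded for $0<t\le T$; $|\mathbf u(x,t)|\to 0$ as $z\to\pm\infty$, uniformly in $y$, for each $t\ge 0$; $\nabla p$ is bounded for $s\le t\le T$ whenever $0<s<T$; and $⨍\rho|\mathbf u|^2dx<\infty$ for each $t\ge0$. Let $$E_p(t)=\frac{1}{\rho_+-\rho_-}⨍(\rho_0(z)-\rho(x,t))\,g z\,dx,\qquad H(t)=\frac{1}{(\rho_+-\rho_-)^2}⨍(\rho_+-\rho(x,t))(\rho(x,t)-\rho_-)\,dx,$$ $$P(t)=\frac1{\rho_+-\rho_-}⨍|\nabla\rho(x,t)|\,dx,$$ where at $t=0$ the last integral is understood as the total variation of $\rho(\cdot,0)$ (so that jumps are allowed). Theorem. There is an absolute constant $C>0$ such that for all such $d,L,g,\rho_\pm$ and every classical solution for which $E_p(0)$, $H(0)$ and $P(0)$ are finite, the integrals defining $E_p(t)$ and $H(t)$ converge absolutely for all $t\ge0$ and $$\limsup_{t\to+\infty}\frac{E_p(t)}{A^2g^3t^3}\le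 C\,\frac{L^2}{(1-A)^{3/2}},\qquad \limsup_{t\to+\infty}\frac{H(t)}{A g\,t^{3/2}}\le C\,\frac{L}{(1-A)^{3/4}} .$$ -/

import Mathlib

open MeasureTheory Filter Topology Set

namespace RayleighTaylor

noncomputable section

/-- Points `x = (y, z)` of `ℝ^d`, where `d = n + 1`: the first `n` coordinates are the transverse
coordinates `y` and the last coordinate is the height `z`. -/
abbrev Space (n : ℕ) : Type := EuclideanSpace ℝ (Fin (n + 1))

/-- The height `z` of the point `x = (y, z)`. -/
def height {n : ℕ} (x : Space n) : ℝ := x (Fin.last n)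

/-- The vertical unit vector `e_z`. -/
def ez (n : ℕ) : Space n := EuclideanSpace.single (Fin.last n) 1

/-- The infinite column `[0, L]^(d-1) × ℝ`. -/
def column (n : ℕ) (L : ℝ) : Set (Space n) :=
  {x | ∀ i : Fin n, x i.castSucc ∈ Icc 0 L}

/-- A function on `ℝ^d` is `L`-periodic in each of the transverse directions. Functions on the
column with periodic boundary conditions are identified with such functions. -/
def TransversePeriodic {n : ℕ} (L : ℝ) {F : Type*} (f : Space n → F) : Prop :=
  ∀ (x : Space n) (i : Fin n), f (x + EuclideanSpace.single i.castSucc L) = f x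

/-- The integral over the column, normalized by `L^(d-1)`. -/
def normalizedIntegral (n : ℕ) (L : ℝ) (f : Space n → ℝ) : ℝ :=
  (L ^ n)⁻¹ * ∫ x in column n L, f x

/-- The divergence of a vector field. -/
def divergence {n : ℕ} (v : Space n → Space n) (x : Space n) : ℝ :=
  ∑ i, fderiv ℝ v x (EuclideanSpace.single i 1) i

/-- The perfectly stratified density, as a function of the height. -/
def stratifiedDensity (rhoM rhoP z : ℝ) : ℝ := if 0 ≤ z then rhoP else rhoM

/-- The Atwood number. -/
def atwood (rhoM rhoP : ℝ) : ℝ := (rhoP - rhoM) / (rhoP + rhoM)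

/-- The integrand `(ρ₀(z) - ρ(x)) g z` of the (negative) potential energy. -/
def potentialDensity {n : ℕ} (g rhoM rhoP : ℝ) (r : Space n → ℝ) (x : Space n) : ℝ :=
  (stratifiedDensity rhoM rhoP (height x) - r x) * g * height x

/-- The negative `E_p` of the potential energy of the density `r`. -/
def potentialEnergy {n : ℕ} (L g rhoM rhoP : ℝ) (r : Space n → ℝ) : ℝ :=
  1 / (rhoP - rhoM) * normalizedIntegral n L (potentialDensity g rhoM rhoP r)

/-- The integrand of the mixing entropy. -/
def mixingDensity {n : ℕ} (rhoM rhoP : ℝ) (r : Space n → ℝ) (x : Space n) : ℝ :=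
  (rhoP - r x) * (r x - rhoM)

/-- The mixing entropy `H` of the density `r`. -/
def mixingEntropy {n : ℕ} (L rhoM rhoP : ℝ) (r : Space n → ℝ) : ℝ :=
  1 / (rhoP - rhoM) ^ 2 * normalizedIntegral n L (mixingDensity rhoM rhoP r)

/-- Admissible test fields for the total variation on the column: continuously differentiable,
periodic in the transverse directions, vanishing for large `|z|`, of length at most `1`. -/
structure IsTestField {n : ℕ} (L : ℝ) (ψ : Space n → Space n) : Prop where
  contDiff : ContDiff ℝ 1 ψ
  periodic : TransversePeriodic L ψ
  vanishes : ∃ R : ℝ, ∀ x, R ≤ |height x| → ψ x = 0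
  norm_le_one : ∀ x, ‖ψ x‖ ≤ 1

/-- The mean perimeter `P` of the density `r`: the normalized integral of `|∇r|`, divided by
`ρ₊ - ρ₋`, where `|∇r|` is understood as the total variation measure of the distributional
gradient, so that densities with jumps are allowed. For a continuously differentiable periodic
`r` it is the integral of the length of the gradient. -/
def meanPerimeter {n : ℕ} (L rhoM rhoP : ℝ) (r : Space n → ℝ) : ENNReal :=
  ENNReal.ofReal (1 / (rhoP - rhoM) * (L ^ n)⁻¹) *
    ⨆ (ψ : Space n → Space n) (_ : IsTestField L ψ),
      ENNReal.ofReal (∫ x in column n L, r x * divergence ψ x)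

/-- `(ρ, u)`, with pressure `p`, is a classical solution for all positive times of
`ρ_t + u·∇ρ - Δρ = 0`, `ρ (u_t + (u·∇)u) - (∇ρ·∇)u + ∇p + ρ g e_z = 0`, `∇·u = 0`
on the column with transverse periodicity, with initial data `ρ 0`, `u 0`. -/
structure IsClassicalSolution {n : ℕ} (L g rhoM rhoP : ℝ)
    (ρ : ℝ → Space n → ℝ) (u : ℝ → Space n → Space n) (p : ℝ → Space n → ℝ) : Prop where
  /- periodicity in the transverse directions -/
  periodic_rho : ∀ t, 0 ≤ t → TransversePeriodic L (ρ t)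
  periodic_u : ∀ t, 0 ≤ t → TransversePeriodic L (u t)
  periodic_p : ∀ t, 0 < t → TransversePeriodic L (p t)
  /- regularity for positive times -/
  contDiff_rho : ContDiffOn ℝ 1 (fun q : ℝ × Space n => ρ q.1 q.2) (Ioi 0 ×ˢ univ)
  contDiff_rho_space : ∀ t, 0 < t → ContDiff ℝ 2 (ρ t)
  continuous_hessian : ContinuousOn
    (fun q : ℝ × Space n => fderiv ℝ (fderiv ℝ (ρ q.1)) q.2) (Ioi 0 ×ˢ univ)
  contDiff_u : ContDiffOn ℝ 1 (fun q : ℝ × Space n => u q.1 q.2) (Ioi 0 ×ˢ univ)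
  contDiff_p : ∀ t, 0 < t → ContDiff ℝ 1 (p t)
  /- the equations -/
  transport : ∀ t, 0 < t → ∀ x,
    deriv (fun s => ρ s x) t + inner ℝ (u t x) (gradient (ρ t) x)
      - Laplacian.laplacian (ρ t) x = 0
  momentum : ∀ t, 0 < t → ∀ x,
    ρ t x • (deriv (fun s => u s x) t + fderiv ℝ (u t) x (u t x))
      - fderiv ℝ (u t) x (gradient (ρ t) x) + gradient (p t) x + (ρ t x * g) • ez n = 0
  incompressible : ∀ t, 0 < t → ∀ x, divergence (u t) x = 0
  /- the initial data: the density may have jumps and is attained in `L¹_loc` -/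
  measurable_initial : Measurable (ρ 0)
  initial_mem : ∀ x, ρ 0 x ∈ Icc rhoM rhoP
  initial_rho : ∀ R : ℝ, Tendsto
    (fun t => ∫ x in column n L ∩ {x | |height x| ≤ R}, |ρ t x - ρ 0 x|) (𝓝[>] 0) (𝓝 0)
  initial_u : ContinuousOn (fun q : ℝ × Space n => u q.1 q.2) (Ici 0 ×ˢ univ)
  /- behaviour at infinity and finite kinetic energy -/
  bounded_rho : ∀ T : ℝ, ∃ M : ℝ, ∀ t ∈ Ioc 0 T, ∀ x, |ρ t x| ≤ M
  bounded_u : ∀ T : ℝ, ∃ M : ℝ, ∀ t ∈ Icc 0 T, ∀ x, ‖u t x‖ ≤ M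
  decay_u : ∀ t, 0 ≤ t → ∀ ε : ℝ, 0 < ε → ∃ R : ℝ, ∀ x, R ≤ |height x| → ‖u t x‖ ≤ ε
  bounded_grad_p : ∀ s T : ℝ, 0 < s → ∃ M : ℝ, ∀ t ∈ Icc s T, ∀ x, ‖gradient (p t) x‖ ≤ M
  kinetic_finite : ∀ t, 0 ≤ t → IntegrableOn (fun x => ρ t x * ‖u t x‖ ^ 2) (column n L)

end

end RayleighTaylor

/-! Let Z(t) be the integral of (ρ₀ - ρ) z over the column, the potential energy up to a constant
factor. The proof shows Z = O(t²), and from this that the mixing entropy is O(t), with constants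
depending on the solution. Both quotients in the theorem then tend to zero, so the size of the
absolute constant plays no role.

Three balances are combined. Up to a bounded term, Z' is minus the vertical mass flux ∫ ρ u_z
(`exists_deriv_moment`). Kinetic energy minus g Z therefore grows at most linearly
(`kineticMass_le`). The integral of (ρ₊ - ρ)(ρ - ρ₋) has derivative 2 ∫ |∇ρ|²
(`exists_deriv_mixing`).

The mass flux is bounded through incompressibility. Since u is divergence free and decays, u_z has
mean zero on every horizontal section, so the horizontal mean of ρ may be subtracted from ρ. The
remainder is controlled by ∇ρ, which gives D/2 (λ ∫ |∇ρ|² + λ⁻¹ ∫ u_z²) for every λ > 0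
(`FluxFree.abs_integral_mul_le`).

Let S be the supremum of Z on [1, T]. Splitting the column at |z| = δ bounds the mixing integral,
hence the space-time integral of |∇ρ|², by a multiple of δ + S/δ. The kinetic energy is at most a
multiple of 1 + S + T. Integration in time bounds Z by O(T) + λ (δ + S/δ) + λ⁻¹ T (1 + S + T), up to
constants. With λ and δ suitable multiples of T, the terms containing S add up to S/2 and are
absorbed; what remains is O(T²) (`exists_integral_excess_le_sq`).

Two matters need care on the infinite column. First, S must be known to be finite: a Grönwall
argument with integrable weights in z gives the maximum principle and, after averaging over the
centres of the weights, a locally bounded first moment (`exists_bound_moment`). Secondly, the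
balances are only available with cutoffs at height R, and the flux errors must disappear as R → ∞.
The pressure enters through its gradient alone, again by subtracting a horizontal mean, and the
diffusive flux of kinetic energy is handled by the space-time bound for ∇ρ. The balances are
integrated from time 1, away from the possibly discontinuous initial density. -/

namespace RayleighTaylor

noncomputable section

/-! ### Geometry of the column -/

variable {n : ℕ}

/-- The height as a continuous linear functional. -/
def heightL (n : ℕ) : Space n →L[ℝ] ℝ := EuclideanSpace.proj (Fin.last n)

theorem heightL_apply (x : Space n) : heightL n x = height x := rfl

theorem continuous_height : Continuous (height : Space n → ℝ) := (heightL n).continuous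

theorem contDiff_height {k : WithTop ℕ∞} : ContDiff ℝ k (height : Space n → ℝ) :=
  (heightL n).contDiff

theorem hasFDerivAt_height (x : Space n) : HasFDerivAt (height : Space n → ℝ) (heightL n) x :=
  (heightL n).hasFDerivAt

theorem height_add (x y : Space n) : height (x + y) = height x + height y := rfl

theorem height_smul (c : ℝ) (x : Space n) : height (c • x) = c * height x := rfl

theorem height_ez : height (ez n) = 1 := by simp [height, ez]

theorem height_single_castSucc (i : Fin n) (c : ℝ) :
    height (EuclideanSpace.single i.castSucc c : Space n) = 0 := by
  simp [height, (Fin.castSucc_ne_last i).symm]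

theorem abs_height_le (x : Space n) : |height x| ≤ ‖x‖ := by
  have := EuclideanSpace.norm_eq x
  rw [this]
  apply Real.le_sqrt_of_sq_le
  rw [← Real.norm_eq_abs]
  exact Finset.single_le_sum (f := fun i => ‖x i‖ ^ 2) (fun i _ => by positivity)
    (Finset.mem_univ (Fin.last n))

theorem isClosed_column (L : ℝ) : IsClosed (column n L) := by
  have : column n L = ⋂ i : Fin n, {x | x i.castSucc ∈ Icc 0 L} := by
    ext x; simp [column]
  rw [this]
  refine isClosed_iInter fun i => isClosed_Icc.preimage ?_
  exact (EuclideanSpace.proj (𝕜 := ℝ) (i.castSucc : Fin (n + 1))).continuous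

theorem measurableSet_column (L : ℝ) : MeasurableSet (column n L) :=
  (isClosed_column L).measurableSet

/-- The part of the column at heights at most `R` in absolute value. -/
def slab (n : ℕ) (L R : ℝ) : Set (Space n) := column n L ∩ {x | |height x| ≤ R}

/-- The lower corner of the slab, in coordinates. -/
def slabLower (n : ℕ) (R : ℝ) : Fin (n + 1) → ℝ := Fin.snoc (fun _ => 0) (-R)

/-- The upper corner of the slab, in coordinates. -/
def slabUpper (n : ℕ) (L R : ℝ) : Fin (n + 1) → ℝ := Fin.snoc (fun _ => L) R

theorem toLp_preimage_slab (L R : ℝ) :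
    (WithLp.toLp 2 : (Fin (n + 1) → ℝ) → Space n) ⁻¹' slab n L R
      = Icc (slabLower n R) (slabUpper n L R) := by
  ext y
  simp only [slab, column, mem_preimage, mem_inter_iff, mem_ofPred_eq, mem_Icc, Pi.le_def,
    Fin.forall_fin_succ', slabLower, slabUpper, Fin.snoc_castSucc, Fin.snoc_last, height, abs_le]
  constructor
  · rintro ⟨h1, h2, h3⟩
    exact ⟨⟨fun i => (h1 i).1, h2⟩, fun i => (h1 i).2, h3⟩
  · rintro ⟨⟨h1, h2⟩, h3, h4⟩
    exact ⟨fun i => ⟨h1 i, h3 i⟩, h2, h4⟩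

theorem isCompact_slab (L R : ℝ) : IsCompact (slab n L R) := by
  have h : slab n L R = (WithLp.toLp 2 : (Fin (n + 1) → ℝ) → Space n) ''
      Icc (slabLower n R) (slabUpper n L R) := by
    rw [← toLp_preimage_slab, image_preimage_eq]
    exact WithLp.toLp_surjective 2
  rw [h]
  exact isCompact_Icc.image (PiLp.continuous_toLp 2 _)

theorem measurableSet_slab (L R : ℝ) : MeasurableSet (slab n L R) :=
  (isCompact_slab L R).measurableSet

theorem slab_subset_column (L R : ℝ) : slab n L R ⊆ column n L := inter_subset_left

/-- Splitting off the last coordinate identifies the column with the product of the line and a cube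
of volume `L ^ n`, and the height with the first projection. Integrals of functions of the height
thereby become integrals on the line. -/
theorem map_height_column {L : ℝ} (hL : 0 ≤ L) :
    (volume.restrict (column n L)).map height
      = ENNReal.ofReal (L ^ n) • (volume : Measure ℝ) := by
  have h1 := (EuclideanSpace.volume_preserving_symm_measurableEquiv_toLp (Fin (n + 1)))
  have h2 := volume_preserving_piFinSuccAbove (fun _ : Fin (n + 1) => ℝ) (Fin.last n)
  have h3 := h2.comp h1
  set S : Set (ℝ × (Fin n → ℝ)) := univ ×ˢ Icc (fun _ => 0) (fun _ => L) with hS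
  have hSm : MeasurableSet S := MeasurableSet.univ.prod measurableSet_Icc
  have h4 := h3.restrict_preimage hSm
  have hpre : (⇑(MeasurableEquiv.piFinSuccAbove (fun _ : Fin (n + 1) => ℝ) (Fin.last n)) ∘
      ⇑(MeasurableEquiv.toLp 2 (Fin (n + 1) → ℝ)).symm) ⁻¹' S = column n L := by
    ext x
    simp only [hS, mem_preimage, mem_prod, mem_univ, true_and, mem_Icc, Pi.le_def, column,
      mem_ofPred_eq, Function.comp]
    constructor
    · rintro ⟨a, b⟩ i
      have h1 := a i
      have h2 := b i
      simp only [MeasurableEquiv.piFinSuccAbove, Fin.insertNthEquiv_last] at h1 h2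
      exact ⟨h1, h2⟩
    · intro h
      simp only [MeasurableEquiv.piFinSuccAbove, Fin.insertNthEquiv_last]
      exact ⟨fun i => (h i).1, fun i => (h i).2⟩
  rw [hpre] at h4
  have hh : (height : Space n → ℝ) = Prod.fst ∘
      (⇑(MeasurableEquiv.piFinSuccAbove (fun _ : Fin (n + 1) => ℝ) (Fin.last n)) ∘
      ⇑(MeasurableEquiv.toLp 2 (Fin (n + 1) → ℝ)).symm) := by
    ext x
    simp [MeasurableEquiv.piFinSuccAbove, Fin.insertNthEquiv, height]
  rw [hh, ← Measure.map_map measurable_fst h4.measurable, h4.map_eq]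
  have : (volume : Measure (ℝ × (Fin n → ℝ))).restrict S
      = (volume : Measure ℝ).prod
        ((volume : Measure (Fin n → ℝ)).restrict (Icc (fun _ => 0) (fun _ => L))) := by
    rw [hS, Measure.volume_eq_prod, ← Measure.prod_restrict, Measure.restrict_univ]
  rw [this, Measure.map_fst_prod, Measure.restrict_apply_univ, Real.volume_Icc_pi]
  simp [ENNReal.ofReal_pow hL]

theorem integrableOn_column_comp_height {L : ℝ} (hL : 0 ≤ L) {f : ℝ → ℝ} (hf : Integrable f) :
    IntegrableOn (fun x => f (height x)) (column n L) := by
  have h : Integrable f ((volume.restrict (column n L)).map (height : Space n → ℝ)) := by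
    rw [map_height_column hL]
    exact hf.smul_measure ENNReal.ofReal_ne_top
  exact h.comp_measurable continuous_height.measurable

theorem lintegral_column_comp_height {L : ℝ} (hL : 0 ≤ L) {f : ℝ → ENNReal} (hf : Measurable f) :
    ∫⁻ x in column n L, f (height x) = ENNReal.ofReal (L ^ n) * ∫⁻ z, f z := by
  rw [← lintegral_map hf continuous_height.measurable, map_height_column hL, lintegral_smul_measure,
    smul_eq_mul]

theorem volume_column_height_preimage {L : ℝ} (hL : 0 ≤ L) {s : Set ℝ} (hs : MeasurableSet s) :
    (volume.restrict (column n L)) (height ⁻¹' s) = ENNReal.ofReal (L ^ n) * volume s := by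
  rw [← Measure.map_apply continuous_height.measurable hs, map_height_column hL]
  simp

theorem volume_real_slab {L R : ℝ} (hL : 0 ≤ L) (hR : 0 ≤ R) :
    (volume (slab n L R)).toReal = 2 * R * L ^ n := by
  have h : slab n L R = height ⁻¹' (Icc (-R) R) ∩ column n L := by
    ext x; simp [slab, abs_le, and_comm]
  have hm : MeasurableSet ((height : Space n → ℝ) ⁻¹' (Icc (-R) R)) :=
    continuous_height.measurable measurableSet_Icc
  rw [h, ← Measure.restrict_apply hm, volume_column_height_preimage hL measurableSet_Icc,
    Real.volume_Icc, ENNReal.toReal_mul, ENNReal.toReal_ofReal (by positivity),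
    ENNReal.toReal_ofReal (by linarith)]
  ring

theorem volume_slab_lt_top (L R : ℝ) : volume (slab n L R) < ⊤ := (isCompact_slab L R).measure_lt_top

/-- The function `f` vanishes at heights at least `R` in absolute value. -/
def VanishesAbove {E : Type*} [Zero E] (R : ℝ) (f : Space n → E) : Prop :=
  ∀ x, R ≤ |height x| → f x = 0

/-- Every localized integral is moved to a compact slab, where continuity alone gives integrability
and uniform bounds. -/
theorem integral_column_eq_slab {E : Type*} [NormedAddCommGroup E] [NormedSpace ℝ E]
    {R : ℝ} {f : Space n → E} (hf : VanishesAbove R f) (L : ℝ) :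
    ∫ x in column n L, f x = ∫ x in slab n L R, f x := by
  refine (setIntegral_eq_of_subset_of_forall_sdiff_eq_zero (measurableSet_column L)
    (slab_subset_column L R) ?_)
  rintro x ⟨hx, hx'⟩
  apply hf
  by_contra h
  exact hx' ⟨hx, (not_le.1 h).le⟩

theorem integrableOn_column_of_vanishesAbove {E : Type*} [NormedAddCommGroup E]
    {R : ℝ} {f : Space n → E} (hf : VanishesAbove R f) (hc : Continuous f) (L : ℝ) :
    IntegrableOn f (column n L) := by
  have h : IntegrableOn f (slab n L R) := hc.continuousOn.integrableOn_compact (isCompact_slab L R)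
  refine h.of_forall_sdiff_eq_zero (measurableSet_column L) ?_
  rintro x ⟨hx, hx'⟩
  apply hf
  by_contra h
  exact hx' ⟨hx, (not_le.1 h).le⟩

/-! ### The divergence theorem on the column -/

/-- Gauss' theorem on a box: the top and bottom faces contribute nothing because the field vanishes
there, and opposite lateral faces cancel by periodicity. -/
theorem integral_column_divergence_eq_zero {L R : ℝ} (hL : 0 ≤ L) {F : Space n → Space n}
    (hF : ContDiff ℝ 1 F) (hper : TransversePeriodic L F) (hvan : VanishesAbove R F) :
    ∫ x in column n L, divergence F x = 0 := by
  wlog hR : 0 ≤ R generalizing R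
  · exact this (R := 0) (fun x _ => hvan x (by linarith [abs_nonneg (height x)])) le_rfl
  -- The margin 1 puts the point in the open region where `F` vanishes, so that the derivative
  -- vanishes as well.
  have hdiv : VanishesAbove (R + 1) (divergence F) := by
    intro x hx
    have : F =ᶠ[𝓝 x] fun _ => 0 := by
      have ho : IsOpen {y : Space n | R < |height y|} :=
        isOpen_lt continuous_const continuous_height.abs
      filter_upwards [ho.mem_nhds (show R < |height x| by linarith)] with y hy
      exact hvan y (le_of_lt hy)
    simp [divergence, this.fderiv_eq]
  rw [integral_column_eq_slab hdiv]
  set R' := R + 1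
  have hR' : 0 ≤ R' := by positivity
  have hmp := PiLp.volume_preserving_toLp (Fin (n + 1))
  have hemb : MeasurableEmbedding (WithLp.toLp 2 : (Fin (n + 1) → ℝ) → Space n) :=
    (MeasurableEquiv.toLp 2 (Fin (n + 1) → ℝ)).measurableEmbedding
  rw [← hmp.setIntegral_preimage_emb hemb, toLp_preimage_slab]
  let eL : (Fin (n + 1) → ℝ) →L[ℝ] Space n :=
    ((PiLp.continuousLinearEquiv 2 ℝ (fun _ : Fin (n + 1) => ℝ)).symm : _ →L[ℝ] _)
  let eR : Space n →L[ℝ] (Fin (n + 1) → ℝ) :=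
    ((PiLp.continuousLinearEquiv 2 ℝ (fun _ : Fin (n + 1) => ℝ)) : _ →L[ℝ] _)
  have heL : ∀ y, eL y = WithLp.toLp 2 y := fun y => rfl
  have hFd : Differentiable ℝ F := hF.differentiable one_ne_zero
  have hfc : Continuous (fderiv ℝ F) := hF.continuous_fderiv one_ne_zero
  have hle : slabLower n R' ≤ slabUpper n L R' := by
    intro i
    refine Fin.lastCases ?_ (fun i => ?_) i
    · simp [slabLower, slabUpper]; linarith
    · simp [slabLower, slabUpper, hL]
  have key := integral_divergence_of_hasFDerivAt_off_countable (E := ℝ)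
    (slabLower n R') (slabUpper n L R') hle
    (fun y => eR (F (eL y))) (fun y => eR.comp ((fderiv ℝ F (eL y)).comp eL)) ∅ countable_empty
    (eR.continuous.comp (hF.continuous.comp eL.continuous)).continuousOn
    (fun y _ => eR.hasFDerivAt.comp y ((hFd _).hasFDerivAt.comp y eL.hasFDerivAt))
    (by
      apply Continuous.integrableOn_Icc
      refine continuous_finsetSum _ fun i _ => ?_
      have h1 : Continuous fun y => fderiv ℝ F (eL y) (eL (Pi.single i 1)) :=
        (hfc.comp eL.continuous).clm_apply continuous_const
      exact (continuous_apply i).comp (eR.continuous.comp h1))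
  have hlhs : ∀ y, divergence F (WithLp.toLp 2 y)
      = ∑ i, (eR.comp ((fderiv ℝ F (eL y)).comp eL)) (Pi.single i 1) i := by
    intro y
    rfl
  simp_rw [hlhs]
  rw [key]
  refine Finset.sum_eq_zero fun i _ => ?_
  refine Fin.lastCases ?_ (fun i => ?_) i
  -- Top and bottom faces.
  · have h0 : ∀ c : ℝ, |c| = R' → ∀ y : Fin n → ℝ,
        eR (F (eL ((Fin.last n).insertNth c y))) (Fin.last n) = 0 := by
      intro c hc y
      have : F (eL ((Fin.last n).insertNth c y)) = 0 := by
        apply hvan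
        have : height (eL ((Fin.last n).insertNth c y)) = c := by
          simp [height, heL]
        rw [this, hc]; simp [R']
      rw [this]; simp
    have h1 : |slabUpper n L R' (Fin.last n)| = R' := by simp [slabUpper, abs_of_nonneg hR']
    have h2 : |slabLower n R' (Fin.last n)| = R' := by simp [slabLower, abs_of_nonneg hR']
    simp only [h0 _ h1, h0 _ h2]
    simp
  -- Lateral faces: the two boundary points differ by one period in direction `i`.
  · rw [sub_eq_zero]
    refine integral_congr_ae (Eventually.of_forall fun y => ?_)
    refine congrArg (fun v => eR v i.castSucc) ?_
    have h1 : slabUpper n L R' i.castSucc = L := by simp [slabUpper]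
    have h2 : slabLower n R' i.castSucc = 0 := by simp [slabLower]
    rw [h1, h2, ← hper (eL (Fin.insertNth i.castSucc (0 : ℝ) y)) i]
    congr 1
    ext j
    by_cases hj : j = i.castSucc
    · subst hj
      simp [heL]
    · obtain ⟨k, rfl⟩ := Fin.exists_succAbove_eq hj
      simp [heL]

/-! ### Integrals depending on a parameter -/

theorem continuousOn_integral_compact {U : Set ℝ} (hU : IsOpen U) {K : Set (Space n)}
    (hK : IsCompact K) {f : ℝ → Space n → ℝ}
    (hf : ContinuousOn (fun q : ℝ × Space n => f q.1 q.2) (U ×ˢ univ)) :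
    ContinuousOn (fun t => ∫ x in K, f t x) U := by
  rw [continuousOn_iff_continuous_domRestrict]
  have : LocallyCompactSpace U := hU.locallyCompactSpace
  refine continuous_parametric_integral_of_continuous (X := U) (f := fun t x => f t x) ?_ hK
  exact hf.comp_continuous (f := fun q : U × Space n => ((q.1 : ℝ), q.2)) (by fun_prop)
    (fun q => ⟨q.1.2, mem_univ _⟩)

theorem continuousOn_integral_column {U : Set ℝ} (hU : IsOpen U) {R : ℝ} {f : ℝ → Space n → ℝ}
    (hf : ContinuousOn (fun q : ℝ × Space n => f q.1 q.2) (U ×ˢ univ))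
    (hv : ∀ t, VanishesAbove R (f t)) (L : ℝ) :
    ContinuousOn (fun t => ∫ x in column n L, f t x) U := by
  simp_rw [integral_column_eq_slab (hv _)]
  exact continuousOn_integral_compact hU (isCompact_slab L R) hf

theorem continuous_slice {U : Set ℝ} {E : Type*} [TopologicalSpace E] {f : ℝ → Space n → E}
    (hf : ContinuousOn (fun q : ℝ × Space n => f q.1 q.2) (U ×ˢ univ)) {t : ℝ} (ht : t ∈ U) :
    Continuous (f t) :=
  hf.comp_continuous (f := fun x : Space n => (t, x)) (by fun_prop) (fun _ => ⟨ht, mem_univ _⟩)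

/-- Differentiation under the integral sign. On a compact neighbourhood of `t` times the slab, the
continuous derivative is bounded by a constant, which serves as the dominating function. -/
theorem hasDerivAt_integral_column {U : Set ℝ} (hU : IsOpen U) {R : ℝ} {f f' : ℝ → Space n → ℝ}
    (hf : ContinuousOn (fun q : ℝ × Space n => f q.1 q.2) (U ×ˢ univ))
    (hf' : ContinuousOn (fun q : ℝ × Space n => f' q.1 q.2) (U ×ˢ univ))
    (hv : ∀ t, VanishesAbove R (f t)) (hv' : ∀ t, VanishesAbove R (f' t))
    (hd : ∀ t ∈ U, ∀ x, HasDerivAt (fun s => f s x) (f' t x) t) (L : ℝ) {t : ℝ} (ht : t ∈ U) :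
    HasDerivAt (fun s => ∫ x in column n L, f s x) (∫ x in column n L, f' t x) t := by
  simp_rw [integral_column_eq_slab (hv _), integral_column_eq_slab (hv' _)]
  obtain ⟨V, hVc, hVn, hVU⟩ : ∃ V, IsCompact V ∧ V ∈ 𝓝 t ∧ V ⊆ U := by
    obtain ⟨V, hV, hVU, hVc⟩ := local_compact_nhds (hU.mem_nhds ht)
    exact ⟨V, hVc, hV, hVU⟩
  have hKc : IsCompact (V ×ˢ slab n L R) := hVc.prod (isCompact_slab L R)
  obtain ⟨C, hC⟩ := hKc.exists_bound_of_continuousOn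
    (hf'.mono (prod_mono hVU (subset_univ _)))
  have hint : ∀ s ∈ U, IntegrableOn (f s) (slab n L R) := fun s hs =>
    (continuous_slice hf hs).continuousOn.integrableOn_compact (isCompact_slab L R)
  refine (hasDerivAt_integral_of_dominated_loc_of_deriv_le (F := f) (F' := f')
    (bound := fun _ => C) hVn ?_ (hint t ht) ?_ ?_ ?_ ?_).2
  · filter_upwards [hU.mem_nhds ht] with s hs
    exact (hint s hs).aestronglyMeasurable
  · exact (continuous_slice hf' ht).aestronglyMeasurable
  · refine (ae_restrict_iff' (measurableSet_slab L R)).2 (Eventually.of_forall ?_)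
    intro x hx s hs
    exact hC (s, x) ⟨hs, hx⟩
  · exact integrableOn_const (isCompact_slab L R).measure_ne_top
  · exact Eventually.of_forall fun x s hs => hd s (hVU hs) x

end

noncomputable section

/-! ### Vector calculus -/

variable {n : ℕ}

theorem proj_eq_inner (v : Space n) (i : Fin (n + 1)) :
    v i = inner ℝ v (EuclideanSpace.single i (1 : ℝ)) := by
  rw [EuclideanSpace.inner_single_right]
  simp

theorem sum_coord_smul_single (v : Space n) :
    ∑ i, v i • (EuclideanSpace.single i (1 : ℝ) : Space n) = v := by
  have := (EuclideanSpace.basisFun (Fin (n + 1)) ℝ).sum_repr v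
  simpa using this

theorem divergence_smul {c : Space n → ℝ} {v : Space n → Space n} {x : Space n}
    (hc : DifferentiableAt ℝ c x) (hv : DifferentiableAt ℝ v x) :
    divergence (fun y => c y • v y) x = c x * divergence v x + fderiv ℝ c x (v x) := by
  have h : fderiv ℝ (fun y => c y • v y) x
      = c x • fderiv ℝ v x + (fderiv ℝ c x).smulRight (v x) := fderiv_fun_smul hc hv
  unfold divergence
  rw [h]
  simp only [add_apply, smul_apply,
    ContinuousLinearMap.smulRight_apply, PiLp.add_apply, PiLp.smul_apply, smul_eq_mul,
    Finset.sum_add_distrib, Finset.mul_sum]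
  congr 1
  conv_rhs => rw [← sum_coord_smul_single (v x)]
  rw [map_sum]
  refine Finset.sum_congr rfl fun i _ => ?_
  rw [map_smul, smul_eq_mul, mul_comm]

theorem divergence_sub {v w : Space n → Space n} {x : Space n}
    (hv : DifferentiableAt ℝ v x) (hw : DifferentiableAt ℝ w x) :
    divergence (fun y => v y - w y) x = divergence v x - divergence w x := by
  simp [divergence, fderiv_fun_sub hv hw, Finset.sum_sub_distrib]

theorem divergence_const (v : Space n) (x : Space n) : divergence (fun _ => v) x = 0 := by
  simp [divergence]

theorem inner_gradient_eq_fderiv {f : Space n → ℝ} {x v : Space n} :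
    inner ℝ (gradient f x) v = fderiv ℝ f x v := by
  simp [gradient, InnerProductSpace.toDual_symm_apply]

theorem inner_gradient_eq_fderiv' {f : Space n → ℝ} {x v : Space n} :
    inner ℝ v (gradient f x) = fderiv ℝ f x v := by
  rw [real_inner_comm, inner_gradient_eq_fderiv]

theorem norm_gradient (f : Space n → ℝ) (x : Space n) : ‖gradient f x‖ = ‖fderiv ℝ f x‖ := by
  simp [gradient]

theorem fderiv_gradient_self {f : Space n → ℝ} {x : Space n} :
    fderiv ℝ f x (gradient f x) = ‖gradient f x‖ ^ 2 := by
  rw [← inner_gradient_eq_fderiv, real_inner_self_eq_norm_sq]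

theorem contDiff_gradient {f : Space n → ℝ} (hf : ContDiff ℝ 2 f) : ContDiff ℝ 1 (gradient f) := by
  have h : ContDiff ℝ 1 (fderiv ℝ f) := hf.fderiv_right (by norm_num)
  exact (InnerProductSpace.toDual ℝ (Space n)).symm.contDiff.comp h

theorem height_eq_inner_ez (v : Space n) : height v = inner ℝ v (ez n) :=
  proj_eq_inner v _

theorem height_gradient (f : Space n → ℝ) (x : Space n) :
    height (gradient f x) = fderiv ℝ f x (ez n) := by
  rw [height_eq_inner_ez, inner_gradient_eq_fderiv]

theorem divergence_gradient {f : Space n → ℝ} (hf : ContDiff ℝ 2 f) (x : Space n) :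
    divergence (gradient f) x = Laplacian.laplacian f x := by
  have h : ContDiff ℝ 1 (fderiv ℝ f) := hf.fderiv_right (by norm_num)
  rw [InnerProductSpace.laplacian_eq_iteratedFDeriv_orthonormalBasis f
    (EuclideanSpace.basisFun (Fin (n + 1)) ℝ)]
  unfold divergence
  refine Finset.sum_congr rfl fun i _ => ?_
  rw [iteratedFDeriv_two_apply]
  have h1 : HasFDerivAt (fun y => fderiv ℝ f y (EuclideanSpace.single i 1))
      ((ContinuousLinearMap.apply ℝ ℝ (EuclideanSpace.single i (1 : ℝ) : Space n)).comp
        (fderiv ℝ (fderiv ℝ f) x)) x :=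
    (ContinuousLinearMap.apply ℝ ℝ (EuclideanSpace.single i (1 : ℝ) : Space n)).hasFDerivAt.comp x
      (h.differentiable one_ne_zero x).hasFDerivAt
  have h2 : HasFDerivAt (fun y => gradient f y i)
      ((EuclideanSpace.proj (𝕜 := ℝ) i).comp (fderiv ℝ (gradient f) x)) x :=
    (EuclideanSpace.proj (𝕜 := ℝ) i : Space n →L[ℝ] ℝ).hasFDerivAt.comp x
      ((contDiff_gradient hf).differentiable one_ne_zero x).hasFDerivAt
  have h3 : (fun y => gradient f y i) = fun y => fderiv ℝ f y (EuclideanSpace.single i 1) := by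
    funext y
    rw [proj_eq_inner, inner_gradient_eq_fderiv]
  rw [h3] at h2
  have h4 := congrArg (fun T : Space n →L[ℝ] ℝ => T (EuclideanSpace.single i 1)) (h2.unique h1)
  simpa using h4

/-! ### Periodic functions -/

theorem TransversePeriodic.comp {L : ℝ} {F F' : Type*} {f : Space n → F}
    (hf : TransversePeriodic L f) (G : F → F') : TransversePeriodic L (fun x => G (f x)) :=
  fun x i => congrArg G (hf x i)

theorem TransversePeriodic.comp₂ {L : ℝ} {F F' F'' : Type*} {f : Space n → F} {f' : Space n → F'}
    (hf : TransversePeriodic L f) (hf' : TransversePeriodic L f') (G : F → F' → F'') :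
    TransversePeriodic L (fun x => G (f x) (f' x)) := by
  intro x i
  simp only [hf x i, hf' x i]

theorem transversePeriodic_height (L : ℝ) : TransversePeriodic L (height : Space n → ℝ) := by
  intro x i
  rw [height_add, height_single_castSucc, add_zero]

theorem TransversePeriodic.fderiv {L : ℝ} {F : Type*} [NormedAddCommGroup F] [NormedSpace ℝ F]
    {f : Space n → F} (hf : TransversePeriodic L f) : TransversePeriodic L (fderiv ℝ f) := by
  intro x i
  have h : (fun y => f (y + EuclideanSpace.single i.castSucc L)) = f := funext fun y => hf y i
  rw [← fderiv_comp_add_right, h]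

theorem TransversePeriodic.gradient {L : ℝ} {f : Space n → ℝ} (hf : TransversePeriodic L f) :
    TransversePeriodic L (gradient f) :=
  hf.fderiv.comp (InnerProductSpace.toDual ℝ (Space n)).symm

/-! ### Functions of the height used as test functions -/

/-- `φ` is twice continuously differentiable with derivatives `φ₁`, `φ₂`, and all three vanish
where `|z| ≥ R`. -/
structure IsCutoff (R : ℝ) (φ φ₁ φ₂ : ℝ → ℝ) : Prop where
  hasDerivAt : ∀ z, HasDerivAt φ (φ₁ z) z
  hasDerivAt₁ : ∀ z, HasDerivAt φ₁ (φ₂ z) z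
  continuous₂ : Continuous φ₂
  vanish : ∀ z, R ≤ |z| → φ z = 0
  vanish₁ : ∀ z, R ≤ |z| → φ₁ z = 0
  vanish₂ : ∀ z, R ≤ |z| → φ₂ z = 0

theorem contDiff_one_of_hasDerivAt {φ φ₁ : ℝ → ℝ} (h : ∀ z, HasDerivAt φ (φ₁ z) z)
    (hc : Continuous φ₁) : ContDiff ℝ 1 φ := by
  rw [contDiff_one_iff_deriv]
  have : deriv φ = φ₁ := funext fun z => (h z).deriv
  exact ⟨fun z => (h z).differentiableAt, this ▸ hc⟩

theorem IsCutoff.continuous₁ {R : ℝ} {φ φ₁ φ₂ : ℝ → ℝ} (h : IsCutoff R φ φ₁ φ₂) :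
    Continuous φ₁ :=
  continuous_iff_continuousAt.2 fun z => (h.hasDerivAt₁ z).continuousAt

theorem IsCutoff.continuous {R : ℝ} {φ φ₁ φ₂ : ℝ → ℝ} (h : IsCutoff R φ φ₁ φ₂) :
    Continuous φ :=
  continuous_iff_continuousAt.2 fun z => (h.hasDerivAt z).continuousAt

theorem hasFDerivAt_comp_height {φ : ℝ → ℝ} {c : ℝ} {x : Space n}
    (h : HasDerivAt φ c (height x)) :
    HasFDerivAt (fun y => φ (height y)) (c • heightL n) x :=
  h.comp_hasFDerivAt x (hasFDerivAt_height x)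

theorem contDiff_comp_height {φ : ℝ → ℝ} (h : ContDiff ℝ 1 φ) :
    ContDiff ℝ 1 (fun y : Space n => φ (height y)) :=
  h.comp contDiff_height

/-- Integration by parts against a function of the height. -/
theorem integral_column_smul_divergence {L R : ℝ} (hL : 0 ≤ L) {φ φ₁ : ℝ → ℝ}
    (hφ : ∀ z, HasDerivAt φ (φ₁ z) z) (hφ₁ : Continuous φ₁) (hv : ∀ z, R ≤ |z| → φ z = 0)
    (hv₁ : ∀ z, R ≤ |z| → φ₁ z = 0) {W : Space n → Space n} (hW : ContDiff ℝ 1 W)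
    (hper : TransversePeriodic L W) :
    ∫ x in column n L, φ (height x) * divergence W x
      = - ∫ x in column n L, φ₁ (height x) * height (W x) := by
  have hφC : ContDiff ℝ 1 φ := contDiff_one_of_hasDerivAt hφ hφ₁
  have h0 := integral_column_divergence_eq_zero (R := R) hL
    (F := fun x => φ (height x) • W x)
    ((contDiff_comp_height hφC).smul hW)
    ((((transversePeriodic_height L).comp φ).comp₂ hper (fun a b => a • b)))
    (fun x hx => by simp [hv _ hx])
  have hdiv : ∀ x, divergence (fun x => φ (height x) • W x) x
      = φ (height x) * divergence W x + φ₁ (height x) * height (W x) := by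
    intro x
    have h1 := hasFDerivAt_comp_height (hφ (height x))
    rw [divergence_smul h1.differentiableAt (hW.differentiable one_ne_zero x), h1.fderiv]
    simp [heightL_apply]
  have hWc : Continuous (divergence W) := by
    unfold divergence
    refine continuous_finsetSum _ fun i _ => ?_
    exact (EuclideanSpace.proj (𝕜 := ℝ) i).continuous.comp
      ((hW.continuous_fderiv one_ne_zero).clm_apply continuous_const)
  simp_rw [hdiv] at h0
  rw [integral_add] at h0
  · linarith
  · exact integrableOn_column_of_vanishesAbove (R := R) (fun x hx => by simp [hv _ hx])
      ((hφC.continuous.comp continuous_height).mul hWc) L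
  · exact integrableOn_column_of_vanishesAbove (R := R) (fun x hx => by simp [hv₁ _ hx])
      ((hφ₁.comp continuous_height).mul (continuous_height.comp hW.continuous)) L

/-! ### Joint regularity -/

section JointRegularity

variable {E : Type*} [NormedAddCommGroup E] [NormedSpace ℝ E] {f : ℝ → Space n → E}

theorem isOpen_Ioi_prod_univ : IsOpen (Ioi (0 : ℝ) ×ˢ (univ : Set (Space n))) :=
  isOpen_Ioi.prod isOpen_univ

theorem hasFDerivAt_of_contDiffOn
    (hf : ContDiffOn ℝ 1 (fun q : ℝ × Space n => f q.1 q.2) (Ioi 0 ×ˢ univ))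
    {t : ℝ} (ht : 0 < t) (x : Space n) :
    HasFDerivAt (fun q : ℝ × Space n => f q.1 q.2)
      (fderiv ℝ (fun q : ℝ × Space n => f q.1 q.2) (t, x)) (t, x) :=
  ((hf.differentiableOn one_ne_zero).differentiableAt
    (isOpen_Ioi_prod_univ.mem_nhds (mk_mem_prod (mem_Ioi.2 ht) (mem_univ x)))).hasFDerivAt

theorem hasDerivAt_time
    (hf : ContDiffOn ℝ 1 (fun q : ℝ × Space n => f q.1 q.2) (Ioi 0 ×ˢ univ))
    {t : ℝ} (ht : 0 < t) (x : Space n) :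
    HasDerivAt (fun s => f s x) (deriv (fun s => f s x) t) t := by
  have h1 : HasFDerivAt (fun s : ℝ => (s, x)) (ContinuousLinearMap.inl ℝ ℝ (Space n)) t :=
    hasFDerivAt_prodMk_left t x
  exact ((hasFDerivAt_of_contDiffOn hf ht x).comp t h1).differentiableAt.hasDerivAt

theorem deriv_time_eq
    (hf : ContDiffOn ℝ 1 (fun q : ℝ × Space n => f q.1 q.2) (Ioi 0 ×ˢ univ))
    {t : ℝ} (ht : 0 < t) (x : Space n) :
    deriv (fun s => f s x) t = fderiv ℝ (fun q : ℝ × Space n => f q.1 q.2) (t, x) (1, 0) := by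
  have h1 : HasFDerivAt (fun s : ℝ => (s, x)) (ContinuousLinearMap.inl ℝ ℝ (Space n)) t :=
    hasFDerivAt_prodMk_left t x
  have h2 := ((hasFDerivAt_of_contDiffOn hf ht x).comp t h1).hasDerivAt.deriv
  simpa [Function.comp_def] using h2

theorem fderiv_space_eq
    (hf : ContDiffOn ℝ 1 (fun q : ℝ × Space n => f q.1 q.2) (Ioi 0 ×ˢ univ))
    {t : ℝ} (ht : 0 < t) (x : Space n) :
    fderiv ℝ (f t) x = (fderiv ℝ (fun q : ℝ × Space n => f q.1 q.2) (t, x)).comp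
      (ContinuousLinearMap.inr ℝ ℝ (Space n)) :=
  ((hasFDerivAt_of_contDiffOn hf ht x).comp x (hasFDerivAt_prodMk_right t x)).fderiv

theorem continuousOn_deriv_time
    (hf : ContDiffOn ℝ 1 (fun q : ℝ × Space n => f q.1 q.2) (Ioi 0 ×ˢ univ)) :
    ContinuousOn (fun q : ℝ × Space n => deriv (fun s => f s q.2) q.1) (Ioi 0 ×ˢ univ) := by
  have h : ContinuousOn (fun q : ℝ × Space n =>
      fderiv ℝ (fun q : ℝ × Space n => f q.1 q.2) q (1, 0)) (Ioi 0 ×ˢ univ) :=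
    (hf.continuousOn_fderiv_of_isOpen isOpen_Ioi_prod_univ le_rfl).clm_apply continuousOn_const
  exact h.congr fun q hq => deriv_time_eq hf hq.1 q.2

theorem continuousOn_fderiv_space
    (hf : ContDiffOn ℝ 1 (fun q : ℝ × Space n => f q.1 q.2) (Ioi 0 ×ˢ univ)) :
    ContinuousOn (fun q : ℝ × Space n => fderiv ℝ (f q.1) q.2) (Ioi 0 ×ˢ univ) := by
  have h : ContinuousOn (fun q : ℝ × Space n =>
      (fderiv ℝ (fun q : ℝ × Space n => f q.1 q.2) q).comp
      (ContinuousLinearMap.inr ℝ ℝ (Space n))) (Ioi 0 ×ˢ univ) :=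
    (hf.continuousOn_fderiv_of_isOpen isOpen_Ioi_prod_univ le_rfl).clm_comp continuousOn_const
  exact h.congr fun q hq => fderiv_space_eq hf hq.1 q.2

theorem contDiff_space
    (hf : ContDiffOn ℝ 1 (fun q : ℝ × Space n => f q.1 q.2) (Ioi 0 ×ˢ univ))
    {t : ℝ} (ht : 0 < t) : ContDiff ℝ 1 (f t) := by
  rw [← contDiffOn_univ]
  have h : ContDiff ℝ 1 (fun x : Space n => (t, x)) := contDiff_prodMk_right t
  exact hf.comp h.contDiffOn (fun x _ => ⟨ht, mem_univ _⟩)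

end JointRegularity

theorem continuousOn_gradient {f : ℝ → Space n → ℝ}
    (hf : ContDiffOn ℝ 1 (fun q : ℝ × Space n => f q.1 q.2) (Ioi 0 ×ˢ univ)) :
    ContinuousOn (fun q : ℝ × Space n => gradient (f q.1) q.2) (Ioi 0 ×ˢ univ) :=
  (InnerProductSpace.toDual ℝ (Space n)).symm.continuous.comp_continuousOn
    (continuousOn_fderiv_space hf)

theorem continuousOn_height_snd {U : Set (ℝ × Space n)} {φ : ℝ → ℝ} (hφ : Continuous φ) :
    ContinuousOn (fun q : ℝ × Space n => φ (height q.2)) U :=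
  (hφ.comp (continuous_height.comp continuous_snd)).continuousOn

end

noncomputable section

variable {n : ℕ}

/-! ### A family of cutoff functions -/

/-- A fixed smooth bump function on the line. -/
def baseBump : ContDiffBump (0 : ℝ) := ⟨1, 2, one_pos, one_lt_two⟩

/-- The cutoff at scale `R`: equal to `1` for `|z| ≤ R` and to `0` for `|z| ≥ 2 R`. -/
def chi (R z : ℝ) : ℝ := baseBump (z / R)

/-- The first derivative of the cutoff at scale `R`. -/
def chi₁ (R z : ℝ) : ℝ := deriv baseBump (z / R) / R

/-- The second derivative of the cutoff at scale `R`. -/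
def chi₂ (R z : ℝ) : ℝ := deriv (deriv baseBump) (z / R) / R / R

theorem contDiff_baseBump : ContDiff ℝ (1 + 1 + 1) baseBump :=
  baseBump.contDiff (n := 1 + 1 + 1)

theorem contDiff_deriv_baseBump : ContDiff ℝ (1 + 1) (deriv baseBump) :=
  (contDiff_succ_iff_deriv.1 contDiff_baseBump).2.2

theorem contDiff_deriv_deriv_baseBump : ContDiff ℝ 1 (deriv (deriv baseBump)) :=
  (contDiff_succ_iff_deriv.1 contDiff_deriv_baseBump).2.2

theorem chi_nonneg (R z : ℝ) : 0 ≤ chi R z := baseBump.nonneg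

theorem chi_le_one (R z : ℝ) : chi R z ≤ 1 := baseBump.le_one

theorem chi_eq_one {R z : ℝ} (hR : 0 < R) (hz : |z| ≤ R) : chi R z = 1 := by
  apply baseBump.one_of_mem_closedBall
  rw [mem_closedBall_zero_iff, Real.norm_eq_abs, abs_div, abs_of_pos hR]
  exact (div_le_one hR).2 hz

theorem chi_eq_zero {R z : ℝ} (hR : 0 < R) (hz : 2 * R ≤ |z|) : chi R z = 0 := by
  apply baseBump.zero_of_le_dist
  rw [dist_zero_right, Real.norm_eq_abs, abs_div, abs_of_pos hR]
  exact (le_div_iff₀ hR).2 hz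

theorem hasDerivAt_chi (R z : ℝ) : HasDerivAt (chi R) (chi₁ R z) z := by
  have h1 : HasDerivAt baseBump (deriv baseBump (z / R)) (z / R) :=
    (contDiff_baseBump.differentiable (by norm_num) _).hasDerivAt
  have h2 : HasDerivAt (fun z => z / R) (1 / R) z := (hasDerivAt_id z).div_const R
  have := h1.comp z h2
  rw [mul_one_div] at this
  exact this

theorem hasDerivAt_chi₁ (R z : ℝ) : HasDerivAt (chi₁ R) (chi₂ R z) z := by
  have h1 : HasDerivAt (deriv baseBump) (deriv (deriv baseBump) (z / R)) (z / R) :=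
    (contDiff_deriv_baseBump.differentiable (by norm_num) _).hasDerivAt
  have h2 : HasDerivAt (fun z => z / R) (1 / R) z := (hasDerivAt_id z).div_const R
  have := (h1.comp z h2).div_const R
  rw [mul_one_div] at this
  exact this

theorem continuous_chi₂ (R : ℝ) : Continuous (chi₂ R) :=
  ((contDiff_deriv_deriv_baseBump.continuous.comp (continuous_id.div_const R)).div_const R).div_const
    R

theorem chi₁_eq_zero_of_lt {R z : ℝ} (hR : 0 < R) (hz : |z| < R) : chi₁ R z = 0 := by
  have : chi R =ᶠ[𝓝 z] fun _ => 1 := by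
    filter_upwards [(isOpen_lt continuous_abs continuous_const).mem_nhds hz] with y hy
    exact chi_eq_one hR (le_of_lt hy)
  rw [← (hasDerivAt_chi R z).deriv, this.deriv_eq, deriv_const]

theorem chi₂_eq_zero_of_lt {R z : ℝ} (hR : 0 < R) (hz : |z| < R) : chi₂ R z = 0 := by
  have : chi₁ R =ᶠ[𝓝 z] fun _ => 0 := by
    filter_upwards [(isOpen_lt continuous_abs continuous_const).mem_nhds hz] with y hy
    exact chi₁_eq_zero_of_lt hR hy
  rw [← (hasDerivAt_chi₁ R z).deriv, this.deriv_eq, deriv_const]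

theorem chi₁_eq_zero_of_gt {R z : ℝ} (hR : 0 < R) (hz : 2 * R < |z|) : chi₁ R z = 0 := by
  have : chi R =ᶠ[𝓝 z] fun _ => 0 := by
    filter_upwards [(isOpen_lt continuous_const continuous_abs).mem_nhds hz] with y hy
    exact chi_eq_zero hR (le_of_lt hy)
  rw [← (hasDerivAt_chi R z).deriv, this.deriv_eq, deriv_const]

theorem chi₂_eq_zero_of_gt {R z : ℝ} (hR : 0 < R) (hz : 2 * R < |z|) : chi₂ R z = 0 := by
  have : chi₁ R =ᶠ[𝓝 z] fun _ => 0 := by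
    filter_upwards [(isOpen_lt continuous_const continuous_abs).mem_nhds hz] with y hy
    exact chi₁_eq_zero_of_gt hR hy
  rw [← (hasDerivAt_chi₁ R z).deriv, this.deriv_eq, deriv_const]

theorem isCutoff_chi {R : ℝ} (hR : 0 < R) : IsCutoff (3 * R) (chi R) (chi₁ R) (chi₂ R) where
  hasDerivAt := hasDerivAt_chi R
  hasDerivAt₁ := hasDerivAt_chi₁ R
  continuous₂ := continuous_chi₂ R
  vanish z hz := chi_eq_zero hR (by linarith)
  vanish₁ z hz := chi₁_eq_zero_of_gt hR (by linarith)
  vanish₂ z hz := chi₂_eq_zero_of_gt hR (by linarith)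

/-- Scaling gives `C / R` and `C / R / R`. The sharper bound for the second derivative is needed
where it is multiplied by `z`, which is of size `R` on its support; elsewhere `C / R` suffices. -/
theorem exists_bound_chi : ∃ C : ℝ, 1 ≤ C ∧ ∀ R, 1 ≤ R → ∀ z,
    |chi₁ R z| ≤ C / R ∧ |chi₂ R z| ≤ C / R ∧ |chi₂ R z| ≤ C / R / R := by
  have hs1 : HasCompactSupport (deriv baseBump) := baseBump.hasCompactSupport.deriv
  have hs2 : HasCompactSupport (deriv (deriv baseBump)) := hs1.deriv
  obtain ⟨C₁, h₁⟩ := contDiff_deriv_baseBump.continuous.bounded_above_of_compact_support hs1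
  obtain ⟨C₂, h₂⟩ := contDiff_deriv_deriv_baseBump.continuous.bounded_above_of_compact_support hs2
  refine ⟨max 1 (max C₁ C₂), le_max_left _ _, fun R hR z => ?_⟩
  have hR0 : 0 < R := by linarith
  have a1 : |chi₁ R z| ≤ max 1 (max C₁ C₂) / R := by
    rw [chi₁, abs_div, abs_of_pos hR0]
    gcongr
    exact (h₁ _).trans ((le_max_left _ _).trans (le_max_right _ _))
  have a2 : |chi₂ R z| ≤ max 1 (max C₁ C₂) / R / R := by
    rw [chi₂, abs_div, abs_div, abs_of_pos hR0]
    gcongr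
    exact (h₂ _).trans ((le_max_right _ _).trans (le_max_right _ _))
  refine ⟨a1, a2.trans ?_, a2⟩
  exact div_le_self (by positivity) hR

/-- The product of a cutoff and a smooth function is a cutoff. -/
theorem IsCutoff.mul {R : ℝ} {φ φ₁ φ₂ w w₁ w₂ : ℝ → ℝ} (h : IsCutoff R φ φ₁ φ₂)
    (hw : ∀ z, HasDerivAt w (w₁ z) z) (hw₁ : ∀ z, HasDerivAt w₁ (w₂ z) z) (hw₂ : Continuous w₂) :
    IsCutoff R (fun z => φ z * w z) (fun z => φ₁ z * w z + φ z * w₁ z)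
      (fun z => φ₂ z * w z + 2 * (φ₁ z * w₁ z) + φ z * w₂ z) where
  hasDerivAt z := (h.hasDerivAt z).mul (hw z)
  hasDerivAt₁ z := by
    refine (((h.hasDerivAt₁ z).mul (hw z)).add ((h.hasDerivAt z).mul (hw₁ z))).congr_deriv ?_
    ring
  continuous₂ := by
    have a1 := h.continuous
    have a2 := h.continuous₁
    have a3 := h.continuous₂
    have a4 : Continuous w := continuous_iff_continuousAt.2 fun z => (hw z).continuousAt
    have a5 : Continuous w₁ := continuous_iff_continuousAt.2 fun z => (hw₁ z).continuousAt
    fun_prop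
  vanish z hz := by simp [h.vanish z hz]
  vanish₁ z hz := by simp [h.vanish z hz, h.vanish₁ z hz]
  vanish₂ z hz := by simp [h.vanish z hz, h.vanish₁ z hz, h.vanish₂ z hz]

theorem abs_integral_column_le {L R B : ℝ} (hL : 0 ≤ L) (hR : 0 ≤ R) {f : Space n → ℝ}
    (hv : VanishesAbove R f) (hB : ∀ x ∈ column n L, |f x| ≤ B) :
    |∫ x in column n L, f x| ≤ B * (2 * R * L ^ n) := by
  rw [integral_column_eq_slab hv, ← Real.norm_eq_abs, ← volume_real_slab hL hR]
  exact norm_setIntegral_le_of_norm_le_const (volume_slab_lt_top L R) (fun x hx => hB x hx.1)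

/-! ### Divergence-free fields have no net vertical flux -/

/-- Write `f` as the derivative of a bounded function `F` and test the divergence against `F` times
a cutoff at height `r`. The error lives where `r ≤ |z| ≤ 2 r`: a region of volume of order `r`, a
cutoff derivative of order `1 / r`, and a velocity at most `ε`. As `F` need not decay, it is the
decay of `v` that makes the error small. -/
theorem integral_column_flux_eq_zero {L : ℝ} (hL : 0 ≤ L) {v : Space n → Space n}
    (hv : ContDiff ℝ 1 v) (hper : TransversePeriodic L v) (hdiv : ∀ x, divergence v x = 0)
    (hdecay : ∀ ε : ℝ, 0 < ε → ∃ R : ℝ, ∀ x, R ≤ |height x| → ‖v x‖ ≤ ε)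
    {f : ℝ → ℝ} {R : ℝ} (hf : Continuous f) (hfR : ∀ z, R ≤ |z| → f z = 0) :
    ∫ x in column n L, f (height x) * height (v x) = 0 := by
  obtain ⟨C, hC1, hC⟩ := exists_bound_chi
  have hfs : HasCompactSupport f := by
    refine HasCompactSupport.of_support_subset_isCompact (isCompact_Icc (a := -R) (b := R)) ?_
    intro z hz
    by_contra h
    refine hz (hfR z ?_)
    by_contra h'
    exact h (abs_le.1 (not_le.1 h').le)
  have hfi : Integrable f := hf.integrable_of_hasCompactSupport hfs
  set F : ℝ → ℝ := fun z => ∫ s in (0 : ℝ)..z, f s with hF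
  have hFd : ∀ z, HasDerivAt F (f z) z := fun z =>
    intervalIntegral.integral_hasDerivAt_right (hf.intervalIntegrable _ _)
      (hf.stronglyMeasurableAtFilter _ _) hf.continuousAt
  have hFb : ∀ z, |F z| ≤ ∫ s, |f s| := by
    intro z
    rw [← Real.norm_eq_abs]
    refine (intervalIntegral.norm_integral_le_integral_norm_uIoc (f := f)).trans ?_
    exact setIntegral_le_integral hfi.norm (Eventually.of_forall fun s => norm_nonneg _)
  set B := ∫ s, |f s|
  have hB : 0 ≤ B := integral_nonneg fun s => abs_nonneg _
  have key : ∀ ε : ℝ, 0 < ε → |∫ x in column n L, f (height x) * height (v x)|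
      ≤ ε * (B * C * (6 * L ^ n)) := by
    intro ε hε
    obtain ⟨R₀, hR₀⟩ := hdecay ε hε
    set r := max 1 (max R R₀)
    have hr1 : 1 ≤ r := le_max_left _ _
    have hr0 : 0 < r := by linarith
    have hrR : R ≤ r := (le_max_left _ _).trans (le_max_right _ _)
    have hrR₀ : R₀ ≤ r := (le_max_right _ _).trans (le_max_right _ _)
    have hc := isCutoff_chi hr0
    have hFc : Continuous F := continuous_iff_continuousAt.2 fun z => (hFd z).continuousAt
    have h1 := integral_column_smul_divergence (R := 3 * r) hL
      (φ := fun z => chi r z * F z) (φ₁ := fun z => chi₁ r z * F z + chi r z * f z)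
      (fun z => (hc.hasDerivAt z).mul (hFd z))
      ((hc.continuous₁.mul hFc).add (hc.continuous.mul hf))
      (fun z hz => by simp [hc.vanish z hz])
      (fun z hz => by simp [hc.vanish z hz, hc.vanish₁ z hz]) hv hper
    simp only [hdiv, mul_zero, integral_zero] at h1
    -- The cutoff equals one on the support of `f`, so only its derivative produces an error.
    have hchif : ∀ z, chi r z * f z = f z := by
      intro z
      by_cases hz : |z| ≤ r
      · rw [chi_eq_one hr0 hz, one_mul]
      · rw [hfR z (by linarith), mul_zero]
    simp only [hchif, add_mul] at h1
    have hvc := continuous_height.comp hv.continuous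
    rw [integral_add] at h1
    rotate_left
    · exact integrableOn_column_of_vanishesAbove (R := 3 * r)
        (fun x hx => by simp [hc.vanish₁ _ hx])
        (((hc.continuous₁.mul hFc).comp continuous_height).mul hvc) L
    · exact integrableOn_column_of_vanishesAbove (R := R)
        (fun x hx => by simp [hfR _ hx]) ((hf.comp continuous_height).mul hvc) L
    have h2 : |∫ x in column n L, chi₁ r (height x) * F (height x) * height (v x)|
        ≤ (C / r * B * ε) * (2 * (3 * r) * L ^ n) := by
      refine abs_integral_column_le hL (by positivity)
        (fun x hx => by simp [hc.vanish₁ _ hx]) (fun x _ => ?_)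
      by_cases hx : |height x| < r
      · rw [chi₁_eq_zero_of_lt hr0 hx]
        simp; positivity
      · rw [abs_mul, abs_mul]
        gcongr
        · exact (hC r hr1 _).1
        · exact hFb _
        · exact (abs_height_le _).trans (hR₀ x (by linarith))
    have h3 : (C / r * B * ε) * (2 * (3 * r) * L ^ n) = ε * (B * C * (6 * L ^ n)) := by
      field_simp; ring
    rw [h3] at h2
    have h4 : ∫ x in column n L, f (height x) * height (v x)
        = - ∫ x in column n L, chi₁ r (height x) * F (height x) * height (v x) := by linarith
    rw [h4, abs_neg]
    exact h2
  have hlim : Tendsto (fun ε : ℝ => ε * (B * C * (6 * L ^ n))) (𝓝[>] 0) (𝓝 0) := by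
    have : Tendsto (fun ε : ℝ => ε * (B * C * (6 * L ^ n))) (𝓝 0) (𝓝 (0 * (B * C * (6 * L ^ n)))) :=
      (continuous_id.mul continuous_const).tendsto 0
    rw [zero_mul] at this
    exact this.mono_left nhdsWithin_le_nhds
  have := ge_of_tendsto hlim (eventually_nhdsWithin_of_forall key)
  exact abs_nonpos_iff.1 this

end

noncomputable section

variable {n : ℕ}

/-! ### Evolution of localized integrals along a solution -/

theorem integrableOn_column_cutoff_mul {R : ℝ} {φ : ℝ → ℝ} (hφ : Continuous φ)
    (hv : ∀ z, R ≤ |z| → φ z = 0) {f : Space n → ℝ} (hf : Continuous f) (L : ℝ) :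
    IntegrableOn (fun x => φ (height x) * f x) (column n L) :=
  integrableOn_column_of_vanishesAbove (R := R) (fun x hx => by simp [hv _ hx])
    ((hφ.comp continuous_height).mul hf) L

theorem divergence_comp_smul_gradient {r : Space n → ℝ} (hr : ContDiff ℝ 2 r) {G G₁ : ℝ → ℝ}
    (hG : ∀ s, HasDerivAt G (G₁ s) s) (x : Space n) :
    divergence (fun y => G (r y) • gradient r y) x
      = G (r x) * Laplacian.laplacian r x + G₁ (r x) * ‖gradient r x‖ ^ 2 := by
  have hr1 : DifferentiableAt ℝ r x := hr.differentiable two_ne_zero x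
  have h1 : HasFDerivAt (fun y => G (r y)) (G₁ (r x) • fderiv ℝ r x) x :=
    (hG (r x)).comp_hasFDerivAt x hr1.hasFDerivAt
  rw [divergence_smul h1.differentiableAt ((contDiff_gradient hr).differentiable one_ne_zero x),
    divergence_gradient hr, h1.fderiv]
  simp [fderiv_gradient_self]

theorem divergence_comp_smul {r : Space n → ℝ} {v : Space n → Space n} {x : Space n}
    (hr : DifferentiableAt ℝ r x) (hv : DifferentiableAt ℝ v x) {G G₁ : ℝ → ℝ}
    (hG : ∀ s, HasDerivAt G (G₁ s) s) :
    divergence (fun y => G (r y) • v y) x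
      = G (r x) * divergence v x + G₁ (r x) * fderiv ℝ r x (v x) := by
  have h1 : HasFDerivAt (fun y => G (r y)) (G₁ (r x) • fderiv ℝ r x) x :=
    (hG (r x)).comp_hasFDerivAt x hr.hasFDerivAt
  rw [divergence_smul h1.differentiableAt hv, h1.fderiv]
  simp

variable {L g rhoM rhoP : ℝ} {ρ : ℝ → Space n → ℝ} {u : ℝ → Space n → Space n}
  {p : ℝ → Space n → ℝ}

theorem IsClassicalSolution.deriv_rho (h : IsClassicalSolution L g rhoM rhoP ρ u p) {t : ℝ}
    (ht : 0 < t) (x : Space n) :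
    deriv (fun s => ρ s x) t
      = Laplacian.laplacian (ρ t) x - fderiv ℝ (ρ t) x (u t x) := by
  have := h.transport t ht x
  rw [inner_gradient_eq_fderiv'] at this
  linarith

theorem IsClassicalSolution.contDiff_u_space (h : IsClassicalSolution L g rhoM rhoP ρ u p) {t : ℝ}
    (ht : 0 < t) : ContDiff ℝ 1 (u t) := contDiff_space h.contDiff_u ht

/-- The renormalized transport equation: G(ρ)_t is the divergence of G'(ρ) ∇ρ - G(ρ) u, minus G''(ρ)
|∇ρ|². One integration by parts moves the divergence onto the cutoff. A second one removes the
gradient of ρ, leaving the second derivative of the cutoff. It is used with convex `G` for the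
maximum principle, with the identity for the moments and the potential energy, and with a concave
quadratic for the mixing entropy. -/
theorem IsClassicalSolution.hasDerivAt_integral_comp
    (h : IsClassicalSolution L g rhoM rhoP ρ u p) (hL : 0 ≤ L) {R : ℝ} {φ φ₁ φ₂ : ℝ → ℝ}
    (hφ : IsCutoff R φ φ₁ φ₂) {G G₁ G₂ : ℝ → ℝ} (hG : ∀ s, HasDerivAt G (G₁ s) s)
    (hG₁ : ∀ s, HasDerivAt G₁ (G₂ s) s) (hG₂ : Continuous G₂) {t : ℝ} (ht : 0 < t) :
    HasDerivAt (fun s => ∫ x in column n L, φ (height x) * G (ρ s x))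
      ((∫ x in column n L, G (ρ t x) * (φ₂ (height x) + height (u t x) * φ₁ (height x)))
        - ∫ x in column n L, φ (height x) * (G₂ (ρ t x) * ‖gradient (ρ t) x‖ ^ 2)) t := by
  have hGc : Continuous G := continuous_iff_continuousAt.2 fun s => (hG s).continuousAt
  have hG₁c : Continuous G₁ := continuous_iff_continuousAt.2 fun s => (hG₁ s).continuousAt
  have hGC : ContDiff ℝ 1 G := contDiff_one_of_hasDerivAt hG hG₁c
  have hG₁C : ContDiff ℝ 1 G₁ := contDiff_one_of_hasDerivAt hG₁ hG₂
  have hρc : ContinuousOn (fun q : ℝ × Space n => ρ q.1 q.2) (Ioi 0 ×ˢ univ) :=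
    h.contDiff_rho.continuousOn
  have h1 := hasDerivAt_integral_column (R := R) isOpen_Ioi (U := Ioi 0)
    (f := fun s x => φ (height x) * G (ρ s x))
    (f' := fun s x => φ (height x) * (G₁ (ρ s x) * deriv (fun s => ρ s x) s))
    ((continuousOn_height_snd hφ.continuous).mul (hGc.comp_continuousOn hρc))
    ((continuousOn_height_snd hφ.continuous).mul
      ((hG₁c.comp_continuousOn hρc).mul (continuousOn_deriv_time h.contDiff_rho)))
    (fun s x hx => by simp [hφ.vanish _ hx]) (fun s x hx => by simp [hφ.vanish _ hx])
    (fun s hs x => ((hG _).comp s (hasDerivAt_time h.contDiff_rho hs x)).const_mul _)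
    L ht
  refine h1.congr_deriv ?_
  have hρ2 := h.contDiff_rho_space t ht
  have hρ1 : ContDiff ℝ 1 (ρ t) := hρ2.of_le (by norm_num)
  have hu1 := h.contDiff_u_space ht
  have hgr := contDiff_gradient hρ2
  have hGρ : ContDiff ℝ 1 (fun x => G (ρ t x)) := hGC.comp hρ1
  have hG₁ρ : ContDiff ℝ 1 (fun x => G₁ (ρ t x)) := hG₁C.comp hρ1
  have hpρ := h.periodic_rho t ht.le
  have hpu := h.periodic_u t ht.le
  have hA : ContDiff ℝ 1 (fun x => G₁ (ρ t x) • gradient (ρ t) x) := hG₁ρ.smul hgr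
  have hB : ContDiff ℝ 1 (fun x => G (ρ t x) • u t x) := hGρ.smul hu1
  have hE : ContDiff ℝ 1 (fun x => G (ρ t x) • ez n) := hGρ.smul contDiff_const
  have e1 := integral_column_smul_divergence hL hφ.hasDerivAt hφ.continuous₁ hφ.vanish hφ.vanish₁
    (hA.sub hB)
    (((hpρ.comp₂ hpρ.gradient (fun a b => G₁ a • b)).comp₂
      (hpρ.comp₂ hpu (fun a b => G a • b)) (fun a b => a - b)))
  have e2 := integral_column_smul_divergence hL hφ.hasDerivAt₁ hφ.continuous₂ hφ.vanish₁ hφ.vanish₂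
    hE (hpρ.comp (fun a => G a • ez n))
  have d1 : ∀ x, divergence (fun x => G₁ (ρ t x) • gradient (ρ t) x - G (ρ t x) • u t x) x
      = G₁ (ρ t x) * deriv (fun s => ρ s x) t + G₂ (ρ t x) * ‖gradient (ρ t) x‖ ^ 2 := by
    intro x
    rw [divergence_sub (hA.differentiable one_ne_zero x) (hB.differentiable one_ne_zero x),
      divergence_comp_smul_gradient hρ2 hG₁,
      divergence_comp_smul (hρ1.differentiable one_ne_zero x) (hu1.differentiable one_ne_zero x) hG,
      h.incompressible t ht, h.deriv_rho ht]
    ring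
  have d2 : ∀ x, divergence (fun x => G (ρ t x) • ez n) x = G₁ (ρ t x) * height (gradient (ρ t) x) := by
    intro x
    rw [divergence_comp_smul (hρ1.differentiable one_ne_zero x) (differentiableAt_const _) hG,
      divergence_const, height_gradient]
    ring
  have hhA : ∀ x, height (G₁ (ρ t x) • gradient (ρ t) x - G (ρ t x) • u t x)
      = G₁ (ρ t x) * height (gradient (ρ t) x) - G (ρ t x) * height (u t x) := fun x => rfl
  have hhE : ∀ x, height (G (ρ t x) • ez n) = G (ρ t x) := by
    intro x; rw [height_smul, height_ez, mul_one]
  simp only [d1, hhA] at e1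
  simp only [d2, hhE] at e2
  have cG₁ := hG₁ρ.continuous
  have cG := hGρ.continuous
  have cgr := hgr.continuous
  have cu : Continuous (fun x => height (u t x)) := continuous_height.comp hu1.continuous
  have cgrz : Continuous (fun x => height (gradient (ρ t) x)) :=
    continuous_height.comp hgr.continuous
  have cG₂ : Continuous (fun x => G₂ (ρ t x) * ‖gradient (ρ t) x‖ ^ 2) :=
    (hG₂.comp hρ1.continuous).mul (cgr.norm.pow 2)
  have cdt : Continuous (fun x => deriv (fun s => ρ s x) t) :=
    continuous_slice (f := fun t x => deriv (fun s => ρ s x) t)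
      (continuousOn_deriv_time h.contDiff_rho) (U := Ioi 0) ht
  have i1 := integrableOn_column_cutoff_mul hφ.continuous hφ.vanish (cG₁.fun_mul cdt) L
  have i2 := integrableOn_column_cutoff_mul hφ.continuous hφ.vanish cG₂ L
  have i3 := integrableOn_column_cutoff_mul hφ.continuous₁ hφ.vanish₁ (cG₁.fun_mul cgrz) L
  have i4 := integrableOn_column_cutoff_mul hφ.continuous₁ hφ.vanish₁ (cG.fun_mul cu) L
  have i5 := integrableOn_column_cutoff_mul hφ.continuous₂ hφ.vanish₂ cG L
  simp only [mul_add, mul_sub] at e1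
  rw [integral_add i1 i2, integral_sub i3 i4] at e1
  have e3 : ∫ x in column n L, G (ρ t x) * (φ₂ (height x) + height (u t x) * φ₁ (height x))
      = (∫ x in column n L, φ₂ (height x) * G (ρ t x))
        + ∫ x in column n L, φ₁ (height x) * (G (ρ t x) * height (u t x)) := by
    rw [← integral_add i5 i4]
    refine integral_congr_ae (Eventually.of_forall fun x => ?_)
    ring
  rw [e3]
  linarith

/-- The unusual term (∇ρ·∇)u is what makes the energy balance exact: paired with u it gives
∇ρ·∇(|u|²/2), which combines with |u|² Δρ / 2 from the density equation into the divergence of |u|²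
∇ρ / 2. Only fluxes and the work of gravity remain. -/
theorem IsClassicalSolution.hasDerivAt_kinetic
    (h : IsClassicalSolution L g rhoM rhoP ρ u p) (hL : 0 ≤ L) {R : ℝ} {φ φ₁ φ₂ : ℝ → ℝ}
    (hφ : IsCutoff R φ φ₁ φ₂) {t : ℝ} (ht : 0 < t) :
    HasDerivAt (fun s => ∫ x in column n L, φ (height x) * (1 / 2 * ρ s x * ‖u s x‖ ^ 2))
      (-(∫ x in column n L, φ₁ (height x) * (1 / 2 * ‖u t x‖ ^ 2 * height (gradient (ρ t) x)
          - 1 / 2 * ρ t x * ‖u t x‖ ^ 2 * height (u t x) - p t x * height (u t x)))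
        - g * ∫ x in column n L, φ (height x) * (ρ t x * height (u t x))) t := by
  have hρc : ContinuousOn (fun q : ℝ × Space n => ρ q.1 q.2) (Ioi 0 ×ˢ univ) :=
    h.contDiff_rho.continuousOn
  have huc : ContinuousOn (fun q : ℝ × Space n => u q.1 q.2) (Ioi 0 ×ˢ univ) :=
    h.contDiff_u.continuousOn
  have h1 := hasDerivAt_integral_column (R := R) isOpen_Ioi (U := Ioi 0)
    (f := fun s x => φ (height x) * (1 / 2 * ρ s x * ‖u s x‖ ^ 2))
    (f' := fun s x => φ (height x) * (1 / 2 * deriv (fun s => ρ s x) s * ‖u s x‖ ^ 2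
      + 1 / 2 * ρ s x * (2 * inner ℝ (u s x) (deriv (fun s => u s x) s))))
    ((continuousOn_height_snd hφ.continuous).mul
      ((continuousOn_const.mul hρc).mul (huc.norm.pow 2)))
    ((continuousOn_height_snd hφ.continuous).mul
      (((continuousOn_const.mul (continuousOn_deriv_time h.contDiff_rho)).mul (huc.norm.pow 2)).add
        ((continuousOn_const.mul hρc).mul (continuousOn_const.mul
          (huc.inner (continuousOn_deriv_time h.contDiff_u))))))
    (fun s x hx => by simp [hφ.vanish _ hx]) (fun s x hx => by simp [hφ.vanish _ hx])
    (fun s hs x => (((hasDerivAt_time h.contDiff_rho hs x).const_mul _).mul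
      (hasDerivAt_time h.contDiff_u hs x).norm_sq).const_mul _)
    L ht
  refine h1.congr_deriv ?_
  have hρ2 := h.contDiff_rho_space t ht
  have hρ1 : ContDiff ℝ 1 (ρ t) := hρ2.of_le (by norm_num)
  have hu1 := h.contDiff_u_space ht
  have hp1 := h.contDiff_p t ht
  have hgr := contDiff_gradient hρ2
  have hpρ := h.periodic_rho t ht.le
  have hpu := h.periodic_u t ht.le
  have hpp := h.periodic_p t ht
  have hn : ContDiff ℝ 1 (fun x => 1 / 2 * ‖u t x‖ ^ 2) := contDiff_const.mul (hu1.norm_sq ℝ)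
  have hn' : ContDiff ℝ 1 (fun x => 1 / 2 * ‖u t x‖ ^ 2 * ρ t x + p t x) := (hn.mul hρ1).add hp1
  have hA : ContDiff ℝ 1 (fun x => (1 / 2 * ‖u t x‖ ^ 2) • gradient (ρ t) x) := hn.smul hgr
  have hB : ContDiff ℝ 1 (fun x => (1 / 2 * ‖u t x‖ ^ 2 * ρ t x + p t x) • u t x) := hn'.smul hu1
  have e1 := integral_column_smul_divergence hL hφ.hasDerivAt hφ.continuous₁ hφ.vanish hφ.vanish₁
    (hA.sub hB)
    (((hpu.comp₂ hpρ.gradient (fun a b => (1 / 2 * ‖a‖ ^ 2) • b)).comp₂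
      (((hpu.comp₂ hpρ (fun a b => 1 / 2 * ‖a‖ ^ 2 * b)).comp₂ hpp (fun a b => a + b)).comp₂ hpu
        (fun a b => a • b)) (fun a b => a - b)))
  have dn : ∀ x, HasFDerivAt (fun x => 1 / 2 * ‖u t x‖ ^ 2)
      ((innerSL ℝ (u t x)).comp (fderiv ℝ (u t) x)) x := by
    intro x
    have := ((hu1.differentiable one_ne_zero x).hasFDerivAt.norm_sq).const_mul (1 / 2)
    refine this.congr_fderiv ?_
    ext v
    simp
  have d1 : ∀ x, divergence (fun x => (1 / 2 * ‖u t x‖ ^ 2) • gradient (ρ t) x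
        - (1 / 2 * ‖u t x‖ ^ 2 * ρ t x + p t x) • u t x) x
      = 1 / 2 * deriv (fun s => ρ s x) t * ‖u t x‖ ^ 2
      + 1 / 2 * ρ t x * (2 * inner ℝ (u t x) (deriv (fun s => u s x) t))
      + g * (ρ t x * height (u t x)) := by
    intro x
    -- The momentum equation is paired with the velocity.
    have hm := congrArg (fun v => inner ℝ (u t x) v) (h.momentum t ht x)
    simp only [inner_add_right, inner_sub_right, inner_smul_right, inner_zero_right] at hm
    rw [inner_gradient_eq_fderiv', ← height_eq_inner_ez] at hm
    have dρ := (hρ1.differentiable one_ne_zero x).hasFDerivAt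
    have dp := (hp1.differentiable one_ne_zero x).hasFDerivAt
    rw [divergence_sub (hA.differentiable one_ne_zero x) (hB.differentiable one_ne_zero x),
      divergence_smul (dn x).differentiableAt (hgr.differentiable one_ne_zero x),
      divergence_smul (hn'.differentiable one_ne_zero x) (hu1.differentiable one_ne_zero x),
      divergence_gradient hρ2, h.incompressible t ht, h.deriv_rho ht, (dn x).fderiv,
      (((dn x).fun_mul dρ).fun_add dp).fderiv]
    simp only [add_apply, smul_apply, smul_eq_mul, ContinuousLinearMap.comp_apply,
      innerSL_apply_apply]
    linarith
  have hh : ∀ x, height ((1 / 2 * ‖u t x‖ ^ 2) • gradient (ρ t) x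
        - (1 / 2 * ‖u t x‖ ^ 2 * ρ t x + p t x) • u t x)
      = 1 / 2 * ‖u t x‖ ^ 2 * height (gradient (ρ t) x)
          - 1 / 2 * ρ t x * ‖u t x‖ ^ 2 * height (u t x) - p t x * height (u t x) := by
    intro x
    have : height ((1 / 2 * ‖u t x‖ ^ 2) • gradient (ρ t) x
        - (1 / 2 * ‖u t x‖ ^ 2 * ρ t x + p t x) • u t x)
      = (1 / 2 * ‖u t x‖ ^ 2) * height (gradient (ρ t) x)
        - (1 / 2 * ‖u t x‖ ^ 2 * ρ t x + p t x) * height (u t x) := rfl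
    rw [this]; ring
  simp only [d1, hh] at e1
  have cu := hu1.continuous
  have cρ := hρ1.continuous
  have cuz : Continuous (fun x => height (u t x)) := continuous_height.comp hu1.continuous
  have cρt : Continuous (fun x => deriv (fun s => ρ s x) t) :=
    continuous_slice (f := fun t x => deriv (fun s => ρ s x) t)
      (continuousOn_deriv_time h.contDiff_rho) (U := Ioi 0) ht
  have cut : Continuous (fun x => deriv (fun s => u s x) t) :=
    continuous_slice (f := fun t x => deriv (fun s => u s x) t)
      (continuousOn_deriv_time h.contDiff_u) (U := Ioi 0) ht
  have c1 : Continuous (fun x => 1 / 2 * deriv (fun s => ρ s x) t * ‖u t x‖ ^ 2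
      + 1 / 2 * ρ t x * (2 * inner ℝ (u t x) (deriv (fun s => u s x) t))) := by fun_prop
  have c2 : Continuous (fun x => g * (ρ t x * height (u t x))) := by fun_prop
  have i1 := integrableOn_column_cutoff_mul hφ.continuous hφ.vanish c1 L
  have i2 := integrableOn_column_cutoff_mul hφ.continuous hφ.vanish c2 L
  have e2 : ∫ x in column n L, φ (height x) * (g * (ρ t x * height (u t x)))
      = g * ∫ x in column n L, φ (height x) * (ρ t x * height (u t x)) := by
    rw [← integral_const_mul]
    refine integral_congr_ae (Eventually.of_forall fun x => ?_)
    simp only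
    ring
  simp only [mul_add (φ (height _)) _ (g * _)] at e1
  rw [integral_add i1 i2] at e1
  rw [e2] at e1
  linarith

end

noncomputable section

variable {n : ℕ}

/-! ### Horizontal translations and horizontal means -/

theorem TransversePeriodic.comp_add_right {L : ℝ} {F : Type*} {f : Space n → F}
    (hf : TransversePeriodic L f) (a : Space n) : TransversePeriodic L (fun x => f (x + a)) := by
  intro x i
  show f (x + EuclideanSpace.single i.castSucc L + a) = f (x + a)
  rw [add_right_comm, hf]

/-- Along the translates by `s • a` the integral has derivative zero: the directional derivative of
`f` is the divergence of `f • a`, and integrating by parts leaves only the vertical component of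
`a`. -/
theorem integral_column_translate {L R : ℝ} (hL : 0 ≤ L) {φ φ₁ φ₂ : ℝ → ℝ}
    (hφ : IsCutoff R φ φ₁ φ₂) {f : Space n → ℝ} (hf : ContDiff ℝ 1 f)
    (hper : TransversePeriodic L f) {a : Space n} (ha : height a = 0) :
    ∫ x in column n L, φ (height x) * f (x + a) = ∫ x in column n L, φ (height x) * f x := by
  have hfc := hf.continuous
  have hfd := hf.continuous_fderiv one_ne_zero
  have hd : ∀ s : ℝ, ∀ x, HasDerivAt (fun s : ℝ => f (x + s • a)) (fderiv ℝ f (x + s • a) a) s := by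
    intro s x
    have h1 : HasDerivAt (fun s : ℝ => x + s • a) a s := by
      simpa using ((hasDerivAt_id s).smul_const a).const_add x
    exact (hf.differentiable one_ne_zero _).hasFDerivAt.comp_hasDerivAt s h1
  have key : ∀ s : ℝ, HasDerivAt (fun s : ℝ => ∫ x in column n L, φ (height x) * f (x + s • a)) 0 s := by
    intro s
    have h1 := hasDerivAt_integral_column (R := R) isOpen_univ (U := univ)
      (f := fun s x => φ (height x) * f (x + s • a))
      (f' := fun s x => φ (height x) * fderiv ℝ f (x + s • a) a)
      ((continuousOn_height_snd hφ.continuous).mul (by fun_prop))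
      ((continuousOn_height_snd hφ.continuous).mul (by fun_prop))
      (fun s x hx => by simp [hφ.vanish _ hx]) (fun s x hx => by simp [hφ.vanish _ hx])
      (fun s _ x => (hd s x).const_mul _) L (mem_univ s)
    refine h1.congr_deriv ?_
    have hfs : ContDiff ℝ 1 (fun x => f (x + s • a)) := hf.comp (contDiff_id.add contDiff_const)
    have h2 := integral_column_smul_divergence hL hφ.hasDerivAt hφ.continuous₁ hφ.vanish hφ.vanish₁
      (W := fun x => f (x + s • a) • a) (hfs.smul contDiff_const)
      ((hper.comp_add_right (s • a)).comp (fun b => b • a))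
    have h3 : ∀ x, divergence (fun x => f (x + s • a) • a) x = fderiv ℝ f (x + s • a) a := by
      intro x
      rw [divergence_smul (hfs.differentiable one_ne_zero x) (differentiableAt_const _),
        divergence_const, fderiv_comp_add_right]
      ring
    simpa [h3, height_smul, ha] using h2
  have := is_const_of_deriv_eq_zero (fun s => (key s).differentiableAt) (fun s => (key s).deriv) 1 0
  simpa using this

/-- The horizontal part of a vector, as a continuous linear map. -/
def horizontal (n : ℕ) : Space n →L[ℝ] Space n :=
  ContinuousLinearMap.id ℝ (Space n) - (heightL n).smulRight (ez n)

theorem horizontal_apply (x : Space n) : horizontal n x = x - height x • ez n := rfl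

theorem height_horizontal (x : Space n) : height (horizontal n x) = 0 := by
  have : height (horizontal n x) = height x - height x * height (ez n) := rfl
  rw [this, height_ez]; ring

theorem horizontal_of_height_eq_zero {x : Space n} (hx : height x = 0) : horizontal n x = x := by
  simp [horizontal_apply, hx]

/-- The total weight used to define horizontal means. -/
def meanWeight (n : ℕ) (L : ℝ) : ℝ := ∫ x in column n L, chi 1 (height x)

/-- The mean of `f` over horizontal translates. -/
def horizontalMean (L : ℝ) (f : Space n → ℝ) (x : Space n) : ℝ :=
  (meanWeight n L)⁻¹ * ∫ s in column n L, chi 1 (height s) * f (x + horizontal n s)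

theorem integrableOn_column_chi {R : ℝ} (hR : 0 < R) (L : ℝ) :
    IntegrableOn (fun x => chi R (height x)) (column n L) :=
  integrableOn_column_of_vanishesAbove (R := 3 * R) (fun _ hx => (isCutoff_chi hR).vanish _ hx)
    ((isCutoff_chi hR).continuous.comp continuous_height) L

theorem meanWeight_pos {L : ℝ} (hL : 0 < L) : 0 < meanWeight n L := by
  have h1 : ∫ x in slab n L 1, chi 1 (height x) ≤ meanWeight n L :=
    setIntegral_mono_set (integrableOn_column_chi one_pos L)
      (Eventually.of_forall fun x => chi_nonneg _ _)
      (slab_subset_column L 1).eventuallyLE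
  have h2 : ∫ x in slab n L 1, chi 1 (height x) = ∫ x in slab n L 1, (1 : ℝ) :=
    setIntegral_congr_fun (measurableSet_slab L 1) fun x hx => chi_eq_one one_pos hx.2
  rw [h2, setIntegral_const, smul_eq_mul, mul_one, Measure.real,
    volume_real_slab hL.le zero_le_one] at h1
  have : 0 < L ^ n := by positivity
  linarith

/-- A horizontal shift of `x` can be moved into the averaging variable, where translation invariance
removes it. Averaging over the whole column with a smooth weight in the height lets the earlier
translation lemma apply directly, without a separate integral over the cross-section. -/
theorem horizontalMean_add {L : ℝ} (hL : 0 ≤ L) {f : Space n → ℝ} (hf : ContDiff ℝ 1 f)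
    (hper : TransversePeriodic L f) (x : Space n) {a : Space n} (ha : height a = 0) :
    horizontalMean L f (x + a) = horizontalMean L f x := by
  unfold horizontalMean
  congr 1
  have h := integral_column_translate hL (isCutoff_chi one_pos)
    (f := fun s => f (x + horizontal n s))
    (hf.comp (contDiff_const.add (horizontal n).contDiff)) ?_ ha
  · rw [← h]
    refine integral_congr_ae (Eventually.of_forall fun s => ?_)
    simp only [map_add, horizontal_of_height_eq_zero ha]
    congr 2
    abel
  · intro s i
    simp only [map_add, horizontal_of_height_eq_zero (height_single_castSucc i L)]
    rw [← add_assoc, hper]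

theorem horizontalMean_eq {L : ℝ} (hL : 0 ≤ L) {f : Space n → ℝ} (hf : ContDiff ℝ 1 f)
    (hper : TransversePeriodic L f) (x : Space n) :
    horizontalMean L f x = horizontalMean L f (height x • ez n) := by
  rw [← horizontalMean_add hL hf hper (height x • ez n) (height_horizontal x), horizontal_apply]
  congr 1
  abel

theorem continuous_horizontalMean {L : ℝ} {f : Space n → ℝ} (hf : Continuous f) :
    Continuous (horizontalMean L f) := by
  unfold horizontalMean
  have hc := (isCutoff_chi one_pos)
  have h : ∀ x, VanishesAbove (3 * 1) (fun s : Space n => chi 1 (height s) * f (x + horizontal n s)) :=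
    fun x s hs => by simp only [hc.vanish _ hs, zero_mul]
  simp_rw [integral_column_eq_slab (h _)]
  refine continuous_const.mul (continuous_parametric_integral_of_continuous ?_ (isCompact_slab _ _))
  exact ((hc.continuous.comp continuous_height).comp continuous_snd).mul
    (hf.comp (continuous_fst.add ((horizontal n).continuous.comp continuous_snd)))

theorem exists_bound_horizontal (n : ℕ) (L : ℝ) :
    ∃ D : ℝ, 0 < D ∧ ∀ s ∈ slab n L 3, ‖horizontal n s‖ ≤ D := by
  obtain ⟨D, hD⟩ := (isCompact_slab (n := n) L 3).exists_bound_of_continuousOn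
    (horizontal n).continuous.continuousOn
  exact ⟨max D 1, by positivity, fun s hs => (hD s hs).trans (le_max_left _ _)⟩

/-- The mean value inequality, averaged over the shifts. It is applied to the pressure, of which
only the gradient is bounded. The weight vanishes at heights of modulus at least 3, so `D` need only
bound the shifts coming from that slab. -/
theorem abs_sub_horizontalMean_le {L D N : ℝ} (hL : 0 < L)
    (hD : ∀ s ∈ slab n L 3, ‖horizontal n s‖ ≤ D) (hN : 0 ≤ N) {f : Space n → ℝ}
    (hf : ContDiff ℝ 1 f) (hfN : ∀ x, ‖gradient f x‖ ≤ N) (x : Space n) :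
    |f x - horizontalMean L f x| ≤ N * D := by
  have hκ := meanWeight_pos (n := n) hL
  have hc := (isCutoff_chi one_pos)
  have hi : IntegrableOn (fun s => chi 1 (height s) * f (x + horizontal n s)) (column n L) :=
    integrableOn_column_cutoff_mul hc.continuous hc.vanish
      (hf.continuous.comp (continuous_const.add (horizontal n).continuous)) L
  have hi1 := (integrableOn_column_chi (n := n) one_pos L)
  have h1 : f x - horizontalMean L f x = (meanWeight n L)⁻¹ *
      ∫ s in column n L, chi 1 (height s) * (f x - f (x + horizontal n s)) := by
    simp_rw [mul_sub]
    rw [integral_sub (hi1.mul_const _) hi, integral_mul_const]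
    change f x - (meanWeight n L)⁻¹ * _ = (meanWeight n L)⁻¹ * (meanWeight n L * f x - _)
    field_simp
  have h2 : |∫ s in column n L, chi 1 (height s) * (f x - f (x + horizontal n s))|
      ≤ ∫ s in column n L, chi 1 (height s) * (N * D) := by
    rw [← Real.norm_eq_abs]
    refine norm_integral_le_of_norm_le (hi1.mul_const _) ?_
    refine (ae_restrict_iff' (measurableSet_column L)).2 (Eventually.of_forall fun s hs => ?_)
    rw [norm_mul, Real.norm_eq_abs, abs_of_nonneg (chi_nonneg _ _)]
    by_cases h3 : |height s| ≤ 3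
    · refine mul_le_mul_of_nonneg_left ?_ (chi_nonneg _ _)
      have := Convex.norm_image_sub_le_of_norm_fderiv_le (𝕜 := ℝ) (f := f) (s := univ)
        (x := x + horizontal n s) (y := x) (C := N)
        (fun y _ => hf.differentiable one_ne_zero y)
        (fun y _ => by rw [← norm_gradient]; exact hfN y) convex_univ (mem_univ _) (mem_univ _)
      refine this.trans ?_
      have e : x - (x + horizontal n s) = - horizontal n s := by abel
      rw [e, norm_neg]
      exact mul_le_mul_of_nonneg_left (hD s ⟨hs, h3⟩) hN
    · have : chi 1 (height s) = 0 := hc.vanish _ (by linarith)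
      simp [this]
  rw [integral_mul_const] at h2
  rw [h1, abs_mul, abs_of_pos (inv_pos.2 hκ)]
  calc _ ≤ (meanWeight n L)⁻¹ * (meanWeight n L * (N * D)) := by
        gcongr
        exact h2
    _ = N * D := by field_simp

/-! ### Flux-free functions and a substitute for the Poincaré inequality -/

/-- The function `w` has no net flux through horizontal sections. -/
def FluxFree (L : ℝ) (w : Space n → ℝ) : Prop :=
  ∀ (m : ℝ → ℝ) (R : ℝ), Continuous m → (∀ z, R ≤ |z| → m z = 0) →
    ∫ x in column n L, m (height x) * w x = 0

/-- The horizontal mean depends on the height only, so together with `φ` it is an admissible test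
function. -/
theorem FluxFree.integral_horizontalMean_eq_zero {L R : ℝ} (hL : 0 ≤ L) {w : Space n → ℝ}
    (hw : FluxFree L w) {φ : ℝ → ℝ} (hφ : Continuous φ) (hv : ∀ z, R ≤ |z| → φ z = 0)
    {f : Space n → ℝ} (hf : ContDiff ℝ 1 f) (hper : TransversePeriodic L f) :
    ∫ x in column n L, φ (height x) * (horizontalMean L f x * w x) = 0 := by
  have h := hw (fun z => φ z * horizontalMean L f (z • ez n)) R
    (hφ.mul ((continuous_horizontalMean hf.continuous).comp (continuous_id.smul continuous_const)))
    (fun z hz => by simp [hv z hz])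
  rw [← h]
  refine integral_congr_ae (Eventually.of_forall fun x => ?_)
  simp only
  rw [horizontalMean_eq hL hf hper, mul_assoc]

/-- The derivative in the shift parameter is estimated by Young's inequality. The resulting gradient
integral at the shifted point does not depend on the shift, by translation invariance, so the bound
is uniform along the segment. -/
theorem abs_integral_translate_sub_le {L R lam : ℝ} (hL : 0 ≤ L) (hlam : 0 < lam)
    {φ φ₁ φ₂ : ℝ → ℝ} (hφ : IsCutoff R φ φ₁ φ₂) (hφ0 : ∀ z, 0 ≤ φ z) {f w : Space n → ℝ}
    (hf : ContDiff ℝ 2 f) (hper : TransversePeriodic L f) (hw : Continuous w) {a : Space n}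
    (ha : height a = 0) :
    |(∫ x in column n L, φ (height x) * (f (x + a) * w x))
        - ∫ x in column n L, φ (height x) * (f x * w x)|
      ≤ ‖a‖ / 2 * (lam * (∫ x in column n L, φ (height x) * ‖gradient f x‖ ^ 2)
          + lam⁻¹ * ∫ x in column n L, φ (height x) * w x ^ 2) := by
  have hf1 : ContDiff ℝ 1 f := hf.of_le (by norm_num)
  have hfc := hf1.continuous
  have hfd := hf1.continuous_fderiv one_ne_zero
  have hgr := contDiff_gradient hf
  have hd : ∀ s : ℝ, ∀ x, HasDerivAt (fun s : ℝ => f (x + s • a)) (fderiv ℝ f (x + s • a) a) s := by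
    intro s x
    have h1 : HasDerivAt (fun s : ℝ => x + s • a) a s := by
      simpa using ((hasDerivAt_id s).smul_const a).const_add x
    exact (hf1.differentiable one_ne_zero _).hasFDerivAt.comp_hasDerivAt s h1
  have key : ∀ s : ℝ, HasDerivAt
      (fun s : ℝ => ∫ x in column n L, φ (height x) * (f (x + s • a) * w x))
      (∫ x in column n L, φ (height x) * (fderiv ℝ f (x + s • a) a * w x)) s := by
    intro s
    exact hasDerivAt_integral_column (R := R) isOpen_univ (U := univ)
      (f := fun s x => φ (height x) * (f (x + s • a) * w x))
      (f' := fun s x => φ (height x) * (fderiv ℝ f (x + s • a) a * w x))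
      ((continuousOn_height_snd hφ.continuous).mul (by fun_prop))
      ((continuousOn_height_snd hφ.continuous).mul (by fun_prop))
      (fun s x hx => by simp [hφ.vanish _ hx]) (fun s x hx => by simp [hφ.vanish _ hx])
      (fun s _ x => ((hd s x).mul_const _).const_mul _) L (mem_univ s)
  set A := ∫ x in column n L, φ (height x) * ‖gradient f x‖ ^ 2 with hA
  set B := ∫ x in column n L, φ (height x) * w x ^ 2 with hB
  have hbound : ∀ s : ℝ, ‖∫ x in column n L, φ (height x) * (fderiv ℝ f (x + s • a) a * w x)‖
      ≤ ‖a‖ / 2 * (lam * A + lam⁻¹ * B) := by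
    intro s
    have cg : Continuous (fun x => ‖gradient f (x + s • a)‖ ^ 2) :=
      (hgr.continuous.comp (continuous_id.add continuous_const)).norm.pow 2
    have i1 := integrableOn_column_cutoff_mul hφ.continuous hφ.vanish cg L
    have i2 := integrableOn_column_cutoff_mul hφ.continuous hφ.vanish (hw.fun_pow 2) L
    have e1 : ∫ x in column n L, φ (height x) * ‖gradient f (x + s • a)‖ ^ 2 = A :=
      integral_column_translate hL hφ (f := fun x => ‖gradient f x‖ ^ 2) (hgr.norm_sq ℝ)
        (hper.gradient.comp (fun v => ‖v‖ ^ 2)) (by rw [height_smul, ha, mul_zero])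
    have e2 : ∫ x in column n L, (‖a‖ / 2 * (lam * (φ (height x) * ‖gradient f (x + s • a)‖ ^ 2)
        + lam⁻¹ * (φ (height x) * w x ^ 2))) = ‖a‖ / 2 * (lam * A + lam⁻¹ * B) := by
      rw [integral_const_mul, integral_add (i1.const_mul _) (i2.const_mul _), integral_const_mul,
        integral_const_mul, e1]
    rw [← e2]
    refine norm_integral_le_of_norm_le (((i1.const_mul _).add (i2.const_mul _)).const_mul _)
      (Eventually.of_forall fun x => ?_)
    have h1 : ‖fderiv ℝ f (x + s • a) a‖ ≤ ‖gradient f (x + s • a)‖ * ‖a‖ := by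
      rw [norm_gradient]; exact ContinuousLinearMap.le_opNorm _ _
    rw [norm_mul, norm_mul, Real.norm_eq_abs (φ _), abs_of_nonneg (hφ0 _)]
    set G := ‖gradient f (x + s • a)‖
    have h2 : G * ‖w x‖ ≤ (lam * G ^ 2 + lam⁻¹ * w x ^ 2) / 2 := by
      have h3 : 0 ≤ lam⁻¹ * (lam * G - ‖w x‖) ^ 2 := by positivity
      have h4 : lam⁻¹ * (lam * G - ‖w x‖) ^ 2
          = lam * G ^ 2 - 2 * (G * ‖w x‖) + lam⁻¹ * w x ^ 2 := by
        rw [Real.norm_eq_abs, sub_sq, sq_abs]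
        field_simp
      linarith
    calc φ (height x) * (‖fderiv ℝ f (x + s • a) a‖ * ‖w x‖)
        ≤ φ (height x) * ((G * ‖a‖) * ‖w x‖) := by
          gcongr
          exact hφ0 _
      _ = φ (height x) * ‖a‖ * (G * ‖w x‖) := by ring
      _ ≤ φ (height x) * ‖a‖ * ((lam * G ^ 2 + lam⁻¹ * w x ^ 2) / 2) := by
          have := hφ0 (height x)
          gcongr
      _ = _ := by ring
  have := Convex.norm_image_sub_le_of_norm_hasDerivWithin_le (𝕜 := ℝ) (s := univ) (x := 0) (y := 1)
    (fun s _ => (key s).hasDerivWithinAt) (fun s _ => hbound s) convex_univ (mem_univ _)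
    (mem_univ _)
  simpa using this

/-- Takes the place of the Poincaré inequality on cross-sections followed by Cauchy–Schwarz. The
average over shifts of the integrals of f(x + shift) w vanishes because `w` is flux free, so the
unshifted integral equals an average of differences, each controlled by the previous lemma. The free
parameter `lam` is chosen only at the end. -/
theorem FluxFree.abs_integral_mul_le {L R lam D : ℝ} (hL : 0 < L) (hlam : 0 < lam)
    (hD : ∀ s ∈ slab n L 3, ‖horizontal n s‖ ≤ D)
    {φ φ₁ φ₂ : ℝ → ℝ} (hφ : IsCutoff R φ φ₁ φ₂) (hφ0 : ∀ z, 0 ≤ φ z) {f w : Space n → ℝ}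
    (hf : ContDiff ℝ 2 f) (hper : TransversePeriodic L f) (hw : Continuous w)
    (hflux : FluxFree L w) :
    |∫ x in column n L, φ (height x) * (f x * w x)|
      ≤ D / 2 * (lam * (∫ x in column n L, φ (height x) * ‖gradient f x‖ ^ 2)
          + lam⁻¹ * ∫ x in column n L, φ (height x) * w x ^ 2) := by
  have hf1 : ContDiff ℝ 1 f := hf.of_le (by norm_num)
  have hfc := hf1.continuous
  have hκ := meanWeight_pos (n := n) hL
  have hc := (isCutoff_chi one_pos)
  have hi1 := (integrableOn_column_chi (n := n) one_pos L)
  set K := lam * (∫ x in column n L, φ (height x) * ‖gradient f x‖ ^ 2)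
          + lam⁻¹ * ∫ x in column n L, φ (height x) * w x ^ 2 with hK
  have hK0 : 0 ≤ K := by
    have h1 : 0 ≤ ∫ x in column n L, φ (height x) * ‖gradient f x‖ ^ 2 :=
      integral_nonneg fun x => mul_nonneg (hφ0 _) (by positivity)
    have h2 : 0 ≤ ∫ x in column n L, φ (height x) * w x ^ 2 :=
      integral_nonneg fun x => mul_nonneg (hφ0 _) (by positivity)
    positivity
  set J := ∫ x in column n L, φ (height x) * (f x * w x) with hJ
  set T : Space n → ℝ := fun s => ∫ x in column n L, φ (height x) * (f (x + horizontal n s) * w x)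
    with hT
  have hφh : Continuous (fun x : Space n => φ (height x)) := hφ.continuous.comp continuous_height
  have hχh : Continuous (fun x : Space n => chi 1 (height x)) := hc.continuous.comp continuous_height
  have hTc : Continuous T := by
    have h : ∀ s, VanishesAbove R
        (fun x : Space n => φ (height x) * (f (x + horizontal n s) * w x)) :=
      fun s x hx => by simp only [hφ.vanish _ hx, zero_mul]
    rw [hT]
    simp_rw [integral_column_eq_slab (h _)]
    refine continuous_parametric_integral_of_continuous ?_ (isCompact_slab _ _)
    exact (hφh.comp continuous_snd).mul ((hfc.comp (continuous_snd.add
      ((horizontal n).continuous.comp continuous_fst))).mul (hw.comp continuous_snd))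
  -- By Fubini this average is a multiple of the integral of `φ` times the horizontal mean of `f`
  -- times `w`.
  have hswap : ∫ s in column n L, chi 1 (height s) * T s = 0 := by
    have h0 := hflux.integral_horizontalMean_eq_zero hL.le hφ.continuous hφ.vanish hf1 hper
    have v1 : VanishesAbove R (fun x : Space n => φ (height x) * (horizontalMean L f x * w x)) :=
      fun x hx => by simp only [hφ.vanish _ hx, zero_mul]
    have v2 : ∀ x, VanishesAbove (3 * 1)
        (fun s : Space n => chi 1 (height s) * f (x + horizontal n s)) :=
      fun x s hs => by simp only [hc.vanish _ hs, zero_mul]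
    have v3 : VanishesAbove (3 * 1) (fun s : Space n => chi 1 (height s) * T s) :=
      fun s hs => by simp only [hc.vanish _ hs, zero_mul]
    have v4 : ∀ s, VanishesAbove R
        (fun x : Space n => φ (height x) * (f (x + horizontal n s) * w x)) :=
      fun s x hx => by simp only [hφ.vanish _ hx, zero_mul]
    rw [integral_column_eq_slab v1] at h0
    rw [integral_column_eq_slab v3]
    simp only [hT]
    simp only [horizontalMean] at h0
    simp_rw [integral_column_eq_slab (v2 _)] at h0
    simp_rw [integral_column_eq_slab (v4 _)]
    have hint : Integrable (Function.uncurry fun x s : Space n =>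
        chi 1 (height s) * (φ (height x) * (f (x + horizontal n s) * w x)))
        ((volume.restrict (slab n L R)).prod (volume.restrict (slab n L (3 * 1)))) := by
      rw [Measure.prod_restrict]
      refine ContinuousOn.integrableOn_compact ((isCompact_slab L R).prod (isCompact_slab L _)) ?_
      refine Continuous.continuousOn ?_
      exact (hχh.comp continuous_snd).mul ((hφh.comp continuous_fst).mul
        ((hfc.comp (continuous_fst.add ((horizontal n).continuous.comp continuous_snd))).mul
          (hw.comp continuous_fst)))
    have h1 := integral_integral_swap hint
    simp_rw [← integral_const_mul (chi 1 _)]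
    rw [← h1]
    have h2 : ∀ x, ∫ s in slab n L (3 * 1), chi 1 (height s) *
        (φ (height x) * (f (x + horizontal n s) * w x))
        = meanWeight n L * (φ (height x) * ((meanWeight n L)⁻¹ *
          (∫ s in slab n L (3 * 1), chi 1 (height s) * f (x + horizontal n s)) * w x)) := by
      intro x
      have h3 : ∀ s, chi 1 (height s) * (φ (height x) * (f (x + horizontal n s) * w x))
          = (φ (height x) * w x) * (chi 1 (height s) * f (x + horizontal n s)) := by
        intro s; ring
      simp_rw [h3]
      rw [integral_const_mul]
      field_simp
    simp_rw [h2]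
    rw [integral_const_mul, h0, mul_zero]
  have hdiff : meanWeight n L * J = ∫ s in column n L, chi 1 (height s) * (J - T s) := by
    simp_rw [mul_sub]
    rw [integral_sub (hi1.mul_const _) (integrableOn_column_cutoff_mul hc.continuous hc.vanish hTc L),
      integral_mul_const, hswap, sub_zero]
    rfl
  have hbd : |∫ s in column n L, chi 1 (height s) * (J - T s)|
      ≤ ∫ s in column n L, chi 1 (height s) * (D / 2 * K) := by
    rw [← Real.norm_eq_abs]
    refine norm_integral_le_of_norm_le (hi1.mul_const _) ?_
    refine (ae_restrict_iff' (measurableSet_column L)).2 (Eventually.of_forall fun s hs => ?_)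
    rw [norm_mul, Real.norm_eq_abs, abs_of_nonneg (chi_nonneg _ _)]
    by_cases h3 : |height s| ≤ 3
    · refine mul_le_mul_of_nonneg_left ?_ (chi_nonneg _ _)
      rw [Real.norm_eq_abs, abs_sub_comm]
      refine (abs_integral_translate_sub_le hL.le hlam hφ hφ0 hf hper hw
        (height_horizontal s)).trans ?_
      have := hD s ⟨hs, h3⟩
      rw [← hK]
      gcongr
    · have : chi 1 (height s) = 0 := hc.vanish _ (by linarith)
      simp [this]
  rw [← hdiff, integral_mul_const, abs_mul, abs_of_pos hκ] at hbd
  exact le_of_mul_le_mul_left hbd hκ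

end

noncomputable section

variable {n : ℕ}

/-! ### Weighted integrals along a solution -/

/-- An integrable weight centred at height `a`. -/
def weight (a z : ℝ) : ℝ := ((1 + (z - a) ^ 2)⁻¹) ^ 3

/-- The first derivative of the weight. -/
def weight₁ (a z : ℝ) : ℝ := -6 * (z - a) * ((1 + (z - a) ^ 2)⁻¹) ^ 4

/-- The second derivative of the weight. -/
def weight₂ (a z : ℝ) : ℝ :=
  -6 * ((1 + (z - a) ^ 2)⁻¹) ^ 4 + 48 * (z - a) ^ 2 * ((1 + (z - a) ^ 2)⁻¹) ^ 5

theorem hasDerivAt_inv_one_add_sq (a z : ℝ) :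
    HasDerivAt (fun z => (1 + (z - a) ^ 2)⁻¹) (-2 * (z - a) * ((1 + (z - a) ^ 2)⁻¹) ^ 2) z := by
  have h0 : (1 + (z - a) ^ 2) ≠ 0 := by positivity
  have h1 : HasDerivAt (fun z => 1 + (z - a) ^ 2) (2 * (z - a)) z := by
    have := (((hasDerivAt_id z).sub_const a).pow 2).const_add 1
    simpa using this
  refine (h1.inv h0).congr_deriv ?_
  field_simp

theorem hasDerivAt_weight (a z : ℝ) : HasDerivAt (weight a) (weight₁ a z) z := by
  refine ((hasDerivAt_inv_one_add_sq a z).pow 3).congr_deriv ?_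
  simp only [weight₁]
  push_cast
  ring

theorem hasDerivAt_weight₁ (a z : ℝ) : HasDerivAt (weight₁ a) (weight₂ a z) z := by
  have h1 : HasDerivAt (fun z => -6 * (z - a)) (-6) z := by
    simpa using ((hasDerivAt_id z).sub_const a).const_mul (-6)
  refine (h1.fun_mul ((hasDerivAt_inv_one_add_sq a z).fun_pow 4)).congr_deriv ?_
  simp only [weight₂]
  push_cast
  ring

theorem continuous_inv_one_add_sq (a : ℝ) : Continuous (fun z : ℝ => (1 + (z - a) ^ 2)⁻¹) :=
  continuous_iff_continuousAt.2 fun z => (hasDerivAt_inv_one_add_sq a z).continuousAt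

theorem continuous_weight (a : ℝ) : Continuous (weight a) :=
  (continuous_inv_one_add_sq a).pow 3

theorem continuous_weight₂ (a : ℝ) : Continuous (weight₂ a) := by
  have := continuous_inv_one_add_sq a
  unfold weight₂
  fun_prop

theorem weight_pos (a z : ℝ) : 0 < weight a z := by unfold weight; positivity

theorem inv_one_add_sq_le_one (s : ℝ) : (1 + s ^ 2)⁻¹ ≤ 1 :=
  inv_le_one_of_one_le₀ (by nlinarith [sq_nonneg s])

theorem weight_le (a z : ℝ) : weight a z ≤ (1 + (z - a) ^ 2)⁻¹ := by
  have h0 : 0 ≤ (1 + (z - a) ^ 2)⁻¹ := by positivity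
  exact pow_le_of_le_one h0 (inv_one_add_sq_le_one _) three_ne_zero

theorem weight_le_one (a z : ℝ) : weight a z ≤ 1 := (weight_le a z).trans (inv_one_add_sq_le_one _)

/-- Derivatives bounded by the weight itself, uniformly in the centre, are what lets the Grönwall
argument close with a rate independent of `a`. -/
theorem abs_weight₁_le (a z : ℝ) : |weight₁ a z| ≤ 3 * weight a z := by
  unfold weight₁ weight
  set s := z - a
  have h0 : 0 < 1 + s ^ 2 := by positivity
  rw [abs_mul, abs_mul, abs_of_nonneg (show 0 ≤ ((1 + s ^ 2)⁻¹) ^ 4 by positivity)]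
  have h1 : 2 * |s| ≤ 1 + s ^ 2 := by nlinarith [sq_nonneg (|s| - 1), sq_abs s]
  have h2 : 3 * ((1 + s ^ 2)⁻¹) ^ 3 = 3 * (1 + s ^ 2) * ((1 + s ^ 2)⁻¹) ^ 4 := by
    field_simp
  rw [h2]
  refine mul_le_mul_of_nonneg_right ?_ (by positivity)
  rw [abs_neg, abs_of_pos (by norm_num : (0 : ℝ) < 6)]
  linarith

theorem abs_weight₂_le (a z : ℝ) : |weight₂ a z| ≤ 54 * weight a z := by
  unfold weight₂ weight
  set s := z - a
  set q := (1 + s ^ 2)⁻¹ with hq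
  have h0 : 0 < q := by positivity
  have h1 : q ≤ 1 := inv_one_add_sq_le_one _
  have h2 : s ^ 2 * q ≤ 1 := by
    rw [hq, mul_inv_le_iff₀ (by positivity)]; linarith
  have h3 : q ^ 4 ≤ q ^ 3 := pow_le_pow_of_le_one h0.le h1 (by norm_num)
  have h4 : s ^ 2 * q ^ 5 ≤ q ^ 4 := by
    have : s ^ 2 * q ^ 5 = (s ^ 2 * q) * q ^ 4 := by ring
    rw [this]
    exact mul_le_of_le_one_left (by positivity) h2
  have h5 : 0 ≤ s ^ 2 * q ^ 5 := by positivity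
  have h6 : 0 < q ^ 4 := by positivity
  rw [abs_le]
  constructor <;> nlinarith

theorem integrable_weight (a : ℝ) : Integrable (weight a) := by
  refine (integrable_inv_one_add_sq.comp_sub_right a).mono'
    (continuous_weight a).aestronglyMeasurable (Eventually.of_forall fun z => ?_)
  rw [Real.norm_eq_abs, abs_of_pos (weight_pos a z)]
  exact weight_le a z

theorem integrableOn_column_weight {L : ℝ} (hL : 0 ≤ L) (a : ℝ) :
    IntegrableOn (fun x => weight a (height x)) (column n L) :=
  integrableOn_column_comp_height hL (integrable_weight a)

theorem tendsto_integral_chi_mul {L : ℝ} {f : Space n → ℝ} (hf : IntegrableOn f (column n L)) :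
    Tendsto (fun R => ∫ x in column n L, chi R (height x) * f x) atTop
      (𝓝 (∫ x in column n L, f x)) := by
  refine tendsto_integral_filter_of_dominated_convergence (fun x => ‖f x‖) ?_ ?_ hf.norm ?_
  · filter_upwards [eventually_gt_atTop 0] with R hR
    exact ((isCutoff_chi hR).continuous.comp continuous_height).aestronglyMeasurable.mul
      hf.aestronglyMeasurable
  · filter_upwards with R
    refine Eventually.of_forall fun x => ?_
    rw [norm_mul, Real.norm_eq_abs, abs_of_nonneg (chi_nonneg _ _)]
    exact mul_le_of_le_one_left (norm_nonneg _) (chi_le_one _ _)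
  · refine Eventually.of_forall fun x => ?_
    refine tendsto_const_nhds.congr' ?_
    filter_upwards [eventually_ge_atTop (max 1 |height x|)] with R hR
    rw [chi_eq_one (by linarith [le_max_left 1 |height x|]) ((le_max_right _ _).trans hR), one_mul]

theorem integrableOn_column_weight_mul {L B : ℝ} (hL : 0 ≤ L) (a : ℝ) {f : Space n → ℝ}
    (hf : AEStronglyMeasurable f (volume.restrict (column n L))) (hB : ∀ x ∈ column n L, |f x| ≤ B) :
    IntegrableOn (fun x => weight a (height x) * f x) (column n L) := by
  refine ((integrableOn_column_weight hL a).mul_const B).mono'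
    (((continuous_weight a).comp continuous_height).aestronglyMeasurable.mul hf) ?_
  refine (ae_restrict_iff' (measurableSet_column L)).2 (Eventually.of_forall fun x hx => ?_)
  rw [norm_mul, Real.norm_eq_abs, abs_of_pos (weight_pos _ _), Real.norm_eq_abs]
  exact mul_le_mul_of_nonneg_left (hB x hx) (weight_pos _ _).le

variable {L g rhoM rhoP : ℝ} {ρ : ℝ → Space n → ℝ} {u : ℝ → Space n → Space n}
  {p : ℝ → Space n → ℝ}

theorem IsClassicalSolution.continuous_rho (h : IsClassicalSolution L g rhoM rhoP ρ u p) {t : ℝ}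
    (ht : 0 < t) : Continuous (ρ t) := (h.contDiff_rho_space t ht).continuous

/-- Grönwall's inequality for a convex nonnegative `G(ρ)`. Convexity gives the dissipation a sign,
and diffusion and transport cost at most 54 + 3 M times the weighted integral. The computation is
made with a cutoff, whose error is O(1/R). -/
theorem IsClassicalSolution.integral_weight_mul_le (h : IsClassicalSolution L g rhoM rhoP ρ u p)
    (hL : 0 < L) {T M B : ℝ} (hM0 : 0 ≤ M) (hM : ∀ t ∈ Icc 0 T, ∀ x, ‖u t x‖ ≤ M)
    {G G₁ G₂ : ℝ → ℝ} (hG : ∀ s, HasDerivAt G (G₁ s) s)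
    (hG₁ : ∀ s, HasDerivAt G₁ (G₂ s) s) (hG₂ : Continuous G₂) (hG₂0 : ∀ s, 0 ≤ G₂ s)
    (hG0 : ∀ t ∈ Ioc 0 T, ∀ x ∈ column n L, 0 ≤ G (ρ t x))
    (hGB : ∀ t ∈ Ioc 0 T, ∀ x ∈ column n L, |G (ρ t x)| ≤ B) (a : ℝ) {s t : ℝ}
    (hs : 0 < s) (hst : s ≤ t) (htT : t ≤ T) :
    Real.exp (-(54 + 3 * M) * t) * ∫ x in column n L, weight a (height x) * G (ρ t x)
      ≤ Real.exp (-(54 + 3 * M) * s) * ∫ x in column n L, weight a (height x) * G (ρ s x) := by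
  obtain ⟨C, hC1, hC⟩ := exists_bound_chi
  set K := 54 + 3 * M with hK
  have hK0 : 0 ≤ K := by positivity
  have hGc : Continuous G := continuous_iff_continuousAt.2 fun s => (hG s).continuousAt
  have hint : ∀ τ ∈ Ioc 0 T, IntegrableOn (fun x => weight a (height x) * G (ρ τ x)) (column n L) :=
    fun τ hτ => integrableOn_column_weight_mul hL.le a
      (hGc.comp (h.continuous_rho hτ.1)).aestronglyMeasurable (hGB τ hτ)
  set W := ∫ x in column n L, weight a (height x) with hW
  have hW0 : 0 ≤ W := integral_nonneg fun x => (weight_pos _ _).le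
  have hB0 : 0 ≤ B := by
    have h0 : (0 : Space n) ∈ column n L := fun i => ⟨le_rfl, hL.le⟩
    exact (abs_nonneg _).trans (hGB t ⟨hs.trans_le hst, htT⟩ 0 h0)
  -- the localized inequality
  have key : ∀ R : ℝ, 1 ≤ R →
      Real.exp (-K * t) * (∫ x in column n L, chi R (height x) * (weight a (height x) * G (ρ t x)))
      - Real.exp (-K * s) * (∫ x in column n L, chi R (height x) * (weight a (height x) * G (ρ s x)))
      ≤ (C * (7 + M) * B * W * (t - s)) / R := by
    intro R hR
    have hR0 : 0 < R := by linarith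
    have hφ := (isCutoff_chi hR0).mul (hasDerivAt_weight a) (hasDerivAt_weight₁ a)
      (continuous_weight₂ a)
    set I : ℝ → ℝ := fun τ => ∫ x in column n L, chi R (height x) * weight a (height x) * G (ρ τ x)
      with hI
    have hId := fun τ (hτ : 0 < τ) => h.hasDerivAt_integral_comp hL.le hφ hG hG₁ hG₂ hτ
    set I' : ℝ → ℝ := fun τ => (∫ x in column n L, G (ρ τ x) *
      ((chi₂ R (height x) * weight a (height x) + 2 * (chi₁ R (height x) * weight₁ a (height x))
        + chi R (height x) * weight₂ a (height x)) + height (u τ x) *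
        (chi₁ R (height x) * weight a (height x) + chi R (height x) * weight₁ a (height x))))
        - ∫ x in column n L, chi R (height x) * weight a (height x) *
          (G₂ (ρ τ x) * ‖gradient (ρ τ) x‖ ^ 2) with hI'
    have hbd : ∀ τ ∈ Ioc 0 T, I' τ ≤ K * I τ + C * (7 + M) * B * W / R := by
      intro τ hτ
      have h1 : 0 ≤ ∫ x in column n L, chi R (height x) * weight a (height x) *
          (G₂ (ρ τ x) * ‖gradient (ρ τ) x‖ ^ 2) :=
        integral_nonneg fun x => mul_nonneg (mul_nonneg (chi_nonneg _ _) (weight_pos _ _).le)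
          (mul_nonneg (hG₂0 _) (by positivity))
      have i1 : IntegrableOn (fun x => chi R (height x) * weight a (height x) * G (ρ τ x))
          (column n L) :=
        integrableOn_column_cutoff_mul hφ.continuous hφ.vanish
          (hGc.comp (h.continuous_rho hτ.1)) L
      have e1 : K * I τ + C * (7 + M) * B * W / R = ∫ x in column n L,
          (K * (chi R (height x) * weight a (height x) * G (ρ τ x))
            + (C * (7 + M) * B / R) * weight a (height x)) := by
        rw [integral_add (i1.const_mul _) ((integrableOn_column_weight hL.le a).const_mul _),
          integral_const_mul, integral_const_mul]
        ring
      have huc : Continuous (u τ) := (h.contDiff_u_space hτ.1).continuous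
      have h2 : ∫ x in column n L, G (ρ τ x) *
          ((chi₂ R (height x) * weight a (height x) + 2 * (chi₁ R (height x) * weight₁ a (height x))
            + chi R (height x) * weight₂ a (height x)) + height (u τ x) *
            (chi₁ R (height x) * weight a (height x) + chi R (height x) * weight₁ a (height x)))
          ≤ K * I τ + C * (7 + M) * B * W / R := by
        rw [e1]
        refine setIntegral_mono_on ?_ ((i1.const_mul _).add
          ((integrableOn_column_weight hL.le a).const_mul _)) (measurableSet_column L) ?_
        · refine integrableOn_column_of_vanishesAbove (R := 3 * R) (fun x hx => ?_) ?_ L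
          · have a0 := hφ.vanish₁ _ hx
            have a1 := hφ.vanish₂ _ hx
            rw [a0, a1]; ring
          · exact (hGc.comp (h.continuous_rho hτ.1)).mul ((hφ.continuous₂.comp continuous_height).add
              ((continuous_height.comp huc).mul (hφ.continuous₁.comp continuous_height)))
        · intro x hx
          have b0 := hG0 τ hτ x hx
          have b1 : G (ρ τ x) ≤ B := (le_abs_self _).trans (hGB τ hτ x hx)
          have b2 := (abs_height_le (u τ x)).trans (hM τ ⟨hτ.1.le, hτ.2⟩ x)
          obtain ⟨c1, c2, -⟩ := hC R hR (height x)
          have d1 := abs_weight₁_le a (height x)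
          have d2 := abs_weight₂_le a (height x)
          have d0 := weight_pos a (height x)
          have f0 := chi_nonneg R (height x)
          set w := weight a (height x)
          set w1 := weight₁ a (height x)
          set w2 := weight₂ a (height x)
          set c := chi R (height x)
          have t1 : chi₂ R (height x) * w ≤ C / R * w :=
            mul_le_mul_of_nonneg_right ((le_abs_self _).trans c2) d0.le
          have t2 : chi₁ R (height x) * w1 ≤ C / R * (3 * w) := by
            refine (le_abs_self _).trans ?_
            rw [abs_mul]; gcongr
          have t3 : c * w2 ≤ c * (54 * w) :=
            mul_le_mul_of_nonneg_left ((le_abs_self _).trans d2) f0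
          have t4 : height (u τ x) * (chi₁ R (height x) * w) ≤ M * (C / R * w) := by
            refine (le_abs_self _).trans ?_
            rw [abs_mul, abs_mul, abs_of_pos d0]; gcongr
          have t5 : height (u τ x) * (c * w1) ≤ M * (c * (3 * w)) := by
            refine (le_abs_self _).trans ?_
            rw [abs_mul, abs_mul, abs_of_nonneg f0]; gcongr
          -- The factor 7 + M collects the terms with a derivative on the cutoff: 1 from `chi₂`, 2 ·
          -- 3 from the mixed term and `M` from transport.
          have t6 : chi₂ R (height x) * w + 2 * (chi₁ R (height x) * w1) + c * w2
              + height (u τ x) * (chi₁ R (height x) * w + c * w1)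
              ≤ K * (c * w) + C / R * (7 + M) * w := by
            rw [hK]; nlinarith
          have t7 : G (ρ τ x) * (C / R * (7 + M) * w) ≤ B * (C / R * (7 + M) * w) := by
            gcongr
          calc G (ρ τ x) * (chi₂ R (height x) * w + 2 * (chi₁ R (height x) * w1) + c * w2
              + height (u τ x) * (chi₁ R (height x) * w + c * w1))
              ≤ G (ρ τ x) * (K * (c * w) + C / R * (7 + M) * w) :=
                mul_le_mul_of_nonneg_left t6 b0
            _ = K * (c * w * G (ρ τ x)) + G (ρ τ x) * (C / R * (7 + M) * w) := by ring
            _ ≤ K * (c * w * G (ρ τ x)) + B * (C / R * (7 + M) * w) := by linarith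
            _ = _ := by ring
      simp only [hI']
      linarith
    have hder : ∀ τ, 0 < τ → HasDerivAt (fun τ => Real.exp (-K * τ) * I τ)
        (Real.exp (-K * τ) * (I' τ - K * I τ)) τ := by
      intro τ hτ
      have e1 : HasDerivAt (fun τ => Real.exp (-K * τ)) (Real.exp (-K * τ) * (-K)) τ := by
        have : HasDerivAt (fun τ => -K * τ) (-K) τ := by
          simpa using (hasDerivAt_id τ).const_mul (-K)
        exact this.exp
      refine (e1.mul (hId τ hτ)).congr_deriv ?_
      simp only [hI, hI']
      ring
    have hmv := Convex.image_sub_le_mul_sub_of_deriv_le (convex_Icc s t)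
      (f := fun τ => Real.exp (-K * τ) * I τ) (C := C * (7 + M) * B * W / R)
      (fun τ hτ => (hder τ (hs.trans_le hτ.1)).continuousAt.continuousWithinAt)
      (fun τ hτ => by
        rw [interior_Icc] at hτ
        exact (hder τ (hs.trans hτ.1)).differentiableAt.differentiableWithinAt)
      (fun τ hτ => by
        rw [interior_Icc] at hτ
        have hτ0 : 0 < τ := hs.trans hτ.1
        rw [(hder τ hτ0).deriv]
        have h1 : I' τ - K * I τ ≤ C * (7 + M) * B * W / R := by
          linarith [hbd τ ⟨hτ0, hτ.2.le.trans htT⟩]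
        have h2 : Real.exp (-K * τ) ≤ 1 := by
          rw [Real.exp_le_one_iff]; nlinarith
        have h3 : 0 ≤ C * (7 + M) * B * W / R := by positivity
        calc _ ≤ Real.exp (-K * τ) * (C * (7 + M) * B * W / R) := by gcongr
          _ ≤ _ := mul_le_of_le_one_left h3 h2)
      s (left_mem_Icc.2 hst) t (right_mem_Icc.2 hst) hst
    simp only [hI] at hmv
    simp only [mul_assoc (chi R _)] at hmv
    refine hmv.trans (le_of_eq ?_)
    ring
  have l1 := (tendsto_integral_chi_mul (hint t ⟨hs.trans_le hst, htT⟩)).const_mul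
    (Real.exp (-K * t))
  have l2 := (tendsto_integral_chi_mul (hint s ⟨hs, hst.trans htT⟩)).const_mul (Real.exp (-K * s))
  have l3 : Tendsto (fun R : ℝ => (C * (7 + M) * B * W * (t - s)) / R) atTop (𝓝 0) :=
    tendsto_const_nhds.div_atTop tendsto_id
  have := le_of_tendsto_of_tendsto (l1.sub l2) l3 (by
    filter_upwards [eventually_ge_atTop 1] with R hR using key R hR)
  linarith

/-- The initial density is attained only locally in L¹. On a slab this suffices since `G` is
Lipschitz on the range of the densities; outside, the tail of the integrable weight is small
uniformly in time. -/
theorem IsClassicalSolution.tendsto_integral_weight_mul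
    (h : IsClassicalSolution L g rhoM rhoP ρ u p) (hL : 0 < L) {T N Lam : ℝ} (hT : 0 < T)
    (hN : ∀ t ∈ Ioc 0 T, ∀ x, |ρ t x| ≤ N) (hN0 : ∀ x, |ρ 0 x| ≤ N) {G : ℝ → ℝ} (hG : Continuous G)
    (hLam : 0 ≤ Lam) (hGL : ∀ a b, |a| ≤ N → |b| ≤ N → |G a - G b| ≤ Lam * |a - b|) (a : ℝ) :
    Tendsto (fun s => ∫ x in column n L, weight a (height x) * G (ρ s x)) (𝓝[>] 0)
      (𝓝 (∫ x in column n L, weight a (height x) * G (ρ 0 x))) := by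
  have hw := integrableOn_column_weight (n := n) hL.le a
  have hN' : 0 ≤ N := (abs_nonneg _).trans (hN0 0)
  have hGb : ∀ r, |r| ≤ N → |G r| ≤ |G 0| + Lam * N := by
    intro r hr
    have h1 := hGL r 0 hr (by simpa using hN')
    rw [sub_zero] at h1
    have h2 : Lam * |r| ≤ Lam * N := by gcongr
    have h3 := abs_sub_abs_le_abs_sub (G r) (G 0)
    linarith
  have i0 : IntegrableOn (fun x => weight a (height x) * G (ρ 0 x)) (column n L) :=
    integrableOn_column_weight_mul hL.le a
      (hG.measurable.comp h.measurable_initial).aestronglyMeasurable (fun x _ => hGb _ (hN0 x))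
  have is : ∀ s ∈ Ioc 0 T, IntegrableOn (fun x => weight a (height x) * G (ρ s x)) (column n L) :=
    fun s hs => integrableOn_column_weight_mul hL.le a
      (hG.comp (h.continuous_rho hs.1)).aestronglyMeasurable (fun x _ => hGb _ (hN s hs x))
  have htail : Tendsto (fun R => 2 * Lam * N * ((∫ x in column n L, weight a (height x))
      - ∫ x in column n L, chi R (height x) * weight a (height x))) atTop (𝓝 0) := by
    have := ((tendsto_integral_chi_mul hw).const_sub (∫ x in column n L, weight a (height x))).const_mul
      (2 * Lam * N)
    rwa [sub_self, mul_zero] at this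
  have key : ∀ R, 0 < R → ∀ s ∈ Ioc 0 T,
      |(∫ x in column n L, weight a (height x) * G (ρ s x))
        - ∫ x in column n L, weight a (height x) * G (ρ 0 x)|
      ≤ Lam * (∫ x in column n L ∩ {x | |height x| ≤ 3 * R}, |ρ s x - ρ 0 x|)
        + 2 * Lam * N * ((∫ x in column n L, weight a (height x))
      - ∫ x in column n L, chi R (height x) * weight a (height x)) := by
    intro R hR s hs
    have hc := isCutoff_chi hR
    have iw : IntegrableOn (fun x => chi R (height x) * weight a (height x)) (column n L) :=
      integrableOn_column_cutoff_mul hc.continuous hc.vanish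
        ((continuous_weight a).comp continuous_height) L
    have id : IntegrableOn (fun x => |ρ s x - ρ 0 x|) (slab n L (3 * R)) := by
      refine (integrableOn_const (C := 2 * N) (isCompact_slab L (3 * R)).measure_ne_top).mono'
        (((h.continuous_rho hs.1).measurable.sub h.measurable_initial).abs.aestronglyMeasurable)
        (Eventually.of_forall fun x => ?_)
      rw [Real.norm_eq_abs, abs_abs]
      have := abs_sub (ρ s x) (ρ 0 x)
      linarith [hN s hs x, hN0 x]
    have id' : IntegrableOn ((slab n L (3 * R)).indicator fun x => |ρ s x - ρ 0 x|) (column n L) :=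
      ((integrable_indicator_iff (measurableSet_slab L (3 * R))).2 id).integrableOn
    have e1 : ∫ x in column n L, (slab n L (3 * R)).indicator (fun x => |ρ s x - ρ 0 x|) x
        = ∫ x in slab n L (3 * R), |ρ s x - ρ 0 x| := by
      rw [setIntegral_indicator (measurableSet_slab L (3 * R)),
        inter_eq_self_of_subset_right (slab_subset_column L (3 * R))]
    have isub : IntegrableOn (fun x => weight a (height x) - chi R (height x) * weight a (height x))
        (column n L) := hw.sub iw
    change _ ≤ Lam * (∫ x in slab n L (3 * R), |ρ s x - ρ 0 x|) + _
    rw [← integral_sub (is s hs) i0, ← e1, ← integral_sub hw iw, ← integral_const_mul,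
      ← integral_const_mul, ← integral_add (id'.const_mul _) (isub.const_mul _),
      ← Real.norm_eq_abs]
    refine norm_integral_le_of_norm_le ((id'.const_mul _).add (isub.const_mul _)) ?_
    refine (ae_restrict_iff' (measurableSet_column L)).2 (Eventually.of_forall fun x hx => ?_)
    rw [← mul_sub, norm_mul, Real.norm_eq_abs, Real.norm_eq_abs, abs_of_pos (weight_pos _ _)]
    have g1 := hGL _ _ (hN s hs x) (hN0 x)
    have g2 : |ρ s x - ρ 0 x| ≤ 2 * N := by
      have := abs_sub (ρ s x) (ρ 0 x)
      linarith [hN s hs x, hN0 x]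
    have w0 := weight_pos a (height x)
    have w1 := weight_le_one a (height x)
    have c0 := chi_nonneg R (height x)
    have c1 := chi_le_one R (height x)
    set w := weight a (height x)
    set c := chi R (height x)
    have hind : c * |ρ s x - ρ 0 x| ≤ (slab n L (3 * R)).indicator (fun x => |ρ s x - ρ 0 x|) x := by
      by_cases hz : |height x| ≤ 3 * R
      · rw [indicator_of_mem (show x ∈ slab n L (3 * R) from ⟨hx, hz⟩)]
        exact mul_le_of_le_one_left (abs_nonneg _) c1
      · have : c = 0 := hc.vanish _ (by linarith)
        rw [this, zero_mul]
        exact indicator_nonneg (fun _ _ => abs_nonneg _) _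
    set δ := |ρ s x - ρ 0 x|
    have hδ : 0 ≤ δ := abs_nonneg _
    calc w * |G (ρ s x) - G (ρ 0 x)| ≤ w * (Lam * δ) := by gcongr
      _ = Lam * (w * (c * δ)) + Lam * ((w - c * w) * δ) := by ring
      _ ≤ Lam * (c * δ) + Lam * ((w - c * w) * (2 * N)) := by
          have h1 : w * (c * δ) ≤ c * δ := mul_le_of_le_one_left (by positivity) w1
          have h2 : 0 ≤ w - c * w := by nlinarith
          gcongr
      _ ≤ Lam * _ + 2 * Lam * N * (w - c * w) := by
          have := mul_le_mul_of_nonneg_left hind hLam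
          linarith
  rw [Metric.tendsto_nhds]
  intro ε hε
  obtain ⟨R, hR, hR0⟩ := ((htail.eventually (gt_mem_nhds (half_pos hε))).and
    (eventually_gt_atTop 0)).exists
  have hlim := (h.initial_rho (3 * R)).const_mul Lam
  rw [mul_zero] at hlim
  filter_upwards [hlim.eventually (gt_mem_nhds (half_pos hε)),
    Ioc_mem_nhdsGT hT] with s h1 h2
  rw [Real.dist_eq]
  refine (key R hR0 s h2).trans_lt ?_
  linarith

end

noncomputable section

variable {n : ℕ}

/-! ### The maximum principle and the first moment -/

/-- With `k = 1` and `k = 0` this shows that the cube of the positive part is twice continuously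
differentiable, a convex function admissible in the Grönwall estimate. -/
theorem hasDerivAt_posPart_pow (k : ℕ) (r : ℝ) :
    HasDerivAt (fun r : ℝ => max r 0 ^ (k + 2)) ((k + 2 : ℝ) * max r 0 ^ (k + 1)) r := by
  rcases lt_trichotomy r 0 with hr | hr | hr
  · have h : (fun r : ℝ => max r 0 ^ (k + 2)) =ᶠ[𝓝 r] fun _ => 0 := by
      filter_upwards [gt_mem_nhds hr] with y hy
      rw [max_eq_right hy.le, zero_pow (by omega)]
    rw [max_eq_right hr.le, zero_pow (by omega), mul_zero]
    exact (hasDerivAt_const r (0 : ℝ)).congr_of_eventuallyEq h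
  · subst hr
    have h1 : HasDerivWithinAt (fun r : ℝ => max r 0 ^ (k + 2)) 0 (Iic 0) 0 :=
      (hasDerivWithinAt_const (0 : ℝ) (Iic 0) (0 : ℝ)).congr
        (fun y hy => by rw [max_eq_right hy, zero_pow (by omega)]) (by simp)
    have h2 : HasDerivWithinAt (fun r : ℝ => max r 0 ^ (k + 2)) 0 (Ici 0) 0 := by
      have := ((hasDerivAt_pow (k + 2) (0 : ℝ)).hasDerivWithinAt (s := Ici 0)).congr
        (f₁ := fun r : ℝ => max r 0 ^ (k + 2)) (fun y hy => by rw [max_eq_left hy]) (by simp)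
      simpa using this
    have h3 := h1.union h2
    rw [Iic_union_Ici, hasDerivWithinAt_univ] at h3
    simpa using h3
  · have h : (fun r : ℝ => max r 0 ^ (k + 2)) =ᶠ[𝓝 r] fun r => r ^ (k + 2) := by
      filter_upwards [lt_mem_nhds hr] with y hy
      rw [max_eq_left hy.le]
    rw [max_eq_left hr.le]
    refine ((hasDerivAt_pow (k + 2) r).congr_of_eventuallyEq h).congr_deriv ?_
    push_cast
    rfl

theorem exists_lipschitz_of_hasDerivAt {G G₁ : ℝ → ℝ} (hG : ∀ s, HasDerivAt G (G₁ s) s)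
    (hG₁ : Continuous G₁) (N : ℝ) :
    ∃ Lam, 0 ≤ Lam ∧ ∀ a b, |a| ≤ N → |b| ≤ N → |G a - G b| ≤ Lam * |a - b| := by
  obtain ⟨C, hC⟩ := (isCompact_Icc (a := -N) (b := N)).exists_bound_of_continuousOn
    hG₁.continuousOn
  refine ⟨max C 0, le_max_right _ _, fun a b ha hb => ?_⟩
  have := Convex.norm_image_sub_le_of_norm_hasDerivWithin_le (𝕜 := ℝ) (f := G) (f' := G₁)
    (s := Icc (-N) N) (x := b) (y := a) (C := max C 0)
    (fun s _ => (hG s).hasDerivWithinAt) (fun s hs => (hC s hs).trans (le_max_left _ _))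
    (convex_Icc _ _) (abs_le.1 hb) (abs_le.1 ha)
  simpa [Real.norm_eq_abs] using this

/-- Used to turn equality almost everywhere of continuous functions on the column into equality
everywhere, boundary faces included. -/
theorem column_subset_closure_interior {L : ℝ} (hL : 0 < L) :
    column n L ⊆ closure (interior (column n L)) := by
  have hconv : Convex ℝ (column n L) := by
    intro x hx y hy a b ha hb hab i
    exact (convex_Icc 0 L) (hx i) (hy i) ha hb hab
  have hopen : IsOpen {x : Space n | ∀ i : Fin n, x i.castSucc ∈ Ioo 0 L} := by
    rw [show {x : Space n | ∀ i : Fin n, x i.castSucc ∈ Ioo 0 L}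
      = ⋂ i : Fin n, {x | x i.castSucc ∈ Ioo 0 L} by ext x; simp]
    refine isOpen_iInter_of_finite fun i => isOpen_Ioo.preimage ?_
    exact (EuclideanSpace.proj (𝕜 := ℝ) (i.castSucc : Fin (n + 1))).continuous
  have hsub : {x : Space n | ∀ i : Fin n, x i.castSucc ∈ Ioo 0 L} ⊆ interior (column n L) :=
    interior_maximal (fun x hx i => Ioo_subset_Icc_self (hx i)) hopen
  have hne : (interior (column n L)).Nonempty := by
    refine ⟨WithLp.toLp 2 fun _ => L / 2, hsub fun i => ⟨?_, ?_⟩⟩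
    · simpa using hL
    · simpa using hL
  rw [hconv.closure_interior_eq_closure_of_nonempty_interior hne]
  exact subset_closure

variable {L g rhoM rhoP : ℝ} {ρ : ℝ → Space n → ℝ} {u : ℝ → Space n → Space n}
  {p : ℝ → Space n → ℝ}

theorem IsClassicalSolution.exists_bound_rho (h : IsClassicalSolution L g rhoM rhoP ρ u p) (T : ℝ) :
    ∃ N, (∀ t ∈ Ioc 0 T, ∀ x, |ρ t x| ≤ N) ∧ ∀ x, |ρ 0 x| ≤ N := by
  obtain ⟨M, hM⟩ := h.bounded_rho T
  refine ⟨max M (max |rhoM| |rhoP|), fun t ht x => (hM t ht x).trans (le_max_left _ _), fun x => ?_⟩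
  refine le_trans ?_ (le_max_right _ _)
  exact abs_le_max_abs_abs (h.initial_mem x).1 (h.initial_mem x).2

theorem IsClassicalSolution.integral_weight_mul_le_initial
    (h : IsClassicalSolution L g rhoM rhoP ρ u p)
    (hL : 0 < L) {T M : ℝ} (hM0 : 0 ≤ M) (hM : ∀ t ∈ Icc 0 T, ∀ x, ‖u t x‖ ≤ M)
    {G G₁ G₂ : ℝ → ℝ} (hG : ∀ s, HasDerivAt G (G₁ s) s)
    (hG₁ : ∀ s, HasDerivAt G₁ (G₂ s) s) (hG₂ : Continuous G₂) (hG₂0 : ∀ s, 0 ≤ G₂ s)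
    (hG0 : ∀ t ∈ Ioc 0 T, ∀ x ∈ column n L, 0 ≤ G (ρ t x)) (a : ℝ) {t : ℝ} (ht : t ∈ Ioc 0 T) :
    IntegrableOn (fun x => weight a (height x) * G (ρ t x)) (column n L) ∧
    ∫ x in column n L, weight a (height x) * G (ρ t x)
      ≤ Real.exp ((54 + 3 * M) * t) * ∫ x in column n L, weight a (height x) * G (ρ 0 x) := by
  obtain ⟨N, hN, hN0⟩ := h.exists_bound_rho T
  have hGc : Continuous G := continuous_iff_continuousAt.2 fun s => (hG s).continuousAt
  have hG₁c : Continuous G₁ := continuous_iff_continuousAt.2 fun s => (hG₁ s).continuousAt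
  obtain ⟨Lam, hLam, hGL⟩ := exists_lipschitz_of_hasDerivAt hG hG₁c N
  obtain ⟨B, hB⟩ := (isCompact_Icc (a := -N) (b := N)).exists_bound_of_continuousOn hGc.continuousOn
  have hGB : ∀ t ∈ Ioc 0 T, ∀ x ∈ column n L, |G (ρ t x)| ≤ B := fun t ht x _ =>
    hB _ (abs_le.1 (hN t ht x))
  refine ⟨integrableOn_column_weight_mul hL.le a (hGc.comp
    (h.continuous_rho ht.1)).aestronglyMeasurable (hGB t ht), ?_⟩
  have hT : 0 < T := ht.1.trans_le ht.2
  have h1 := h.tendsto_integral_weight_mul hL hT hN hN0 hGc hLam hGL a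
  have h2 : Tendsto (fun s => Real.exp (-(54 + 3 * M) * s)) (𝓝[>] 0) (𝓝 1) := by
    have : Continuous (fun s => Real.exp (-(54 + 3 * M) * s)) := by fun_prop
    have := this.tendsto 0
    simp only [mul_zero, Real.exp_zero] at this
    exact this.mono_left nhdsWithin_le_nhds
  have h3 := ge_of_tendsto (h2.mul h1) (by
    filter_upwards [Ioc_mem_nhdsGT ht.1] with s hs
    exact h.integral_weight_mul_le hL hM0 hM hG hG₁ hG₂ hG₂0 hG0 hGB a hs.1 hs.2 ht.2)
  rw [one_mul] at h3
  have h4 := mul_le_mul_of_nonneg_left h3 (Real.exp_pos ((54 + 3 * M) * t)).le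
  rwa [← mul_assoc, ← Real.exp_add, show (54 + 3 * M) * t + -(54 + 3 * M) * t = 0 by ring,
    Real.exp_zero, one_mul] at h4

theorem IsClassicalSolution.exists_bound_u (h : IsClassicalSolution L g rhoM rhoP ρ u p) (T : ℝ) :
    ∃ M, 0 ≤ M ∧ ∀ t ∈ Icc 0 T, ∀ x, ‖u t x‖ ≤ M := by
  obtain ⟨M, hM⟩ := h.bounded_u T
  exact ⟨max M 0, le_max_right _ _, fun t ht x => (hM t ht x).trans (le_max_left _ _)⟩

/-- The weighted integral of the cube of the positive part of `σ * (ρ - c)` vanishes initially,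
hence by Grönwall at all times. The sign `σ` treats upper and lower bounds together. -/
theorem IsClassicalSolution.affine_rho_nonpos (h : IsClassicalSolution L g rhoM rhoP ρ u p)
    (hL : 0 < L) {σ c : ℝ} (h0 : ∀ x, σ * (ρ 0 x - c) ≤ 0) {t : ℝ} (ht : 0 < t) {x : Space n}
    (hx : x ∈ column n L) : σ * (ρ t x - c) ≤ 0 := by
  obtain ⟨M, hM0, hM⟩ := h.exists_bound_u t
  have hl : ∀ s : ℝ, HasDerivAt (fun s => σ * (s - c)) σ s := fun s => by
    simpa using ((hasDerivAt_id s).sub_const c).const_mul σ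
  set G : ℝ → ℝ := fun s => max (σ * (s - c)) 0 ^ 3 with hGdef
  have hG : ∀ s, HasDerivAt G (3 * max (σ * (s - c)) 0 ^ 2 * σ) s := fun s => by
    have := (hasDerivAt_posPart_pow 1 (σ * (s - c))).comp s (hl s)
    refine this.congr_deriv ?_
    norm_num
  have hG₁ : ∀ s, HasDerivAt (fun s => 3 * max (σ * (s - c)) 0 ^ 2 * σ)
      (6 * max (σ * (s - c)) 0 * σ ^ 2) s := fun s => by
    have := (((hasDerivAt_posPart_pow 0 (σ * (s - c))).comp s (hl s)).const_mul 3).mul_const σ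
    refine this.congr_deriv ?_
    norm_num
    ring
  obtain ⟨hi, hle⟩ := h.integral_weight_mul_le_initial hL hM0 hM hG hG₁ (by fun_prop)
    (fun s => by positivity) (fun τ _ x _ => by positivity) 0 (⟨ht, le_rfl⟩ : t ∈ Ioc 0 t)
  have hz : ∀ x, G (ρ 0 x) = 0 := fun x => by simp [hGdef, max_eq_right (h0 x)]
  simp only [hz, mul_zero, integral_zero] at hle
  have hnn : ∀ x, 0 ≤ weight 0 (height x) * G (ρ t x) := fun x =>
    mul_nonneg (weight_pos _ _).le (by positivity)
  have hae := (integral_eq_zero_iff_of_nonneg hnn hi).1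
    (le_antisymm hle (integral_nonneg hnn))
  have hGc : Continuous G := continuous_iff_continuousAt.2 fun s => (hG s).continuousAt
  have heq := Measure.eqOn_of_ae_eq hae
    (((continuous_weight 0).comp continuous_height).mul
      (hGc.comp (h.continuous_rho ht))).continuousOn
    continuousOn_const (column_subset_closure_interior hL)
  have h2 : weight 0 (height x) * G (ρ t x) = 0 := heq hx
  have h3 : G (ρ t x) = 0 := (mul_eq_zero.1 h2).resolve_left (weight_pos _ _).ne'
  have h4 : max (σ * (ρ t x - c)) 0 = 0 := by simpa [hGdef] using h3
  exact max_eq_right_iff.1 h4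

/-- The maximum principle for the density. -/
theorem IsClassicalSolution.rho_mem (h : IsClassicalSolution L g rhoM rhoP ρ u p)
    (hL : 0 < L) {t : ℝ} (ht : 0 < t) {x : Space n} (hx : x ∈ column n L) :
    ρ t x ∈ Icc rhoM rhoP := by
  constructor
  · have := h.affine_rho_nonpos hL (σ := -1) (c := rhoM)
      (fun x => by linarith [(h.initial_mem x).1]) ht hx
    linarith
  · have := h.affine_rho_nonpos hL (σ := 1) (c := rhoP)
      (fun x => by linarith [(h.initial_mem x).2]) ht hx
    linarith

/-- The averaged weight comparable to the positive part of `e z`. -/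
def momentWeight (e z : ℝ) : ENNReal :=
  ∫⁻ a in Ioi (0 : ℝ), ENNReal.ofReal a * ENNReal.ofReal (weight (e * a) z)

theorem weight_mul_of_sq_eq_one {e : ℝ} (he : e ^ 2 = 1) (a z : ℝ) :
    weight (e * a) z = ((1 + (e * z - a) ^ 2)⁻¹) ^ 3 := by
  have : (z - e * a) ^ 2 = (e * z - a) ^ 2 := by
    have : (z - e * a) = e * (e * z - a) + (1 - e ^ 2) * z := by ring
    rw [this, he, sub_self, zero_mul, add_zero, mul_pow, he, one_mul]
  rw [weight, this]

/-- Centres within distance 1 above `e * z` are enough: there the weight is at least 1/8. -/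
theorem le_momentWeight {e : ℝ} (he : e ^ 2 = 1) (z : ℝ) :
    ENNReal.ofReal (max (e * z) 0) ≤ 8 * momentWeight e z := by
  rcases le_or_gt (e * z) 0 with hz | hz
  · simp [max_eq_right hz]
  rw [max_eq_left hz.le]
  set y := e * z
  have h1 : ∫⁻ _a in Ioo y (y + 1), ENNReal.ofReal (y / 8) ≤ momentWeight e z := by
    refine le_trans ?_ (lintegral_mono_set (fun a ha => hz.trans ha.1 : Ioo y (y + 1) ⊆ Ioi 0))
    refine setLIntegral_mono' measurableSet_Ioo fun a ha => ?_
    rw [← ENNReal.ofReal_mul (hz.trans ha.1).le, weight_mul_of_sq_eq_one he]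
    refine ENNReal.ofReal_le_ofReal ?_
    have h2 : (1 + (y - a) ^ 2) ≤ 2 := by nlinarith [ha.1, ha.2]
    have h3 : (1 / 2 : ℝ) ≤ (1 + (y - a) ^ 2)⁻¹ := by
      rw [one_div]; exact inv_anti₀ (by positivity) h2
    have h4 : (1 / 2 : ℝ) ^ 3 ≤ ((1 + (y - a) ^ 2)⁻¹) ^ 3 := by gcongr
    calc y / 8 = y * (1 / 2) ^ 3 := by ring
      _ ≤ a * ((1 + (y - a) ^ 2)⁻¹) ^ 3 := by
        have := ha.1.le
        have := hz.le.trans ha.1.le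
        gcongr
  rw [setLIntegral_const, Real.volume_Ioo, show y + 1 - y = 1 by ring, ENNReal.ofReal_one,
    mul_one] at h1
  calc ENNReal.ofReal y = 8 * ENNReal.ofReal (y / 8) := by
        rw [← ENNReal.ofReal_ofNat, ← ENNReal.ofReal_mul (by norm_num)]
        congr 1; ring
    _ ≤ 8 * momentWeight e z := by gcongr

/-- Of the three powers of the basic factor in the weight, two absorb the growth of `a` and the
third is integrated over the centres. The extra integrable term pays for centres `a > 0` on the side
where `e * z` is negative and for small `e * z`. -/
theorem momentWeight_le {e : ℝ} (he : e ^ 2 = 1) (z : ℝ) :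
    momentWeight e z ≤ ENNReal.ofReal (2 * (max (e * z) 0 + (1 + z ^ 2)⁻¹)) *
      ∫⁻ s, ENNReal.ofReal ((1 + s ^ 2)⁻¹) := by
  set y := e * z with hy
  have hyz : y ^ 2 = z ^ 2 := by rw [hy, mul_pow, he, one_mul]
  rw [← lintegral_sub_left_eq_self (fun s => ENNReal.ofReal ((1 + s ^ 2)⁻¹)) y,
    ← lintegral_const_mul' _ _ ENNReal.ofReal_ne_top]
  refine le_trans (setLIntegral_mono' measurableSet_Ioi fun a ha => ?_) (setLIntegral_le_lintegral _ _)
  have ha0 : 0 < a := ha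
  rw [← ENNReal.ofReal_mul ha0.le, ← ENNReal.ofReal_mul (by positivity),
    weight_mul_of_sq_eq_one he, ← hyz]
  refine ENNReal.ofReal_le_ofReal ?_
  change a * ((1 + (y - a) ^ 2)⁻¹) ^ 3 ≤ 2 * (max y 0 + (1 + y ^ 2)⁻¹) * (1 + (y - a) ^ 2)⁻¹
  set q := (1 + (y - a) ^ 2)⁻¹ with hq
  have hq0 : 0 < q := by positivity
  have hq1 : q ≤ 1 := inv_one_add_sq_le_one _
  have hQ0 : 0 < (1 + y ^ 2)⁻¹ := by positivity
  have hmain : a * q ^ 2 ≤ 2 * (max y 0 + (1 + y ^ 2)⁻¹) := by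
    rcases le_or_gt 0 y with h0 | h0
    · rw [max_eq_left h0]
      have h1 : |a - y| * q ≤ 1 := by
        rw [hq, mul_inv_le_iff₀ (by positivity)]
        nlinarith [sq_nonneg (|a - y| - 1), sq_abs (a - y)]
      have h2 : a * q ≤ y + 1 := by
        have : a ≤ y + |a - y| := by linarith [le_abs_self (a - y)]
        calc a * q ≤ (y + |a - y|) * q := by gcongr
          _ = y * q + |a - y| * q := by ring
          _ ≤ y * 1 + 1 := by gcongr
          _ = y + 1 := by ring
      have h3 : 1 ≤ y + 2 * (1 + y ^ 2)⁻¹ := by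
        rcases le_or_gt 1 y with h | h
        · linarith
        · have : (1 / 2 : ℝ) ≤ (1 + y ^ 2)⁻¹ := by
            rw [one_div]; exact inv_anti₀ (by positivity) (by nlinarith)
          linarith
      have h4 : a * q ^ 2 ≤ a * q := by
        have : a * q ^ 2 = (a * q) * q := by ring
        rw [this]
        exact mul_le_of_le_one_right (by positivity) hq1
      linarith
    · rw [max_eq_right h0.le]
      have h1 : q ≤ (1 + y ^ 2)⁻¹ := inv_anti₀ (by positivity) (by nlinarith)
      have h2 : a * q ≤ 1 := by
        rw [hq, mul_inv_le_iff₀ (by positivity)]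
        nlinarith [sq_nonneg (a - 1)]
      calc a * q ^ 2 = (a * q) * q := by ring
        _ ≤ 1 * (1 + y ^ 2)⁻¹ := by gcongr
        _ ≤ _ := by linarith
  calc a * q ^ 3 = a * q ^ 2 * q := by ring
    _ ≤ _ := by gcongr

theorem measurable_weight_uncurry (e : ℝ) :
    Measurable (fun q : Space n × ℝ => ENNReal.ofReal (weight (e * q.2) (height q.1))) := by
  have : Measurable (fun q : Space n × ℝ => height q.1) :=
    continuous_height.measurable.comp measurable_fst
  unfold weight
  fun_prop

theorem measurable_momentWeight (e : ℝ) :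
    Measurable (fun x : Space n => momentWeight e (height x)) := by
  have h : Measurable (fun q : Space n × ℝ =>
      ENNReal.ofReal q.2 * ENNReal.ofReal (weight (e * q.2) (height q.1))) :=
    measurable_snd.ennreal_ofReal.mul (measurable_weight_uncurry e)
  exact h.lintegral_prod_right'

theorem lintegral_mul_momentWeight (e : ℝ) {f : Space n → ENNReal} (hf : Measurable f) (L : ℝ) :
    ∫⁻ x in column n L, f x * momentWeight e (height x)
      = ∫⁻ a in Ioi (0 : ℝ), ENNReal.ofReal a *
          ∫⁻ x in column n L, ENNReal.ofReal (weight (e * a) (height x)) * f x := by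
  have hm := measurable_weight_uncurry (n := n) e
  have hmx : ∀ x : Space n, Measurable (fun a : ℝ => ENNReal.ofReal (weight (e * a) (height x))) :=
    fun x => by unfold weight; fun_prop
  have hma : ∀ a : ℝ, Measurable (fun x : Space n => ENNReal.ofReal (weight (e * a) (height x))) :=
    fun a => ((continuous_weight (e * a)).comp continuous_height).measurable.ennreal_ofReal
  have h1 : ∀ x : Space n, f x * momentWeight e (height x)
      = ∫⁻ a in Ioi (0 : ℝ), f x *
          (ENNReal.ofReal a * ENNReal.ofReal (weight (e * a) (height x))) := fun x =>
    (lintegral_const_mul (f x) (measurable_id.ennreal_ofReal.mul (hmx x))).symm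
  have h2 : ∀ a : ℝ, ENNReal.ofReal a *
        ∫⁻ x in column n L, ENNReal.ofReal (weight (e * a) (height x)) * f x
      = ∫⁻ x in column n L, f x *
          (ENNReal.ofReal a * ENNReal.ofReal (weight (e * a) (height x))) := by
    intro a
    refine (lintegral_const_mul (ENNReal.ofReal a) ((hma a).mul hf)).symm.trans ?_
    refine lintegral_congr fun x => ?_
    simp only [Pi.mul_apply]
    ring
  have hj : Measurable (fun q : Space n × ℝ =>
      f q.1 * (ENNReal.ofReal q.2 * ENNReal.ofReal (weight (e * q.2) (height q.1)))) :=
    (hf.comp measurable_fst).mul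
      (measurable_snd.ennreal_ofReal.mul hm)
  rw [lintegral_congr h1, lintegral_congr h2]
  exact lintegral_lintegral_swap hj.aemeasurable

/-- The growth rate in the weighted estimate does not depend on the centre, so the estimate may be
integrated against `a` over all centres `e * a` with `a > 0`. By Tonelli this gives an estimate with
the averaged weight, which is comparable to the one-sided moment up to an integrable error. -/
theorem IsClassicalSolution.exists_bound_moment (h : IsClassicalSolution L g rhoM rhoP ρ u p)
    (hL : 0 < L) {σ c e : ℝ} (he : e ^ 2 = 1)
    (h0 : ∀ x, 0 ≤ σ * (ρ 0 x - c))
    (hint : ∫⁻ x in column n L, ENNReal.ofReal (max (e * height x) 0 * (σ * (ρ 0 x - c))) < ⊤)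
    (T : ℝ) :
    ∃ C : ENNReal, C < ⊤ ∧ ∀ t ∈ Ioc 0 T,
      ∫⁻ x in column n L, ENNReal.ofReal (max (e * height x) 0 * (σ * (ρ t x - c))) ≤ C := by
  obtain ⟨M, hM0, hM⟩ := h.exists_bound_u T
  obtain ⟨N, hN, hN0⟩ := h.exists_bound_rho T
  set Pi := ∫⁻ s : ℝ, ENNReal.ofReal ((1 + s ^ 2)⁻¹) with hPi
  have hPi_top : Pi < ⊤ := by
    have := integrable_inv_one_add_sq.lintegral_lt_top
    exact this
  have ht0 : ∀ t, 0 < t → ∀ x ∈ column n L, 0 ≤ σ * (ρ t x - c) := fun t ht x hx => by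
    have := h.affine_rho_nonpos hL (σ := -σ) (c := c) (fun x => by linarith [h0 x]) ht hx
    linarith
  have hm0 : Measurable (fun x => σ * (ρ 0 x - c)) :=
    (h.measurable_initial.sub_const c).const_mul σ
  have hmz : Measurable (height : Space n → ℝ) := continuous_height.measurable
  set I₀ := ∫⁻ x in column n L, ENNReal.ofReal (σ * (ρ 0 x - c)) * momentWeight e (height x)
  have hI₀ : I₀ < ⊤ := by
    have h1 : I₀ ≤ ∫⁻ x in column n L, (2 * Pi) *
        (ENNReal.ofReal (max (e * height x) 0 * (σ * (ρ 0 x - c)))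
          + ENNReal.ofReal (|σ| * (N + |c|)) * ENNReal.ofReal ((1 + height x ^ 2)⁻¹)) := by
      refine lintegral_mono fun x => ?_
      calc ENNReal.ofReal (σ * (ρ 0 x - c)) * momentWeight e (height x)
          ≤ ENNReal.ofReal (σ * (ρ 0 x - c)) *
            (ENNReal.ofReal (2 * (max (e * height x) 0 + (1 + height x ^ 2)⁻¹)) * Pi) := by
            gcongr
            exact momentWeight_le he _
        _ = (2 * Pi) * (ENNReal.ofReal (max (e * height x) 0 * (σ * (ρ 0 x - c)))
          + ENNReal.ofReal (σ * (ρ 0 x - c)) * ENNReal.ofReal ((1 + height x ^ 2)⁻¹)) := by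
            rw [ENNReal.ofReal_mul two_pos.le, ENNReal.ofReal_add (le_max_right _ _) (by positivity),
              ENNReal.ofReal_mul (le_max_right _ _), ENNReal.ofReal_ofNat]
            ring
        _ ≤ _ := by
            gcongr _ * (_ + ?_ * _)
            refine ENNReal.ofReal_le_ofReal ((le_abs_self _).trans ?_)
            rw [abs_mul]
            gcongr
            exact (abs_sub _ _).trans (by gcongr; exact hN0 x)
    refine h1.trans_lt ?_
    rw [lintegral_const_mul _ (by fun_prop), lintegral_add_left (by fun_prop),
      lintegral_const_mul _ (by fun_prop),
      lintegral_column_comp_height hL.le (f := fun z => ENNReal.ofReal ((1 + z ^ 2)⁻¹))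
        (by fun_prop)]
    refine ENNReal.mul_lt_top (ENNReal.mul_lt_top (by simp) hPi_top) (ENNReal.add_lt_top.2 ⟨hint, ?_⟩)
    exact ENNReal.mul_lt_top ENNReal.ofReal_lt_top
      (ENNReal.mul_lt_top ENNReal.ofReal_lt_top hPi_top)
  refine ⟨8 * (ENNReal.ofReal (Real.exp ((54 + 3 * M) * T)) * I₀),
    ENNReal.mul_lt_top (by simp) (ENNReal.mul_lt_top ENNReal.ofReal_lt_top hI₀), fun t ht => ?_⟩
  have hmt : Measurable (fun x => σ * (ρ t x - c)) :=
    ((h.continuous_rho ht.1).measurable.sub_const c).const_mul σ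
  have hl : ∀ s : ℝ, HasDerivAt (fun s => σ * (s - c)) σ s := fun s => by
    simpa using ((hasDerivAt_id s).sub_const c).const_mul σ
  have hstep : ∀ a, ∫⁻ x in column n L,
        ENNReal.ofReal (weight a (height x)) * ENNReal.ofReal (σ * (ρ t x - c))
      ≤ ENNReal.ofReal (Real.exp ((54 + 3 * M) * T)) * ∫⁻ x in column n L,
        ENNReal.ofReal (weight a (height x)) * ENNReal.ofReal (σ * (ρ 0 x - c)) := by
    intro a
    obtain ⟨hi, hle⟩ := h.integral_weight_mul_le_initial hL hM0 hM hl
      (fun s => hasDerivAt_const s σ) continuous_const (fun _ => le_rfl)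
      (fun τ hτ x hx => ht0 τ hτ.1 x hx) a ht
    have i0 : IntegrableOn (fun x => weight a (height x) * (σ * (ρ 0 x - c))) (column n L) := by
      refine integrableOn_column_weight_mul (B := |σ| * (N + |c|)) hL.le a
        hm0.aestronglyMeasurable (fun x _ => ?_)
      rw [abs_mul]
      gcongr
      exact (abs_sub _ _).trans (by gcongr; exact hN0 x)
    simp_rw [← ENNReal.ofReal_mul (weight_pos _ _).le]
    rw [← ofReal_integral_eq_lintegral_ofReal i0
        (Eventually.of_forall fun x => mul_nonneg (weight_pos _ _).le (h0 x)),
      ← ofReal_integral_eq_lintegral_ofReal hi ((ae_restrict_iff' (measurableSet_column L)).2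
        (Eventually.of_forall fun x hx => mul_nonneg (weight_pos _ _).le (ht0 t ht.1 x hx))),
      ← ENNReal.ofReal_mul (Real.exp_pos _).le]
    refine ENNReal.ofReal_le_ofReal (hle.trans ?_)
    refine mul_le_mul_of_nonneg_right (Real.exp_le_exp.2 ?_)
      (integral_nonneg fun x => mul_nonneg (weight_pos _ _).le (h0 x))
    exact mul_le_mul_of_nonneg_left ht.2 (by positivity)
  calc ∫⁻ x in column n L, ENNReal.ofReal (max (e * height x) 0 * (σ * (ρ t x - c)))
      ≤ ∫⁻ x in column n L, 8 * (ENNReal.ofReal (σ * (ρ t x - c)) * momentWeight e (height x)) := by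
        refine lintegral_mono fun x => ?_
        rw [ENNReal.ofReal_mul (le_max_right _ _)]
        calc _ ≤ (8 * momentWeight e (height x)) * ENNReal.ofReal (σ * (ρ t x - c)) := by
              gcongr
              exact le_momentWeight he _
          _ = _ := by ring
    _ = 8 * ∫⁻ x in column n L, ENNReal.ofReal (σ * (ρ t x - c)) * momentWeight e (height x) := by
        rw [lintegral_const_mul]
        exact hmt.ennreal_ofReal.mul (measurable_momentWeight e)
    _ ≤ 8 * (ENNReal.ofReal (Real.exp ((54 + 3 * M) * T)) * I₀) := by
        gcongr
        simp only [I₀]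
        rw [lintegral_mul_momentWeight e hmt.ennreal_ofReal,
          lintegral_mul_momentWeight e hm0.ennreal_ofReal,
          ← lintegral_const_mul' _ _ ENNReal.ofReal_ne_top]
        refine lintegral_mono fun a => ?_
        calc _ ≤ ENNReal.ofReal a * (ENNReal.ofReal (Real.exp ((54 + 3 * M) * T)) *
              ∫⁻ x in column n L, ENNReal.ofReal (weight (e * a) (height x)) *
                ENNReal.ofReal (σ * (ρ 0 x - c))) := by
              gcongr
              exact hstep _
          _ = _ := by ring

end

noncomputable section

variable {n : ℕ}

/-! ### The excess density -/

/-- The integrand of the potential energy without the factor `g`. -/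
def excess (rhoM rhoP : ℝ) (r : Space n → ℝ) (x : Space n) : ℝ :=
  (stratifiedDensity rhoM rhoP (height x) - r x) * height x

theorem potentialDensity_eq (g rhoM rhoP : ℝ) (r : Space n → ℝ) :
    potentialDensity g rhoM rhoP r = fun x => g * excess rhoM rhoP r x := by
  funext x
  simp only [potentialDensity, excess]
  ring

section pointwise

variable {rhoM rhoP : ℝ} {r : Space n → ℝ} {x : Space n}

/-- Splits the potential energy into two one-sided moments, of ρ₊ - ρ above and of ρ - ρ₋ below,
each of the form treated by `exists_bound_moment`. -/
theorem excess_eq (rhoM rhoP : ℝ) (r : Space n → ℝ) (x : Space n) :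
    excess rhoM rhoP r x = max (1 * height x) 0 * (-1 * (r x - rhoP))
      + max (-1 * height x) 0 * (1 * (r x - rhoM)) := by
  unfold excess stratifiedDensity
  split_ifs with hz
  · rw [max_eq_left (by linarith), max_eq_right (by linarith)]; ring
  · rw [max_eq_right (by linarith), max_eq_left (by linarith)]; ring

theorem excess_eq_abs (hr : r x ∈ Icc rhoM rhoP) :
    excess rhoM rhoP r x = |stratifiedDensity rhoM rhoP (height x) - r x| * |height x| := by
  unfold excess stratifiedDensity
  split_ifs with hz
  · rw [abs_of_nonneg (by linarith [hr.2]), abs_of_nonneg hz]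
  · rw [abs_of_nonpos (by linarith [hr.1]), abs_of_neg (not_le.1 hz)]; ring

theorem excess_nonneg (hr : r x ∈ Icc rhoM rhoP) : 0 ≤ excess rhoM rhoP r x := by
  rw [excess_eq_abs hr]; positivity

theorem abs_stratified_sub_le (hr : r x ∈ Icc rhoM rhoP) :
    |stratifiedDensity rhoM rhoP (height x) - r x| ≤ rhoP - rhoM := by
  unfold stratifiedDensity
  split_ifs
  · rw [abs_le]; constructor <;> linarith [hr.1, hr.2]
  · rw [abs_le]; constructor <;> linarith [hr.1, hr.2]

theorem abs_stratified_sub_le_excess_div (hr : r x ∈ Icc rhoM rhoP) {R : ℝ} (hR : 0 < R)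
    (hx : R ≤ |height x|) :
    |stratifiedDensity rhoM rhoP (height x) - r x| ≤ excess rhoM rhoP r x / R := by
  rw [le_div_iff₀ hR, excess_eq_abs hr]
  gcongr

theorem mixingDensity_nonneg (hr : r x ∈ Icc rhoM rhoP) : 0 ≤ mixingDensity rhoM rhoP r x :=
  mul_nonneg (by linarith [hr.2]) (by linarith [hr.1])

theorem mixingDensity_le (hr : r x ∈ Icc rhoM rhoP) :
    mixingDensity rhoM rhoP r x
      ≤ (rhoP - rhoM) * |stratifiedDensity rhoM rhoP (height x) - r x| := by
  unfold mixingDensity stratifiedDensity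
  split_ifs with hz
  · rw [abs_of_nonneg (by linarith [hr.2]), mul_comm]
    exact mul_le_mul_of_nonneg_right (by linarith [hr.2]) (by linarith [hr.2])
  · rw [abs_of_nonpos (by linarith [hr.1])]
    have : -(rhoM - r x) = r x - rhoM := by ring
    rw [this]
    exact mul_le_mul_of_nonneg_right (by linarith [hr.1]) (by linarith [hr.1])

/-- Within distance `δ` of the interface the deviation from stratification is at most the jump;
further away it is at most the excess divided by `δ`. Integrated, this is the interpolation between
mixing entropy and potential energy. -/
theorem mixingDensity_le_add (hr : r x ∈ Icc rhoM rhoP) {δ : ℝ} (hδ : 0 < δ) :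
    mixingDensity rhoM rhoP r x ≤ (rhoP - rhoM) *
      ((rhoP - rhoM) * (Icc (-δ) δ).indicator 1 (height x) + excess rhoM rhoP r x / δ) := by
  refine (mixingDensity_le hr).trans ?_
  have h0 : 0 ≤ rhoP - rhoM := by linarith [hr.1, hr.2]
  refine mul_le_mul_of_nonneg_left ?_ h0
  have h1 : 0 ≤ excess rhoM rhoP r x / δ := div_nonneg (excess_nonneg hr) hδ.le
  by_cases hz : height x ∈ Icc (-δ) δ
  · rw [indicator_of_mem hz]
    have := abs_stratified_sub_le hr
    simp only [Pi.one_apply, mul_one]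
    linarith
  · rw [indicator_of_notMem hz, mul_zero, zero_add]
    refine abs_stratified_sub_le_excess_div hr hδ ?_
    by_contra h
    exact hz (abs_le.1 (not_le.1 h).le)

end pointwise

theorem measurable_stratifiedDensity (rhoM rhoP : ℝ) : Measurable (stratifiedDensity rhoM rhoP) :=
  Measurable.ite measurableSet_Ici measurable_const measurable_const

theorem measurable_excess {rhoM rhoP : ℝ} {r : Space n → ℝ} (hr : Measurable r) :
    Measurable (excess rhoM rhoP r) := by
  have hz : Measurable (height : Space n → ℝ) := continuous_height.measurable
  exact (((measurable_stratifiedDensity rhoM rhoP).comp hz).sub hr).mul hz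

theorem integrableOn_mixingDensity {L rhoM rhoP : ℝ} (hL : 0 ≤ L) {r : Space n → ℝ}
    (hr : ∀ x ∈ column n L, r x ∈ Icc rhoM rhoP) (hm : Measurable r)
    (hi : IntegrableOn (excess rhoM rhoP r) (column n L)) {δ : ℝ} (hδ : 0 < δ) :
    IntegrableOn (mixingDensity rhoM rhoP r) (column n L) ∧
      ∫ x in column n L, mixingDensity rhoM rhoP r x
        ≤ (rhoP - rhoM) * ((rhoP - rhoM) * (2 * δ * L ^ n)
          + (∫ x in column n L, excess rhoM rhoP r x) / δ) := by
  have hind : Integrable ((Icc (-δ) δ).indicator (1 : ℝ → ℝ)) :=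
    (integrable_indicator_iff measurableSet_Icc).2 (integrableOn_const (by simp))
  have hind' := integrableOn_column_comp_height (n := n) hL hind
  have hval : ∫ x in column n L, (Icc (-δ) δ).indicator (1 : ℝ → ℝ) (height x)
      = 2 * δ * L ^ n := by
    have h1 : ∀ x : Space n, (Icc (-δ) δ).indicator (1 : ℝ → ℝ) (height x)
        = (slab n L δ).indicator (fun _ => (1 : ℝ)) x ∨ x ∉ column n L := by
      intro x
      by_cases hx : x ∈ column n L
      · left
        by_cases hz : height x ∈ Icc (-δ) δ
        · rw [indicator_of_mem hz, indicator_of_mem (show x ∈ slab n L δ from ⟨hx, abs_le.2 hz⟩)]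
          rfl
        · rw [indicator_of_notMem hz, indicator_of_notMem]
          exact fun h => hz (abs_le.1 h.2)
      · exact Or.inr hx
    rw [setIntegral_congr_fun (measurableSet_column L)
      (fun x hx => (h1 x).resolve_right (fun h => h hx)),
      setIntegral_indicator (measurableSet_slab L δ),
      inter_eq_self_of_subset_right (slab_subset_column L δ), setIntegral_const, smul_eq_mul,
      mul_one, Measure.real, volume_real_slab hL hδ.le]
  have hdom : IntegrableOn (fun x => (rhoP - rhoM) *
      ((rhoP - rhoM) * (Icc (-δ) δ).indicator 1 (height x) + excess rhoM rhoP r x / δ))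
      (column n L) := ((hind'.const_mul _).add (hi.div_const δ)).const_mul _
  have hmix : IntegrableOn (mixingDensity rhoM rhoP r) (column n L) := by
    refine hdom.mono' ((hm.const_sub rhoP).mul (hm.sub_const rhoM)).aestronglyMeasurable ?_
    refine (ae_restrict_iff' (measurableSet_column L)).2 (Eventually.of_forall fun x hx => ?_)
    rw [Real.norm_eq_abs, abs_of_nonneg (mixingDensity_nonneg (hr x hx))]
    exact mixingDensity_le_add (hr x hx) hδ
  refine ⟨hmix, ?_⟩
  have e : ∫ x in column n L, (rhoP - rhoM) *
      ((rhoP - rhoM) * (Icc (-δ) δ).indicator 1 (height x) + excess rhoM rhoP r x / δ)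
      = (rhoP - rhoM) * ((rhoP - rhoM) * (2 * δ * L ^ n)
          + (∫ x in column n L, excess rhoM rhoP r x) / δ) := by
    rw [integral_const_mul, integral_add (hind'.const_mul _) (hi.div_const δ), integral_const_mul,
      integral_div, hval]
  rw [← e]
  exact setIntegral_mono_on hmix hdom (measurableSet_column L)
    (fun x hx => mixingDensity_le_add (hr x hx) hδ)

variable {L g rhoM rhoP : ℝ} {ρ : ℝ → Space n → ℝ} {u : ℝ → Space n → Space n}
  {p : ℝ → Space n → ℝ}

/-- A qualitative bound, with no useful growth in `T`. Its role is to make the supremum finite, so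
that it can be absorbed later. -/
theorem IsClassicalSolution.exists_bound_excess (h : IsClassicalSolution L g rhoM rhoP ρ u p)
    (hL : 0 < L) (h0 : IntegrableOn (excess rhoM rhoP (ρ 0)) (column n L)) (T : ℝ) :
    ∃ S : ℝ, ∀ t ∈ Ioc 0 T, IntegrableOn (excess rhoM rhoP (ρ t)) (column n L) ∧
      ∫ x in column n L, excess rhoM rhoP (ρ t) x ≤ S := by
  have hlt := h0.lintegral_lt_top
  have a1 : ∀ x, 0 ≤ -1 * (ρ 0 x - rhoP) := fun x => by linarith [(h.initial_mem x).2]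
  have a2 : ∀ x, 0 ≤ 1 * (ρ 0 x - rhoM) := fun x => by linarith [(h.initial_mem x).1]
  obtain ⟨C₁, hC₁, b₁⟩ := h.exists_bound_moment hL (e := 1) (by norm_num) a1
    ((lintegral_mono fun x => ENNReal.ofReal_le_ofReal (by
      rw [excess_eq]
      linarith [mul_nonneg (le_max_right (-1 * height x) 0) (a2 x)])).trans_lt hlt) T
  obtain ⟨C₂, hC₂, b₂⟩ := h.exists_bound_moment hL (e := -1) (by norm_num) a2
    ((lintegral_mono fun x => ENNReal.ofReal_le_ofReal (by
      rw [excess_eq]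
      linarith [mul_nonneg (le_max_right (1 * height x) 0) (a1 x)])).trans_lt hlt) T
  refine ⟨(C₁ + C₂).toReal, fun t ht => ?_⟩
  have hm : Measurable (ρ t) := (h.continuous_rho ht.1).measurable
  have hz : Measurable (height : Space n → ℝ) := continuous_height.measurable
  have hnn : 0 ≤ᵐ[volume.restrict (column n L)] excess rhoM rhoP (ρ t) :=
    (ae_restrict_iff' (measurableSet_column L)).2
      (Eventually.of_forall fun x hx => excess_nonneg (h.rho_mem hL ht.1 hx))
  have hle : ∫⁻ x in column n L, ENNReal.ofReal (excess rhoM rhoP (ρ t) x) ≤ C₁ + C₂ := by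
    calc ∫⁻ x in column n L, ENNReal.ofReal (excess rhoM rhoP (ρ t) x)
        ≤ ∫⁻ x in column n L, (ENNReal.ofReal (max (1 * height x) 0 * (-1 * (ρ t x - rhoP)))
          + ENNReal.ofReal (max (-1 * height x) 0 * (1 * (ρ t x - rhoM)))) := by
          refine lintegral_mono fun x => ?_
          rw [excess_eq]
          exact ENNReal.ofReal_add_le
      _ = _ := lintegral_add_left (by fun_prop) _
      _ ≤ C₁ + C₂ := add_le_add (b₁ t ht) (b₂ t ht)
  have htop : C₁ + C₂ < ⊤ := ENNReal.add_lt_top.2 ⟨hC₁, hC₂⟩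
  constructor
  · refine ⟨(measurable_excess hm).aestronglyMeasurable, ?_⟩
    rw [hasFiniteIntegral_iff_ofReal hnn]
    exact hle.trans_lt htop
  · rw [integral_eq_lintegral_of_nonneg_ae hnn (measurable_excess hm).aestronglyMeasurable]
    exact ENNReal.toReal_mono htop.ne hle

end

noncomputable section

variable {n : ℕ}

/-! ### Estimates for localized quantities -/

/-- A bound for the derivatives of the cutoffs. -/
def chiBound : ℝ := exists_bound_chi.choose

theorem one_le_chiBound : 1 ≤ chiBound := exists_bound_chi.choose_spec.1

theorem chiBound_pos : 0 < chiBound := one_pos.trans_le one_le_chiBound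

theorem abs_chi₁_le {R : ℝ} (hR : 1 ≤ R) (z : ℝ) : |chi₁ R z| ≤ chiBound / R :=
  (exists_bound_chi.choose_spec.2 R hR z).1

theorem abs_chi₂_le {R : ℝ} (hR : 1 ≤ R) (z : ℝ) : |chi₂ R z| ≤ chiBound / R :=
  (exists_bound_chi.choose_spec.2 R hR z).2.1

theorem abs_chi₂_le' {R : ℝ} (hR : 1 ≤ R) (z : ℝ) : |chi₂ R z| ≤ chiBound / R / R :=
  (exists_bound_chi.choose_spec.2 R hR z).2.2

theorem abs_integral_le_of_le_excess {L rhoM rhoP c : ℝ} {r f : Space n → ℝ}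
    (hi : IntegrableOn (excess rhoM rhoP r) (column n L))
    (hf : ∀ x ∈ column n L, |f x| ≤ c * excess rhoM rhoP r x) :
    |∫ x in column n L, f x| ≤ c * ∫ x in column n L, excess rhoM rhoP r x := by
  rw [← integral_const_mul, ← Real.norm_eq_abs]
  exact norm_integral_le_of_norm_le (hi.const_mul c)
    ((ae_restrict_iff' (measurableSet_column L)).2 (Eventually.of_forall hf))

/-- The localized squared gradient. -/
def gradMass (L : ℝ) (r : Space n → ℝ) (R : ℝ) : ℝ :=
  ∫ x in column n L, chi R (height x) * ‖gradient r x‖ ^ 2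

/-- The localized vertical mass flux. -/
def massFlux (L : ℝ) (r : Space n → ℝ) (v : Space n → Space n) (R : ℝ) : ℝ :=
  ∫ x in column n L, chi R (height x) * (r x * height (v x))

/-- The localized kinetic energy. -/
def kineticMass (L : ℝ) (r : Space n → ℝ) (v : Space n → Space n) (R : ℝ) : ℝ :=
  ∫ x in column n L, chi R (height x) * (1 / 2 * r x * ‖v x‖ ^ 2)

/-- The diffusive flux of kinetic energy through the cutoff region. -/
def diffusiveFlux (L : ℝ) (r : Space n → ℝ) (v : Space n → Space n) (R : ℝ) : ℝ :=
  ∫ x in column n L, chi₁ R (height x) * (1 / 2 * ‖v x‖ ^ 2 * height (gradient r x))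

/-- The flux of kinetic energy and the work of the pressure in the cutoff region. -/
def energyFlux (L : ℝ) (r : Space n → ℝ) (v : Space n → Space n) (q : Space n → ℝ) (R : ℝ) : ℝ :=
  ∫ x in column n L, chi₁ R (height x) * ((1 / 2 * r x * ‖v x‖ ^ 2 + q x) * height (v x))

variable {L g rhoM rhoP : ℝ} {ρ : ℝ → Space n → ℝ} {u : ℝ → Space n → Space n}
  {p : ℝ → Space n → ℝ}

theorem IsClassicalSolution.fluxFree (h : IsClassicalSolution L g rhoM rhoP ρ u p) (hL : 0 ≤ L)
    {t : ℝ} (ht : 0 < t) : FluxFree L (fun x => height (u t x)) := fun _ _ hm hv =>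
  integral_column_flux_eq_zero hL (h.contDiff_u_space ht) (h.periodic_u t ht.le)
    (h.incompressible t ht) (h.decay_u t ht.le) hm hv

theorem IsClassicalSolution.continuous_u (h : IsClassicalSolution L g rhoM rhoP ρ u p) {t : ℝ}
    (ht : 0 < t) : Continuous (u t) := (h.contDiff_u_space ht).continuous

theorem IsClassicalSolution.continuous_gradient (h : IsClassicalSolution L g rhoM rhoP ρ u p)
    {t : ℝ} (ht : 0 < t) : Continuous (gradient (ρ t)) :=
  (contDiff_gradient (h.contDiff_rho_space t ht)).continuous

theorem IsClassicalSolution.continuousOn_gradMass (h : IsClassicalSolution L g rhoM rhoP ρ u p)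
    {R : ℝ} (hR : 0 < R) : ContinuousOn (fun t => gradMass L (ρ t) R) (Ioi 0) := by
  have hc := isCutoff_chi hR
  exact continuousOn_integral_column (R := 3 * R) isOpen_Ioi
    ((continuousOn_height_snd hc.continuous).mul ((continuousOn_gradient h.contDiff_rho).norm.pow 2))
    (fun t x hx => by simp [hc.vanish _ hx]) L

theorem IsClassicalSolution.continuousOn_massFlux (h : IsClassicalSolution L g rhoM rhoP ρ u p)
    {R : ℝ} (hR : 0 < R) : ContinuousOn (fun t => massFlux L (ρ t) (u t) R) (Ioi 0) := by
  have hc := isCutoff_chi hR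
  exact continuousOn_integral_column (R := 3 * R) isOpen_Ioi
    ((continuousOn_height_snd hc.continuous).mul (h.contDiff_rho.continuousOn.mul
      (continuous_height.comp_continuousOn h.contDiff_u.continuousOn)))
    (fun t x hx => by simp [hc.vanish _ hx]) L

theorem IsClassicalSolution.continuousOn_diffusiveFlux
    (h : IsClassicalSolution L g rhoM rhoP ρ u p)
    {R : ℝ} (hR : 0 < R) : ContinuousOn (fun t => diffusiveFlux L (ρ t) (u t) R) (Ioi 0) := by
  have hc := isCutoff_chi hR
  exact continuousOn_integral_column (R := 3 * R) isOpen_Ioi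
    ((continuousOn_height_snd hc.continuous₁).mul ((continuousOn_const.mul
      (h.contDiff_u.continuousOn.norm.pow 2)).mul
      (continuous_height.comp_continuousOn (continuousOn_gradient h.contDiff_rho))))
    (fun t x hx => by simp [hc.vanish₁ _ hx]) L

theorem gradMass_nonneg (L : ℝ) (r : Space n → ℝ) (R : ℝ) : 0 ≤ gradMass L r R :=
  integral_nonneg fun _ => mul_nonneg (chi_nonneg _ _) (by positivity)

theorem IsClassicalSolution.hasDerivAt_kineticMass (h : IsClassicalSolution L g rhoM rhoP ρ u p)
    (hL : 0 ≤ L) {R : ℝ} (hR : 0 < R) {t : ℝ} (ht : 0 < t) :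
    HasDerivAt (fun s => kineticMass L (ρ s) (u s) R)
      (-diffusiveFlux L (ρ t) (u t) R + energyFlux L (ρ t) (u t) (p t) R
        - g * massFlux L (ρ t) (u t) R) t := by
  have hc := isCutoff_chi hR
  refine (h.hasDerivAt_kinetic hL hc ht).congr_deriv ?_
  have cu := h.continuous_u ht
  have cρ := h.continuous_rho ht
  have cp := (h.contDiff_p t ht).continuous
  have cgz : Continuous (fun x => height (gradient (ρ t) x)) :=
    continuous_height.comp (h.continuous_gradient ht)
  have cuz : Continuous (fun x => height (u t x)) := continuous_height.comp cu
  have i1 := integrableOn_column_cutoff_mul (f := fun x => 1 / 2 * ‖u t x‖ ^ 2 *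
    height (gradient (ρ t) x)) hc.continuous₁ hc.vanish₁ (by fun_prop) L
  have i2 := integrableOn_column_cutoff_mul (f := fun x => (1 / 2 * ρ t x * ‖u t x‖ ^ 2 + p t x) *
    height (u t x)) hc.continuous₁ hc.vanish₁ (by fun_prop) L
  have e : ∫ x in column n L, chi₁ R (height x) * (1 / 2 * ‖u t x‖ ^ 2 * height (gradient (ρ t) x)
          - 1 / 2 * ρ t x * ‖u t x‖ ^ 2 * height (u t x) - p t x * height (u t x))
      = diffusiveFlux L (ρ t) (u t) R - energyFlux L (ρ t) (u t) (p t) R := by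
    unfold diffusiveFlux energyFlux
    rw [← integral_sub i1 i2]
    refine integral_congr_ae (Eventually.of_forall fun x => ?_)
    simp only
    ring
  rw [e]
  unfold massFlux
  ring

/-- The pressure itself may be unbounded. Subtracting its horizontal mean does not change the work,
because the velocity has no net vertical flux, and the difference is bounded by the pressure
gradient. The cutoff derivative of order `1 / R` balances the volume of order `R`, so smallness
comes from `ε`. -/
theorem IsClassicalSolution.abs_energyFlux_le (h : IsClassicalSolution L g rhoM rhoP ρ u p)
    (hL : 0 < L) (hrho : 0 < rhoM) {D M N ε R t : ℝ}
    (hD : ∀ s ∈ slab n L 3, ‖horizontal n s‖ ≤ D)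
    (hR : 1 ≤ R) (ht : 0 < t) (hM : ∀ x, ‖u t x‖ ≤ M)
    (hN0 : 0 ≤ N) (hN : ∀ x, ‖gradient (p t) x‖ ≤ N)
    (hu : ∀ x, R ≤ |height x| → ‖u t x‖ ≤ ε) (hε : 0 ≤ ε) :
    |energyFlux L (ρ t) (u t) (p t) R|
      ≤ 6 * chiBound * L ^ n * (1 / 2 * rhoP * M ^ 2 + N * D) * ε := by
  have hR0 : 0 < R := by linarith
  have hc := isCutoff_chi hR0
  have hp1 := h.contDiff_p t ht
  have cu := h.continuous_u ht
  have cρ := h.continuous_rho ht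
  have cp := hp1.continuous
  have cpm := continuous_horizontalMean (L := L) cp
  have cuz : Continuous (fun x => height (u t x)) := continuous_height.comp cu
  have e0 := (h.fluxFree hL.le ht).integral_horizontalMean_eq_zero hL.le hc.continuous₁ hc.vanish₁
    hp1 (h.periodic_p t ht)
  have i1 := integrableOn_column_cutoff_mul (f := fun x => (1 / 2 * ρ t x * ‖u t x‖ ^ 2 + p t x) *
    height (u t x)) hc.continuous₁ hc.vanish₁ (by fun_prop) L
  have i2 := integrableOn_column_cutoff_mul (f := fun x => horizontalMean L (p t) x * height (u t x))
    hc.continuous₁ hc.vanish₁ (by fun_prop) L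
  have e1 : energyFlux L (ρ t) (u t) (p t) R = ∫ x in column n L, chi₁ R (height x) *
      ((1 / 2 * ρ t x * ‖u t x‖ ^ 2 + (p t x - horizontalMean L (p t) x)) * height (u t x)) := by
    have : energyFlux L (ρ t) (u t) (p t) R = energyFlux L (ρ t) (u t) (p t) R - 0 := by ring
    rw [this, ← e0]
    unfold energyFlux
    rw [← integral_sub i1 i2]
    refine integral_congr_ae (Eventually.of_forall fun x => ?_)
    simp only
    ring
  rw [e1]
  have hb := abs_integral_column_le (n := n) (L := L) (R := 3 * R)
    (B := chiBound / R * ((1 / 2 * rhoP * M ^ 2 + N * D) * ε)) hL.le (by positivity)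
    (f := fun x => chi₁ R (height x) *
      ((1 / 2 * ρ t x * ‖u t x‖ ^ 2 + (p t x - horizontalMean L (p t) x)) * height (u t x)))
    (fun x hx => by simp [hc.vanish₁ _ hx]) (fun x hx => ?_)
  · refine hb.trans (le_of_eq ?_)
    field_simp
    ring
  · have hr := h.rho_mem hL ht hx
    have hM0 : 0 ≤ M := (norm_nonneg _).trans (hM x)
    have h1 := abs_sub_horizontalMean_le hL hD hN0 hp1 hN x
    have hND : 0 ≤ N * D := (abs_nonneg _).trans h1
    have hrP : 0 ≤ rhoP := by linarith [hr.1, hr.2]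
    by_cases hz : |height x| < R
    · rw [chi₁_eq_zero_of_lt hR0 hz, zero_mul, abs_zero]
      have := chiBound_pos
      positivity
    · rw [abs_mul, abs_mul]
      have hz' := not_lt.1 hz
      have := chiBound_pos
      have h2 : |1 / 2 * ρ t x * ‖u t x‖ ^ 2 + (p t x - horizontalMean L (p t) x)|
          ≤ 1 / 2 * rhoP * M ^ 2 + N * D := by
        refine (abs_add_le _ _).trans (add_le_add ?_ h1)
        have h3 : 0 ≤ ρ t x := by linarith [hr.1]
        rw [abs_of_nonneg (by positivity)]
        have := hr.2
        have := hM x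
        gcongr
      gcongr
      · exact abs_chi₁_le hR _
      · exact (abs_height_le _).trans (hu x hz')

/-- No pointwise bound on ∇ρ is at hand, only its square integral. With the cutoff at height `r ^ 2`
and Young's inequality with parameter `r`, both the volume term and the gradient term gain a factor
`1 / r`. -/
theorem IsClassicalSolution.abs_diffusiveFlux_le (h : IsClassicalSolution L g rhoM rhoP ρ u p)
    (hL : 0 < L) {M r t : ℝ} (hr : 1 ≤ r) (ht : 0 < t) (hM : ∀ x, ‖u t x‖ ≤ M) :
    |diffusiveFlux L (ρ t) (u t) (r ^ 2)|
      ≤ chiBound * M ^ 2 / 4 * (12 * L ^ n + gradMass L (ρ t) (2 * r ^ 2)) / r := by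
  have hr0 : 0 < r := by linarith
  have hR : 1 ≤ r ^ 2 := one_le_pow₀ hr
  have hR0 : 0 < r ^ 2 := by positivity
  have hc := isCutoff_chi hR0
  have hc2 := isCutoff_chi (show 0 < 2 * r ^ 2 by positivity)
  have hM0 : 0 ≤ M := (norm_nonneg _).trans (hM 0)
  have hcb := chiBound_pos
  have cg := h.continuous_gradient ht
  set A := chiBound * M ^ 2 / 4 with hA
  have hA0 : 0 ≤ A := by positivity
  have iA : IntegrableOn (fun x => chi (2 * r ^ 2) (height x) * ‖gradient (ρ t) x‖ ^ 2)
      (column n L) := integrableOn_column_cutoff_mul hc2.continuous hc2.vanish (cg.norm.pow 2) L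
  have hvan : VanishesAbove (2 * r ^ 2 + r ^ 2) (fun x =>
      chi₁ (r ^ 2) (height x) * (1 / 2 * ‖u t x‖ ^ 2 * height (gradient (ρ t) x))) := by
    intro x hx
    simp only
    rw [chi₁_eq_zero_of_gt hR0 (by linarith), zero_mul]
  unfold diffusiveFlux
  rw [integral_column_eq_slab hvan]
  have i1 : IntegrableOn (fun _ : Space n => A / r ^ 3) (slab n L (2 * r ^ 2 + r ^ 2)) :=
    integrableOn_const (isCompact_slab L _).measure_ne_top
  have i2 : IntegrableOn (fun x => A / r * (chi (2 * r ^ 2) (height x) * ‖gradient (ρ t) x‖ ^ 2))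
      (slab n L (2 * r ^ 2 + r ^ 2)) := (iA.mono_set (slab_subset_column L _)).const_mul _
  have hb : ‖∫ x in slab n L (2 * r ^ 2 + r ^ 2),
      chi₁ (r ^ 2) (height x) * (1 / 2 * ‖u t x‖ ^ 2 * height (gradient (ρ t) x))‖
      ≤ ∫ x in slab n L (2 * r ^ 2 + r ^ 2), (A / r ^ 3 + A / r *
        (chi (2 * r ^ 2) (height x) * ‖gradient (ρ t) x‖ ^ 2)) := by
    refine norm_integral_le_of_norm_le (i1.add i2) (Eventually.of_forall fun x => ?_)
    rw [Real.norm_eq_abs]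
    by_cases hz : 2 * r ^ 2 < |height x|
    · rw [chi₁_eq_zero_of_gt hR0 hz, zero_mul, abs_zero]
      have := chi_nonneg (2 * r ^ 2) (height x)
      positivity
    · rw [chi_eq_one (by positivity) (not_lt.1 hz), one_mul, abs_mul, abs_mul, abs_mul]
      set G := ‖gradient (ρ t) x‖
      have h1 : |height (gradient (ρ t) x)| ≤ G := abs_height_le _
      have h2 := abs_chi₁_le hR (height x)
      have h3 : |‖u t x‖ ^ 2| ≤ M ^ 2 := by
        rw [abs_of_nonneg (by positivity)]
        have := hM x
        gcongr
      have h4 : |(1 / 2 : ℝ)| = 1 / 2 := by norm_num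
      -- The first term, times the cutoff derivative, is of order `r ^ (-3)` on a volume of order `r
      -- ^ 2`.
      have h5 : G ≤ 1 / 2 * (1 / r + r * G ^ 2) := by
        have h6 : 0 ≤ (1 - r * G) ^ 2 / r := by positivity
        have h7 : (1 - r * G) ^ 2 / r = 1 / r - 2 * G + r * G ^ 2 := by field_simp; ring
        linarith
      rw [h4]
      calc _ ≤ chiBound / r ^ 2 * (1 / 2 * M ^ 2 * (1 / 2 * (1 / r + r * G ^ 2))) := by
            gcongr
            exact h1.trans h5
        _ = A / r ^ 3 + A / r * G ^ 2 := by
            rw [hA]; field_simp; ring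
  rw [integral_add i1 i2, setIntegral_const, smul_eq_mul, Measure.real,
    volume_real_slab hL.le (by positivity), integral_const_mul] at hb
  have hmono : ∫ x in slab n L (2 * r ^ 2 + r ^ 2), chi (2 * r ^ 2) (height x) *
      ‖gradient (ρ t) x‖ ^ 2 ≤ gradMass L (ρ t) (2 * r ^ 2) :=
    setIntegral_mono_set iA (Eventually.of_forall fun x => mul_nonneg (chi_nonneg _ _) (by positivity))
      (slab_subset_column L _).eventuallyLE
  refine hb.trans ?_
  calc _ ≤ 2 * (2 * r ^ 2 + r ^ 2) * L ^ n * (A / r ^ 3)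
        + A / r * gradMass L (ρ t) (2 * r ^ 2) := by gcongr
    _ = A * (6 * L ^ n + gradMass L (ρ t) (2 * r ^ 2)) / r := by field_simp; ring
    _ ≤ _ := by
        gcongr
        norm_num

theorem IsClassicalSolution.abs_massFlux_le (h : IsClassicalSolution L g rhoM rhoP ρ u p)
    (hL : 0 < L) (hrho : 0 < rhoM) {D lam R t : ℝ} (hD0 : 0 ≤ D)
    (hD : ∀ s ∈ slab n L 3, ‖horizontal n s‖ ≤ D) (hlam : 0 < lam)
    (hR : 0 < R) (ht : 0 < t) :
    |massFlux L (ρ t) (u t) R|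
      ≤ D / 2 * (lam * gradMass L (ρ t) R + lam⁻¹ * (2 / rhoM * kineticMass L (ρ t) (u t) R)) := by
  have hc := isCutoff_chi hR
  have cu := h.continuous_u ht
  have cρ := h.continuous_rho ht
  have cuz : Continuous (fun x => height (u t x)) := continuous_height.comp cu
  refine ((h.fluxFree hL.le ht).abs_integral_mul_le hL hlam hD hc (chi_nonneg R)
    (h.contDiff_rho_space t ht) (h.periodic_rho t ht.le) cuz).trans ?_
  have h1 : ∫ x in column n L, chi R (height x) * height (u t x) ^ 2
      ≤ 2 / rhoM * kineticMass L (ρ t) (u t) R := by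
    unfold kineticMass
    rw [← integral_const_mul]
    refine setIntegral_mono_on
      (integrableOn_column_cutoff_mul (f := fun x => height (u t x) ^ 2) hc.continuous hc.vanish
        (by fun_prop) L)
      ((integrableOn_column_cutoff_mul (f := fun x => 1 / 2 * ρ t x * ‖u t x‖ ^ 2) hc.continuous
        hc.vanish (by fun_prop) L).const_mul _) (measurableSet_column L) (fun x hx => ?_)
    have hr := (h.rho_mem hL ht hx).1
    have h2 : height (u t x) ^ 2 ≤ ‖u t x‖ ^ 2 := by
      rw [← sq_abs (height (u t x))]
      have := abs_height_le (u t x)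
      gcongr
    have h3 : ‖u t x‖ ^ 2 ≤ 2 / rhoM * (1 / 2 * ρ t x * ‖u t x‖ ^ 2) := by
      have : 2 / rhoM * (1 / 2 * ρ t x * ‖u t x‖ ^ 2) = (ρ t x / rhoM) * ‖u t x‖ ^ 2 := by
        field_simp
      rw [this]
      exact le_mul_of_one_le_left (by positivity) ((one_le_div hrho).2 hr)
    calc _ ≤ chi R (height x) * (2 / rhoM * (1 / 2 * ρ t x * ‖u t x‖ ^ 2)) :=
          mul_le_mul_of_nonneg_left (h2.trans h3) (chi_nonneg _ _)
      _ = _ := by ring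
  unfold gradMass
  gcongr

/-- The factor `z` removes the jump at the interface, so the product is a legitimate test function
for the flux-free property. -/
theorem continuous_stratified_mul (rhoM rhoP : ℝ) {m : ℝ → ℝ} (hm : Continuous m) :
    Continuous (fun z => stratifiedDensity rhoM rhoP z * (m z * z)) := by
  have : (fun z => stratifiedDensity rhoM rhoP z * (m z * z))
      = fun z => if 0 ≤ z then rhoP * (m z * z) else rhoM * (m z * z) := by
    funext z
    simp only [stratifiedDensity, ite_mul]
  rw [this]
  refine Continuous.if_le (by fun_prop) (by fun_prop) continuous_const continuous_id ?_
  intro z hz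
  have : z = 0 := hz.symm
  simp [this]

/-- Testing the density equation with `z` times the cutoff produces the mass flux plus cutoff
errors. The diffusive one is merely bounded uniformly in `R`, which is harmless since it contributes
linearly in time. The convective one carries a factor of size `z` and is tamed by subtracting the
stratified density. -/
theorem IsClassicalSolution.exists_deriv_moment (h : IsClassicalSolution L g rhoM rhoP ρ u p)
    (hL : 0 < L) (hrho : 0 < rhoM) {M S R t : ℝ} (hR : 1 ≤ R) (ht : 0 < t)
    (hM : ∀ x, ‖u t x‖ ≤ M) (hi : IntegrableOn (excess rhoM rhoP (ρ t)) (column n L))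
    (hS : ∫ x in column n L, excess rhoM rhoP (ρ t) x ≤ S) :
    ∃ q, HasDerivAt (fun s => -∫ x in column n L, chi R (height x) * height x * ρ s x) q t ∧
      |q + massFlux L (ρ t) (u t) R|
        ≤ 24 * chiBound * rhoP * L ^ n + chiBound * M * S / R := by
  have hR0 : 0 < R := by linarith
  have hcb := chiBound_pos
  have hM0 : 0 ≤ M := (norm_nonneg _).trans (hM 0)
  have hc := isCutoff_chi hR0
  have hφ := hc.mul (w := fun z => z) (w₁ := fun _ => 1) (w₂ := fun _ => 0)
    (fun z => hasDerivAt_id z) (fun z => hasDerivAt_const z 1) continuous_const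
  have hd := h.hasDerivAt_integral_comp hL.le hφ (G := fun s => s) (G₁ := fun _ => 1)
    (G₂ := fun _ => 0) (fun s => hasDerivAt_id s) (fun s => hasDerivAt_const s 1)
    continuous_const ht
  refine ⟨_, hd.neg, ?_⟩
  have cu := h.continuous_u ht
  have cρ := h.continuous_rho ht
  have cz : Continuous (height : Space n → ℝ) := continuous_height
  have cuz : Continuous (fun x => height (u t x)) := continuous_height.comp cu
  -- the diffusive part
  have i1 := integrableOn_column_cutoff_mul hφ.continuous₂ hφ.vanish₂ cρ L
  have b1 : |∫ x in column n L, (chi₂ R (height x) * height x + 2 * (chi₁ R (height x) * 1)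
      + chi R (height x) * 0) * ρ t x| ≤ 24 * chiBound * rhoP * L ^ n := by
    have := abs_integral_column_le (n := n) (L := L) (R := 3 * R) (B := 4 * chiBound / R * rhoP)
      hL.le (by positivity) (f := fun x => (chi₂ R (height x) * height x
        + 2 * (chi₁ R (height x) * 1) + chi R (height x) * 0) * ρ t x)
      (fun x hx => by
        have := hφ.vanish₂ _ hx
        simp only at this ⊢
        rw [this, zero_mul])
      (fun x hx => by
        have hr := h.rho_mem hL ht hx
        have h1 : |chi₂ R (height x) * height x| ≤ 2 * chiBound / R := by
          by_cases hz : 2 * R < |height x|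
          · rw [chi₂_eq_zero_of_gt hR0 hz, zero_mul, abs_zero]; positivity
          · rw [abs_mul]
            calc _ ≤ chiBound / R / R * (2 * R) := by
                  gcongr
                  · exact abs_chi₂_le' hR _
                  · exact not_lt.1 hz
              _ = _ := by field_simp
        have h2 : |2 * (chi₁ R (height x) * 1)| ≤ 2 * chiBound / R := by
          rw [mul_one, abs_mul, abs_of_pos two_pos, mul_div_assoc]
          gcongr
          exact abs_chi₁_le hR _
        rw [abs_mul, mul_zero, add_zero, abs_of_pos (hrho.trans_le hr.1)]
        have h3 : |chi₂ R (height x) * height x + 2 * (chi₁ R (height x) * 1)|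
            ≤ 4 * chiBound / R := by
          refine (abs_add_le _ _).trans ((add_le_add h1 h2).trans (le_of_eq ?_))
          ring
        have := hr.1
        have := hr.2
        gcongr
        linarith)
    refine this.trans (le_of_eq ?_)
    field_simp
    ring
  -- the convective error
  have i2 := integrableOn_column_cutoff_mul (f := fun x => height x * (ρ t x * height (u t x)))
    hc.continuous₁ hc.vanish₁ (by fun_prop) L
  have i3 := integrableOn_column_cutoff_mul (f := fun x => ρ t x * height (u t x))
    hc.continuous hc.vanish (by fun_prop) L
  have hflux := (h.fluxFree hL.le ht)
    (fun z => stratifiedDensity rhoM rhoP z * (chi₁ R z * z)) (3 * R)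
    (continuous_stratified_mul rhoM rhoP hc.continuous₁) (fun z hz => by simp [hc.vanish₁ z hz])
  have i4 : IntegrableOn (fun x => stratifiedDensity rhoM rhoP (height x) *
      (chi₁ R (height x) * height x) * height (u t x)) (column n L) :=
    integrableOn_column_cutoff_mul (R := 3 * R)
      (continuous_stratified_mul rhoM rhoP hc.continuous₁) (fun z hz => by simp [hc.vanish₁ z hz]) cuz L
  have b2 : |∫ x in column n L, chi₁ R (height x) * (height x * (ρ t x * height (u t x)))|
      ≤ chiBound * M * S / R := by
    -- The subtracted term is a function of the height times the vertical velocity, hence has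
    -- integral zero; the difference is an excess, which is integrable.
    have e : ∫ x in column n L, chi₁ R (height x) * (height x * (ρ t x * height (u t x)))
        = ∫ x in column n L, (chi₁ R (height x) * (height x * (ρ t x * height (u t x)))
          - stratifiedDensity rhoM rhoP (height x) * (chi₁ R (height x) * height x)
            * height (u t x)) := by
      rw [integral_sub i2 i4, hflux, sub_zero]
    rw [e]
    refine (abs_integral_le_of_le_excess (c := chiBound / R * M) hi (fun x hx => ?_)).trans ?_
    · have hr := h.rho_mem hL ht hx
      have e2 : chi₁ R (height x) * (height x * (ρ t x * height (u t x)))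
          - stratifiedDensity rhoM rhoP (height x) * (chi₁ R (height x) * height x)
            * height (u t x) = - (chi₁ R (height x) * height (u t x) * excess rhoM rhoP (ρ t) x) := by
        unfold excess; ring
      rw [e2, abs_neg, abs_mul, abs_of_nonneg (excess_nonneg hr), abs_mul]
      refine mul_le_mul_of_nonneg_right ?_ (excess_nonneg hr)
      gcongr
      · exact abs_chi₁_le hR _
      · exact (abs_height_le _).trans (hM x)
    · calc _ ≤ chiBound / R * M * S := by gcongr
        _ = _ := by ring
  have e3 : ∫ x in column n L, ρ t x * ((chi₂ R (height x) * height x + 2 * (chi₁ R (height x) * 1)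
      + chi R (height x) * 0) + height (u t x) *
        (chi₁ R (height x) * height x + chi R (height x) * 1))
      = (∫ x in column n L, (chi₂ R (height x) * height x + 2 * (chi₁ R (height x) * 1)
      + chi R (height x) * 0) * ρ t x)
        + (∫ x in column n L, chi₁ R (height x) * (height x * (ρ t x * height (u t x))))
        + massFlux L (ρ t) (u t) R := by
    unfold massFlux
    rw [← integral_add i1 i2, ← integral_add (by exact i1.add i2) i3]
    refine integral_congr_ae (Eventually.of_forall fun x => ?_)
    simp only
    ring
  rw [e3]
  simp only [zero_mul, mul_zero, integral_zero, sub_zero]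
  simp only [mul_zero] at b1
  rw [show ∀ a b c : ℝ, -(a + b + c) + c = -(a + b) by intros; ring, abs_neg]
  exact (abs_add_le _ _).trans (add_le_add b1 b2)

/-- The renormalized equation with second derivative -2 produces the gradient integral. The cutoff
errors live at `|z| ≥ R ≥ 1`, where the mixing integrand is dominated by the excess. -/
theorem IsClassicalSolution.exists_deriv_mixing (h : IsClassicalSolution L g rhoM rhoP ρ u p)
    (hL : 0 < L) {M S R t : ℝ} (hR : 1 ≤ R) (ht : 0 < t)
    (hM : ∀ x, ‖u t x‖ ≤ M) (hi : IntegrableOn (excess rhoM rhoP (ρ t)) (column n L))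
    (hS : ∫ x in column n L, excess rhoM rhoP (ρ t) x ≤ S) :
    ∃ q, HasDerivAt
        (fun s => ∫ x in column n L, chi R (height x) * mixingDensity rhoM rhoP (ρ s) x) q t ∧
      2 * gradMass L (ρ t) R - chiBound * (1 + M) * (rhoP - rhoM) * S / R ≤ q := by
  have hR0 : 0 < R := by linarith
  have hcb := chiBound_pos
  have hM0 : 0 ≤ M := (norm_nonneg _).trans (hM 0)
  have hc := isCutoff_chi hR0
  have hS0 : 0 ≤ S := le_trans (setIntegral_nonneg (measurableSet_column L)
    fun x hx => excess_nonneg (h.rho_mem hL ht hx)) hS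
  have hG : ∀ s, HasDerivAt (fun s => (rhoP - s) * (s - rhoM)) (rhoP + rhoM - 2 * s) s := by
    intro s
    refine (((hasDerivAt_id s).const_sub rhoP).mul ((hasDerivAt_id s).sub_const rhoM)).congr_deriv ?_
    simp only [id]
    ring
  have hG₁ : ∀ s : ℝ, HasDerivAt (fun s => rhoP + rhoM - 2 * s) (-2) s := by
    intro s
    simpa using ((hasDerivAt_id s).const_mul 2).const_sub (rhoP + rhoM)
  have hd := h.hasDerivAt_integral_comp hL.le hc hG hG₁ continuous_const ht
  refine ⟨_, hd, ?_⟩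
  have b : |∫ x in column n L, (rhoP - ρ t x) * (ρ t x - rhoM) *
      (chi₂ R (height x) + height (u t x) * chi₁ R (height x))|
      ≤ chiBound * (1 + M) * (rhoP - rhoM) / R * ∫ x in column n L, excess rhoM rhoP (ρ t) x := by
    refine abs_integral_le_of_le_excess hi (fun x hx => ?_)
    have hr := h.rho_mem hL ht hx
    have hΔ : 0 ≤ rhoP - rhoM := by linarith [hr.1, hr.2]
    by_cases hz : |height x| < R
    · rw [chi₁_eq_zero_of_lt hR0 hz, chi₂_eq_zero_of_lt hR0 hz]
      have := excess_nonneg hr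
      simp only [mul_zero, add_zero, abs_zero]
      positivity
    · have hz' := not_lt.1 hz
      have h1 := mixingDensity_nonneg hr
      have h2 := mixingDensity_le hr
      have h3 := abs_stratified_sub_le_excess_div hr (R := 1) one_pos (hR.trans hz')
      rw [div_one] at h3
      have h4 : |chi₂ R (height x) + height (u t x) * chi₁ R (height x)|
          ≤ chiBound / R * (1 + M) := by
        refine (abs_add_le _ _).trans ?_
        rw [abs_mul]
        calc _ ≤ chiBound / R + M * (chiBound / R) := by
              gcongr
              · exact abs_chi₂_le hR _
              · exact (abs_height_le _).trans (hM x)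
              · exact abs_chi₁_le hR _
          _ = _ := by ring
      change |mixingDensity rhoM rhoP (ρ t) x * _| ≤ _
      rw [abs_mul, abs_of_nonneg h1]
      calc _ ≤ ((rhoP - rhoM) * excess rhoM rhoP (ρ t) x) * (chiBound / R * (1 + M)) := by
            refine mul_le_mul (h2.trans ?_) h4 (abs_nonneg _) ?_
            · gcongr
            · exact mul_nonneg hΔ (excess_nonneg hr)
        _ = _ := by ring
  have hr := h.rho_mem (x := 0) hL ht (fun i => ⟨le_rfl, hL.le⟩)
  have hΔ : 0 ≤ rhoP - rhoM := by linarith [hr.1, hr.2]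
  have b' : chiBound * (1 + M) * (rhoP - rhoM) / R * ∫ x in column n L, excess rhoM rhoP (ρ t) x
      ≤ chiBound * (1 + M) * (rhoP - rhoM) * S / R := by
    calc _ ≤ chiBound * (1 + M) * (rhoP - rhoM) / R * S :=
          mul_le_mul_of_nonneg_left hS (by positivity)
      _ = _ := by ring
  have e : ∫ x in column n L, chi R (height x) * (-2 * ‖gradient (ρ t) x‖ ^ 2)
      = -2 * gradMass L (ρ t) R := by
    unfold gradMass
    rw [← integral_const_mul]
    refine integral_congr_ae (Eventually.of_forall fun x => ?_)
    simp only
    ring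
  rw [e]
  have := (abs_le.1 b).1
  linarith

end

noncomputable section

variable {n : ℕ}

/-! ### Growth of the potential energy -/

variable {L g rhoM rhoP : ℝ} {ρ : ℝ → Space n → ℝ} {u : ℝ → Space n → Space n}
  {p : ℝ → Space n → ℝ}

theorem intervalIntegrable_of_continuousOn_Ioi {f : ℝ → ℝ} (hf : ContinuousOn f (Ioi 0)) {a b : ℝ}
    (ha : 0 < a) (hb : 0 < b) : IntervalIntegrable f volume a b :=
  (hf.mono fun _ ht => (lt_min ha hb).trans_le ht.1).intervalIntegrable

theorem integral_chi_mul_le {f : Space n → ℝ} (hf : IntegrableOn f (column n L))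
    (h0 : ∀ x ∈ column n L, 0 ≤ f x) {R : ℝ} (hR : 0 < R) :
    ∫ x in column n L, chi R (height x) * f x ≤ ∫ x in column n L, f x := by
  refine setIntegral_mono_on ?_ hf (measurableSet_column L)
    fun x hx => mul_le_of_le_one_left (h0 x hx) (chi_le_one _ _)
  refine Integrable.mono hf (((isCutoff_chi hR).continuous.comp continuous_height).aestronglyMeasurable.mul
    hf.aestronglyMeasurable) (Eventually.of_forall fun x => ?_)
  rw [norm_mul, Real.norm_of_nonneg (chi_nonneg _ _)]
  exact mul_le_of_le_one_left (norm_nonneg _) (chi_le_one _ _)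

/-- The mixing production is integrated in time; the mixing integral at time 1 is nonnegative and
dropped, and that at time `T` is bounded by interpolation. -/
theorem IsClassicalSolution.integral_gradMass_le (h : IsClassicalSolution L g rhoM rhoP ρ u p)
    (hL : 0 < L) {M S R T δ : ℝ} (hR : 1 ≤ R) (hT : 1 ≤ T)
    (hM : ∀ t ∈ Icc 1 T, ∀ x, ‖u t x‖ ≤ M)
    (hi : ∀ t ∈ Icc 1 T, IntegrableOn (excess rhoM rhoP (ρ t)) (column n L) ∧
      ∫ x in column n L, excess rhoM rhoP (ρ t) x ≤ S) (hδ : 0 < δ) :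
    2 * ∫ t in 1..T, gradMass L (ρ t) R
      ≤ (rhoP - rhoM) * ((rhoP - rhoM) * (2 * δ * L ^ n) + S / δ)
        + (T - 1) * (chiBound * (1 + M) * (rhoP - rhoM) * S / R) := by
  have hR0 : 0 < R := by linarith
  have hT0 : 0 < T := by linarith
  have hT1 : T ∈ Icc 1 T := ⟨hT, le_rfl⟩
  have h1 : (1 : ℝ) ∈ Icc 1 T := ⟨le_rfl, hT⟩
  have hr : ∀ t, 0 < t → ∀ x ∈ column n L, ρ t x ∈ Icc rhoM rhoP := fun t ht x hx =>
    h.rho_mem hL ht hx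
  have hΔ : 0 ≤ rhoP - rhoM := by
    have := hr 1 one_pos 0 fun i => ⟨le_rfl, hL.le⟩
    linarith [this.1, this.2]
  have hd : ∀ t ∈ Icc 1 T, _ := fun t ht => h.exists_deriv_mixing hL hR (one_pos.trans_le ht.1)
    (hM t ht) (hi t ht).1 (hi t ht).2
  choose! q hq hq' using hd
  have iA := intervalIntegrable_of_continuousOn_Ioi (h.continuousOn_gradMass hR0) one_pos hT0
  have key := intervalIntegral.integral_le_sub_of_hasDeriv_right_of_le hT
    (fun t ht => (hq t ht).continuousAt.continuousWithinAt)
    (fun t ht => (hq t (Ioo_subset_Icc_self ht)).hasDerivWithinAt)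
    ((intervalIntegrable_iff_integrableOn_Icc_of_le hT).1
      ((iA.const_mul 2).sub intervalIntegrable_const))
    (fun t ht => hq' t (Ioo_subset_Icc_self ht))
  rw [intervalIntegral.integral_sub (iA.const_mul 2) intervalIntegrable_const,
    intervalIntegral.integral_const_mul, intervalIntegral.integral_const, smul_eq_mul] at key
  obtain ⟨hm, hb⟩ := integrableOn_mixingDensity hL.le (hr T hT0)
    (h.continuous_rho hT0).measurable (hi T hT1).1 hδ
  have h2 := integral_chi_mul_le hm (fun x hx => mixingDensity_nonneg (hr T hT0 x hx)) hR0
  have h3 : 0 ≤ ∫ x in column n L, chi R (height x) * mixingDensity rhoM rhoP (ρ 1) x :=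
    setIntegral_nonneg (measurableSet_column L) fun x hx =>
      mul_nonneg (chi_nonneg _ _) (mixingDensity_nonneg (hr 1 one_pos x hx))
  have h4 : (rhoP - rhoM) * ((rhoP - rhoM) * (2 * δ * L ^ n)
          + (∫ x in column n L, excess rhoM rhoP (ρ T) x) / δ)
      ≤ (rhoP - rhoM) * ((rhoP - rhoM) * (2 * δ * L ^ n) + S / δ) := by
    have := (hi T hT1).2
    gcongr
  linarith

/-- The pressure carries no regularity in time. Measurability is read off from the energy balance,
which expresses this flux through the derivative of the kinetic energy and two fluxes continuous in
time. -/
theorem IsClassicalSolution.aestronglyMeasurable_energyFlux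
    (h : IsClassicalSolution L g rhoM rhoP ρ u p) (hL : 0 < L) {T R : ℝ} (hT : 1 ≤ T) (hR : 0 < R) :
    AEStronglyMeasurable (fun t => energyFlux L (ρ t) (u t) (p t) R)
      (volume.restrict (uIoc 1 T)) := by
  have hpos : uIoc 1 T ⊆ Ioi (0 : ℝ) := by
    rw [uIoc_of_le hT]; exact fun t ht => one_pos.trans ht.1
  have hm : AEStronglyMeasurable (fun t => deriv (fun s => kineticMass L (ρ s) (u s) R) t
      + diffusiveFlux L (ρ t) (u t) R + g * massFlux L (ρ t) (u t) R)
      (volume.restrict (uIoc 1 T)) :=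
    ((stronglyMeasurable_deriv _).aestronglyMeasurable.add
      (((h.continuousOn_diffusiveFlux hR).mono hpos).aestronglyMeasurable measurableSet_uIoc)).add
      (((continuousOn_const.mul (h.continuousOn_massFlux hR)).mono hpos).aestronglyMeasurable
        measurableSet_uIoc)
  refine hm.congr ((ae_restrict_iff' measurableSet_uIoc).2 (Eventually.of_forall fun t ht => ?_))
  simp only
  rw [(h.hasDerivAt_kineticMass hL.le hR (hpos ht)).deriv]
  ring

theorem IsClassicalSolution.exists_abs_energyFlux_le
    (h : IsClassicalSolution L g rhoM rhoP ρ u p) (hL : 0 < L) (hrho : 0 < rhoM) (T : ℝ) :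
    ∃ B M : ℝ, 0 ≤ B ∧ ∀ t ∈ Icc 1 T, (∀ x, ‖u t x‖ ≤ M) ∧ ∀ R ≥ 1, ∀ ε ≥ 0,
      (∀ x, R ≤ |height x| → ‖u t x‖ ≤ ε) → |energyFlux L (ρ t) (u t) (p t) R| ≤ B * ε := by
  obtain ⟨M, hM0, hM⟩ := h.exists_bound_u T
  obtain ⟨N, hN⟩ := h.bounded_grad_p 1 T one_pos
  obtain ⟨D, hD0, hD⟩ := exists_bound_horizontal n L
  have hrP : 0 < rhoP := by
    have := h.initial_mem 0
    linarith [this.1, this.2]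
  have hcb := chiBound_pos
  refine ⟨6 * chiBound * L ^ n * (1 / 2 * rhoP * M ^ 2 + max N 0 * D), M, by positivity,
    fun t ht => ⟨hM t ⟨by linarith [ht.1], ht.2⟩, fun R hR ε hε hu => ?_⟩⟩
  exact h.abs_energyFlux_le hL hrho hD hR (by linarith [ht.1]) (hM t ⟨by linarith [ht.1], ht.2⟩)
    (le_max_right _ _) (fun x => (hN t ht x).trans (le_max_left _ _)) hu hε

theorem IsClassicalSolution.intervalIntegrable_abs_energyFlux
    (h : IsClassicalSolution L g rhoM rhoP ρ u p) (hL : 0 < L) (hrho : 0 < rhoM) {T R : ℝ}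
    (hT : 1 ≤ T) (hR : 1 ≤ R) :
    IntervalIntegrable (fun t => |energyFlux L (ρ t) (u t) (p t) R|) volume 1 T := by
  obtain ⟨B, M, hB, hb⟩ := h.exists_abs_energyFlux_le hL hrho T
  refine (intervalIntegrable_const (c := B * M)).mono_fun
    (h.aestronglyMeasurable_energyFlux hL hT (by linarith)).norm
    ((ae_restrict_iff' measurableSet_uIoc).2 (Eventually.of_forall fun t ht => ?_))
  rw [uIoc_of_le hT] at ht
  have hM := (hb t (Ioc_subset_Icc_self ht)).1
  simp only [Real.norm_eq_abs, abs_abs]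
  exact ((hb t (Ioc_subset_Icc_self ht)).2 R hR M ((norm_nonneg _).trans (hM 0))
    fun x _ => hM x).trans (le_abs_self _)

/-- Dominated convergence: the velocity decays at each time, with no uniformity in time assumed,
while the flux is bounded uniformly on the time interval. -/
theorem IsClassicalSolution.tendsto_integral_energyFlux
    (h : IsClassicalSolution L g rhoM rhoP ρ u p) (hL : 0 < L) (hrho : 0 < rhoM) {T : ℝ}
    (hT : 1 ≤ T) :
    Tendsto (fun R => ∫ t in 1..T, |energyFlux L (ρ t) (u t) (p t) R|) atTop (𝓝 0) := by
  obtain ⟨B, M, hB, hb⟩ := h.exists_abs_energyFlux_le hL hrho T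
  have key : Tendsto (fun R => ∫ t in 1..T, |energyFlux L (ρ t) (u t) (p t) R|) atTop
      (𝓝 (∫ t in 1..T, (0 : ℝ))) := by
    refine intervalIntegral.tendsto_integral_filter_of_dominated_convergence (fun _ => B * M)
      ?_ ?_ intervalIntegrable_const ?_
    · filter_upwards [eventually_ge_atTop 1] with R hR
      exact (h.aestronglyMeasurable_energyFlux hL hT (by linarith)).norm
    · filter_upwards [eventually_ge_atTop 1] with R hR
      refine Eventually.of_forall fun t ht => ?_
      rw [uIoc_of_le hT] at ht
      have hM := (hb t (Ioc_subset_Icc_self ht)).1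
      rw [Real.norm_eq_abs, abs_abs]
      exact (hb t (Ioc_subset_Icc_self ht)).2 R hR M ((norm_nonneg _).trans (hM 0)) fun x _ => hM x
    · refine Eventually.of_forall fun t ht => ?_
      rw [uIoc_of_le hT] at ht
      rw [Metric.tendsto_atTop]
      intro ε hε
      obtain ⟨R₀, hR₀⟩ := h.decay_u t (by linarith [ht.1]) (ε / (B + 1)) (by positivity)
      refine ⟨max R₀ 1, fun R hR => ?_⟩
      rw [Real.dist_eq, sub_zero, abs_abs]
      refine ((hb t (Ioc_subset_Icc_self ht)).2 R ((le_max_right _ _).trans hR) (ε / (B + 1))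
        (by positivity) fun x hx => hR₀ x (((le_max_left _ _).trans hR).trans hx)).trans_lt ?_
      rw [mul_div_assoc', div_lt_iff₀ (by positivity)]
      linarith
  simpa using key

theorem IsClassicalSolution.tendsto_integral_diffusiveFlux
    (h : IsClassicalSolution L g rhoM rhoP ρ u p) (hL : 0 < L) {S T : ℝ} (hT : 1 ≤ T)
    (hi : ∀ t ∈ Icc 1 T, IntegrableOn (excess rhoM rhoP (ρ t)) (column n L) ∧
      ∫ x in column n L, excess rhoM rhoP (ρ t) x ≤ S) :
    Tendsto (fun r => ∫ t in 1..T, |diffusiveFlux L (ρ t) (u t) (r ^ 2)|) atTop (𝓝 0) := by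
  obtain ⟨M, hM0, hM⟩ := h.exists_bound_u T
  have hM' : ∀ t ∈ Icc 1 T, ∀ x, ‖u t x‖ ≤ M := fun t ht => hM t ⟨by linarith [ht.1], ht.2⟩
  have hT0 : 0 < T := by linarith
  have hcb := chiBound_pos
  have hr := h.rho_mem (x := 0) hL one_pos fun i => ⟨le_rfl, hL.le⟩
  have hΔ : 0 ≤ rhoP - rhoM := by linarith [hr.1, hr.2]
  have hS : 0 ≤ S := (setIntegral_nonneg (measurableSet_column L) fun x hx =>
    excess_nonneg (h.rho_mem hL one_pos hx)).trans (hi 1 ⟨le_rfl, hT⟩).2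
  set G := (rhoP - rhoM) * ((rhoP - rhoM) * (2 * 1 * L ^ n) + S / 1)
    + (T - 1) * (chiBound * (1 + M) * (rhoP - rhoM) * S) with hG
  set B := chiBound * M ^ 2 / 4 * (12 * L ^ n * (T - 1) + G) with hB
  refine squeeze_zero' (g := fun r => B / r)
    (Eventually.of_forall fun r => intervalIntegral.integral_nonneg hT fun _ _ => abs_nonneg _) ?_
    (tendsto_const_nhds.div_atTop tendsto_id)
  filter_upwards [eventually_ge_atTop 1] with r hr1
  have hr0 : 0 < r := by linarith
  have hR : 1 ≤ 2 * r ^ 2 := by nlinarith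
  have iA := intervalIntegrable_of_continuousOn_Ioi
    (h.continuousOn_gradMass (L := L) (R := 2 * r ^ 2) (by positivity)) one_pos hT0
  have iF := (intervalIntegrable_of_continuousOn_Ioi
    (h.continuousOn_diffusiveFlux (L := L) (R := r ^ 2) (by positivity)) one_pos hT0).norm
  have h0 : 0 ≤ ∫ t in 1..T, gradMass L (ρ t) (2 * r ^ 2) :=
    intervalIntegral.integral_nonneg hT fun _ _ => gradMass_nonneg _ _ _
  have h1 : ∫ t in 1..T, gradMass L (ρ t) (2 * r ^ 2) ≤ G := by
    have h2 := h.integral_gradMass_le hL hR hT hM' hi one_pos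
    have h3 : chiBound * (1 + M) * (rhoP - rhoM) * S / (2 * r ^ 2)
        ≤ chiBound * (1 + M) * (rhoP - rhoM) * S := div_le_self (by positivity) hR
    have h4 := mul_le_mul_of_nonneg_left h3 (sub_nonneg.2 hT)
    linarith
  calc ∫ t in 1..T, |diffusiveFlux L (ρ t) (u t) (r ^ 2)|
      ≤ ∫ t in 1..T, chiBound * M ^ 2 / 4 / r * (12 * L ^ n + gradMass L (ρ t) (2 * r ^ 2)) := by
        refine intervalIntegral.integral_mono_on hT iF
          ((intervalIntegrable_const.add iA).const_mul _) fun t ht => ?_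
        refine (h.abs_diffusiveFlux_le hL hr1 (by linarith [ht.1]) (hM' t ht)).trans (le_of_eq ?_)
        ring
    _ = chiBound * M ^ 2 / 4 / r * (12 * L ^ n * (T - 1)
          + ∫ t in 1..T, gradMass L (ρ t) (2 * r ^ 2)) := by
        rw [intervalIntegral.integral_const_mul,
          intervalIntegral.integral_add intervalIntegrable_const iA,
          intervalIntegral.integral_const, smul_eq_mul]
        ring
    _ ≤ chiBound * M ^ 2 / 4 / r * (12 * L ^ n * (T - 1) + G) := by gcongr
    _ = B / r := by rw [hB]; ring

/-! ### Localized balances of potential and kinetic energy -/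

/-- The localized potential energy, without the factor `g`. -/
def excessMass (L rhoM rhoP : ℝ) (r : Space n → ℝ) (R : ℝ) : ℝ :=
  ∫ x in column n L, chi R (height x) * excess rhoM rhoP r x

/-- A bound for the difference between the rate of change of the localized potential energy
and the mass flux. -/
def momentError (n : ℕ) (L rhoP M S R : ℝ) : ℝ :=
  24 * chiBound * rhoP * L ^ n + chiBound * M * S / R

/-- The stratified part of the localized excess is constant in time, so increments of the excess are
those of minus the first moment, whose derivative is already known. -/
theorem IsClassicalSolution.exists_deriv_excessMass
    (h : IsClassicalSolution L g rhoM rhoP ρ u p) (hL : 0 < L) (hrho : 0 < rhoM)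
    {M S R T : ℝ} (hR : 1 ≤ R)
    (hM : ∀ t ∈ Icc 1 T, ∀ x, ‖u t x‖ ≤ M)
    (hi : ∀ t ∈ Icc 1 T, IntegrableOn (excess rhoM rhoP (ρ t)) (column n L) ∧
      ∫ x in column n L, excess rhoM rhoP (ρ t) x ≤ S) :
    ∃ Q q : ℝ → ℝ, (∀ t ∈ Icc 1 T, HasDerivAt Q (q t) t ∧
      |q t + massFlux L (ρ t) (u t) R| ≤ momentError n L rhoP M S R) ∧
      ∀ t ∈ Icc 1 T, Q t - Q 1 = excessMass L rhoM rhoP (ρ t) R - excessMass L rhoM rhoP (ρ 1) R := by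
  have hR0 : 0 < R := by linarith
  have hc := isCutoff_chi hR0
  have hd : ∀ t ∈ Icc 1 T, _ := fun t ht => h.exists_deriv_moment hL hrho hR
    (one_pos.trans_le ht.1) (hM t ht) (hi t ht).1 (hi t ht).2
  choose! q hq hq' using hd
  refine ⟨_, q, fun t ht => ⟨hq t ht, hq' t ht⟩, fun t ht => ?_⟩
  have i0 : IntegrableOn (fun x : Space n => stratifiedDensity rhoM rhoP (height x) *
      (chi R (height x) * height x)) (column n L) := by
    simpa using integrableOn_column_cutoff_mul (R := 3 * R)
      (continuous_stratified_mul rhoM rhoP hc.continuous) (fun z hz => by simp [hc.vanish z hz])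
      (continuous_const (y := (1 : ℝ))) L
  have e : ∀ t ∈ Icc 1 T, excessMass L rhoM rhoP (ρ t) R
      = (∫ x in column n L, stratifiedDensity rhoM rhoP (height x) * (chi R (height x) * height x))
        - ∫ x in column n L, chi R (height x) * height x * ρ t x := by
    intro t ht
    have hc' : Continuous (fun x : Space n => height x * ρ t x) :=
      continuous_height.mul (h.continuous_rho (one_pos.trans_le ht.1))
    have i1 := integrableOn_column_cutoff_mul hc.continuous hc.vanish hc' L
    have i2 : IntegrableOn (fun x => chi R (height x) * height x * ρ t x) (column n L) :=
      i1.congr (Eventually.of_forall fun x => by simp only; ring)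
    rw [← integral_sub i0 i2]
    refine integral_congr_ae (Eventually.of_forall fun x => ?_)
    simp only [excess]
    ring
  rw [e t ht, e 1 ⟨le_rfl, ht.1.trans ht.2⟩]
  ring

/-- In the kinetic energy minus `g` times the potential part, the mass flux cancels, leaving only
the boundary fluxes and the bounded moment error. -/
theorem IsClassicalSolution.kineticMass_le (h : IsClassicalSolution L g rhoM rhoP ρ u p)
    (hL : 0 < L) (hg : 0 < g) (hrho : 0 < rhoM) {M S R T : ℝ} (hR : 1 ≤ R)
    (hM : ∀ t ∈ Icc 1 T, ∀ x, ‖u t x‖ ≤ M)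
    (hi : ∀ t ∈ Icc 1 T, IntegrableOn (excess rhoM rhoP (ρ t)) (column n L) ∧
      ∫ x in column n L, excess rhoM rhoP (ρ t) x ≤ S) {t : ℝ} (ht : t ∈ Icc 1 T) :
    kineticMass L (ρ t) (u t) R ≤ kineticMass L (ρ 1) (u 1) R
      + g * (excessMass L rhoM rhoP (ρ t) R - excessMass L rhoM rhoP (ρ 1) R)
      + g * (T - 1) * momentError n L rhoP M S R
      + ∫ s in 1..T, (|diffusiveFlux L (ρ s) (u s) R| + |energyFlux L (ρ s) (u s) (p s) R|) := by
  have hR0 : 0 < R := by linarith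
  have hT : 1 ≤ T := ht.1.trans ht.2
  have hT0 : 0 < T := by linarith
  obtain ⟨Q, q, hq, hQ⟩ := h.exists_deriv_excessMass hL hrho hR hM hi
  set e := momentError n L rhoP M S R
  have he : 0 ≤ e := (abs_nonneg _).trans (hq t ht).2
  have iF := (intervalIntegrable_of_continuousOn_Ioi
    (h.continuousOn_diffusiveFlux (L := L) hR0) one_pos hT0).norm.add
    (h.intervalIntegrable_abs_energyFlux hL hrho hT hR)
  have iF' := iF.mono_set (c := 1) (d := t) (by
    rw [uIcc_of_le ht.1, uIcc_of_le hT]; exact Icc_subset_Icc_right ht.2)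
  have sub : ∀ s ∈ Icc 1 t, s ∈ Icc 1 T := fun s hs => ⟨hs.1, hs.2.trans ht.2⟩
  have hd : ∀ s ∈ Icc 1 t, HasDerivAt (fun s => kineticMass L (ρ s) (u s) R - g * Q s)
      ((-diffusiveFlux L (ρ s) (u s) R + energyFlux L (ρ s) (u s) (p s) R
        - g * massFlux L (ρ s) (u s) R) - g * q s) s := fun s hs =>
    (h.hasDerivAt_kineticMass hL.le hR0 (one_pos.trans_le hs.1)).sub
      ((hq s (sub s hs)).1.const_mul g)
  have key := intervalIntegral.sub_le_integral_of_hasDeriv_right_of_le ht.1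
    (fun s hs => (hd s hs).continuousAt.continuousWithinAt)
    (fun s hs => (hd s (Ioo_subset_Icc_self hs)).hasDerivWithinAt)
    (φ := fun s => (|diffusiveFlux L (ρ s) (u s) R| + |energyFlux L (ρ s) (u s) (p s) R|) + g * e)
    ((intervalIntegrable_iff_integrableOn_Icc_of_le ht.1).1 (iF'.add intervalIntegrable_const))
    (fun s hs => by
      have h1 := (abs_le.1 (hq s (sub s (Ioo_subset_Icc_self hs))).2).1
      have h2 := neg_le_abs (diffusiveFlux L (ρ s) (u s) R)
      have h3 := le_abs_self (energyFlux L (ρ s) (u s) (p s) R)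
      have h4 := mul_le_mul_of_nonneg_left h1 hg.le
      linarith)
  rw [intervalIntegral.integral_add (by exact iF') intervalIntegrable_const,
    intervalIntegral.integral_const, smul_eq_mul] at key
  have hmono := intervalIntegral.integral_mono_interval (a := 1) (b := t) (c := 1) (d := T)
    le_rfl ht.1 ht.2 (f := fun s => |diffusiveFlux L (ρ s) (u s) R|
      + |energyFlux L (ρ s) (u s) (p s) R|) (Eventually.of_forall fun s => by positivity)
      (by exact iF)
  have h5 : (t - 1) * (g * e) ≤ (T - 1) * (g * e) := by
    have := ht.2
    gcongr
  have h6 : g * Q t - g * Q 1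
      = g * (excessMass L rhoM rhoP (ρ t) R - excessMass L rhoM rhoP (ρ 1) R) := by
    rw [← hQ t ht]; ring
  linarith

theorem IsClassicalSolution.excessMass_le (h : IsClassicalSolution L g rhoM rhoP ρ u p)
    (hL : 0 < L) (hrho : 0 < rhoM) {M S R T : ℝ} (hR : 1 ≤ R) (hT : 1 ≤ T)
    (hM : ∀ t ∈ Icc 1 T, ∀ x, ‖u t x‖ ≤ M)
    (hi : ∀ t ∈ Icc 1 T, IntegrableOn (excess rhoM rhoP (ρ t)) (column n L) ∧
      ∫ x in column n L, excess rhoM rhoP (ρ t) x ≤ S) :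
    excessMass L rhoM rhoP (ρ T) R ≤ excessMass L rhoM rhoP (ρ 1) R
      + (T - 1) * momentError n L rhoP M S R + ∫ s in 1..T, |massFlux L (ρ s) (u s) R| := by
  have hR0 : 0 < R := by linarith
  have hT0 : 0 < T := by linarith
  obtain ⟨Q, q, hq, hQ⟩ := h.exists_deriv_excessMass hL hrho hR hM hi
  have iJ := (intervalIntegrable_of_continuousOn_Ioi
    (h.continuousOn_massFlux (L := L) hR0) one_pos hT0).norm
  have key := intervalIntegral.sub_le_integral_of_hasDeriv_right_of_le hT
    (fun s hs => (hq s hs).1.continuousAt.continuousWithinAt)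
    (fun s hs => (hq s (Ioo_subset_Icc_self hs)).1.hasDerivWithinAt)
    (φ := fun s => |massFlux L (ρ s) (u s) R| + momentError n L rhoP M S R)
    ((intervalIntegrable_iff_integrableOn_Icc_of_le hT).1 (iJ.add intervalIntegrable_const))
    (fun s hs => by
      have h1 := (abs_le.1 (hq s (Ioo_subset_Icc_self hs)).2).2
      have h2 := neg_le_abs (massFlux L (ρ s) (u s) R)
      linarith)
  rw [intervalIntegral.integral_add (by exact iJ) intervalIntegrable_const,
    intervalIntegral.integral_const, smul_eq_mul, hQ T ⟨hT, le_rfl⟩] at key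
  linarith

end

/-! ### Removal of the cutoff and the quadratic growth bound -/

noncomputable section

variable {n : ℕ}

variable {L g rhoM rhoP : ℝ} {ρ : ℝ → Space n → ℝ} {u : ℝ → Space n → Space n}
  {p : ℝ → Space n → ℝ}

theorem tendsto_div_sq (a : ℝ) : Tendsto (fun r : ℝ => a / r ^ 2) atTop (𝓝 0) :=
  tendsto_const_nhds.div_atTop (tendsto_pow_atTop two_ne_zero)

theorem tendsto_momentError (n : ℕ) (L rhoP M S : ℝ) :
    Tendsto (fun r : ℝ => momentError n L rhoP M S (r ^ 2)) atTop
      (𝓝 (24 * chiBound * rhoP * L ^ n)) := by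
  simpa [momentError] using (tendsto_div_sq (chiBound * M * S)).const_add
    (24 * chiBound * rhoP * L ^ n)

/-- All balances are combined at cutoff height `r ^ 2` and `r → ∞`. The bounds on velocity and
pressure gradient on [1, T], whose growth in `T` is unknown, occur only in terms that vanish in this
limit, so none of them survives in the conclusion. -/
theorem IsClassicalSolution.integral_excess_le (h : IsClassicalSolution L g rhoM rhoP ρ u p)
    (hL : 0 < L) (hg : 0 < g) (hrho : 0 < rhoM) {D S T lam δ : ℝ} (hT : 1 ≤ T) (hD0 : 0 ≤ D)
    (hD : ∀ s ∈ slab n L 3, ‖horizontal n s‖ ≤ D)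
    (hi : ∀ t ∈ Icc 1 T, IntegrableOn (excess rhoM rhoP (ρ t)) (column n L) ∧
      ∫ x in column n L, excess rhoM rhoP (ρ t) x ≤ S) (hlam : 0 < lam) (hδ : 0 < δ) :
    ∫ x in column n L, excess rhoM rhoP (ρ T) x
      ≤ (∫ x in column n L, excess rhoM rhoP (ρ 1) x)
        + (T - 1) * (24 * chiBound * rhoP * L ^ n)
        + D / 2 * (lam * (1 / 2 * ((rhoP - rhoM) * ((rhoP - rhoM) * (2 * δ * L ^ n) + S / δ)))
          + lam⁻¹ * (2 / rhoM * ((T - 1) * ((∫ x in column n L, 1 / 2 * ρ 1 x * ‖u 1 x‖ ^ 2)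
            + g * S + g * (T - 1) * (24 * chiBound * rhoP * L ^ n))))) := by
  obtain ⟨M, hM0, hM⟩ := h.exists_bound_u T
  have hM' : ∀ t ∈ Icc 1 T, ∀ x, ‖u t x‖ ≤ M := fun t ht => hM t ⟨by linarith [ht.1], ht.2⟩
  have hT0 : 0 < T := by linarith
  have h1T : (1 : ℝ) ∈ Icc 1 T := ⟨le_rfl, hT⟩
  have hTT : T ∈ Icc 1 T := ⟨hT, le_rfl⟩
  have hex : ∀ t ∈ Icc 1 T, ∀ x ∈ column n L, 0 ≤ excess rhoM rhoP (ρ t) x := fun t ht x hx =>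
    excess_nonneg (h.rho_mem hL (one_pos.trans_le ht.1) hx)
  have hsq : Tendsto (fun r : ℝ => r ^ 2) atTop atTop := tendsto_pow_atTop two_ne_zero
  have hkin : IntegrableOn (fun x => 1 / 2 * ρ 1 x * ‖u 1 x‖ ^ 2) (column n L) :=
    ((h.kinetic_finite 1 zero_le_one).const_mul (1 / 2)).congr
      (Eventually.of_forall fun x => by simp only; ring)
  have lE : ∀ t ∈ Icc 1 T, Tendsto (fun r : ℝ => excessMass L rhoM rhoP (ρ t) (r ^ 2)) atTop
      (𝓝 (∫ x in column n L, excess rhoM rhoP (ρ t) x)) := fun t ht =>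
    (tendsto_integral_chi_mul (hi t ht).1).comp hsq
  have lK : Tendsto (fun r : ℝ => kineticMass L (ρ 1) (u 1) (r ^ 2)) atTop
      (𝓝 (∫ x in column n L, 1 / 2 * ρ 1 x * ‖u 1 x‖ ^ 2)) :=
    (tendsto_integral_chi_mul hkin).comp hsq
  have le := tendsto_momentError n L rhoP M S
  have lF := (h.tendsto_integral_diffusiveFlux hL hT hi).add
    ((h.tendsto_integral_energyFlux hL hrho hT).comp hsq)
  have lG := tendsto_div_sq (chiBound * (1 + M) * (rhoP - rhoM) * S)
  have lim := ((lE 1 h1T).add (le.const_mul (T - 1))).add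
    ((((((lG.const_mul (T - 1)).const_add
      ((rhoP - rhoM) * ((rhoP - rhoM) * (2 * δ * L ^ n) + S / δ))).const_mul (1 / 2)).const_mul
        lam).add ((((((lK.add_const (g * S)).add (le.const_mul (g * (T - 1)))).add lF).const_mul
          (T - 1)).const_mul (2 / rhoM)).const_mul lam⁻¹)).const_mul (D / 2))
  simp only [mul_zero, add_zero] at lim
  refine le_of_tendsto_of_tendsto (lE T hTT) lim ?_
  filter_upwards [eventually_ge_atTop 1] with r hr
  have hR : 1 ≤ r ^ 2 := one_le_pow₀ hr
  have hR0 : 0 < r ^ 2 := by linarith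
  simp only [Function.comp_apply]
  set R := r ^ 2
  set e := momentError n L rhoP M S R
  set F := (∫ t in 1..T, |diffusiveFlux L (ρ t) (u t) R|)
    + ∫ t in 1..T, |energyFlux L (ρ t) (u t) (p t) R| with hF
  set K := kineticMass L (ρ 1) (u 1) R + g * S + g * (T - 1) * e + F with hK
  have iA := intervalIntegrable_of_continuousOn_Ioi
    (h.continuousOn_gradMass (L := L) hR0) one_pos hT0
  have iJ := (intervalIntegrable_of_continuousOn_Ioi
    (h.continuousOn_massFlux (L := L) hR0) one_pos hT0).norm
  have b1 := h.excessMass_le hL hrho hR hT hM' hi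
  have b2 := h.integral_gradMass_le hL hR hT hM' hi hδ
  have b3 : ∀ t ∈ Icc 1 T, kineticMass L (ρ t) (u t) R ≤ K := by
    intro t ht
    have a1 := h.kineticMass_le hL hg hrho hR hM' hi ht
    have iF : IntervalIntegrable (fun s => |diffusiveFlux L (ρ s) (u s) R|) volume 1 T :=
      (intervalIntegrable_of_continuousOn_Ioi
        (h.continuousOn_diffusiveFlux (L := L) hR0) one_pos hT0).norm
    rw [intervalIntegral.integral_add iF
      (h.intervalIntegrable_abs_energyFlux hL hrho hT hR)] at a1
    have a2 : excessMass L rhoM rhoP (ρ t) R ≤ S :=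
      (integral_chi_mul_le (hi t ht).1 (hex t ht) hR0).trans (hi t ht).2
    have a3 : 0 ≤ excessMass L rhoM rhoP (ρ 1) R := setIntegral_nonneg (measurableSet_column L)
      fun x hx => mul_nonneg (chi_nonneg _ _) (hex 1 h1T x hx)
    have a4 : g * (excessMass L rhoM rhoP (ρ t) R - excessMass L rhoM rhoP (ρ 1) R) ≤ g * S := by
      gcongr
      linarith
    linarith
  have b4 : ∫ s in 1..T, |massFlux L (ρ s) (u s) R|
      ≤ ∫ s in 1..T, D / 2 * (lam * gradMass L (ρ s) R + lam⁻¹ * (2 / rhoM * K)) := by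
    refine intervalIntegral.integral_mono_on hT iJ
      (((iA.const_mul lam).add intervalIntegrable_const).const_mul _) fun t ht => ?_
    refine (h.abs_massFlux_le hL hrho hD0 hD hlam hR0 (one_pos.trans_le ht.1)).trans ?_
    have := b3 t ht
    gcongr
  rw [intervalIntegral.integral_const_mul,
    intervalIntegral.integral_add (iA.const_mul lam) intervalIntegrable_const,
    intervalIntegral.integral_const_mul, intervalIntegral.integral_const, smul_eq_mul] at b4
  have b5 : ∫ t in 1..T, gradMass L (ρ t) R
      ≤ 1 / 2 * ((rhoP - rhoM) * ((rhoP - rhoM) * (2 * δ * L ^ n) + S / δ)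
        + (T - 1) * (chiBound * (1 + M) * (rhoP - rhoM) * S / R)) := by linarith
  calc excessMass L rhoM rhoP (ρ T) R
      ≤ excessMass L rhoM rhoP (ρ 1) R + (T - 1) * e
        + D / 2 * (lam * (∫ t in 1..T, gradMass L (ρ t) R)
          + (T - 1) * (lam⁻¹ * (2 / rhoM * K))) := by linarith
    _ = excessMass L rhoM rhoP (ρ 1) R + (T - 1) * e
        + D / 2 * (lam * (∫ t in 1..T, gradMass L (ρ t) R)
          + lam⁻¹ * (2 / rhoM * ((T - 1) * K))) := by ring
    _ ≤ _ := by gcongr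

/-- Absorption: applied at every time in [1, T] with the same parameters, the previous estimate
bounds the supremum `S` by `C * T ^ 2 + S / 2`. As `S` is finite, it is at most `2 * C * T ^ 2`. -/
theorem IsClassicalSolution.exists_integral_excess_le_sq
    (h : IsClassicalSolution L g rhoM rhoP ρ u p) (hL : 0 < L) (hg : 0 < g) (hrho : 0 < rhoM)
    (hlt : rhoM < rhoP) (h0 : IntegrableOn (excess rhoM rhoP (ρ 0)) (column n L)) :
    ∃ C, ∀ t ≥ 1, ∫ x in column n L, excess rhoM rhoP (ρ t) x ≤ C * t ^ 2 := by
  obtain ⟨D, hD, hDb⟩ := exists_bound_horizontal n L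
  have hΔ : 0 < rhoP - rhoM := by linarith
  have hrP : 0 < rhoP := by linarith
  have hcb := chiBound_pos
  have hnn : ∀ t, 0 < t → 0 ≤ ∫ x in column n L, excess rhoM rhoP (ρ t) x := fun t ht =>
    setIntegral_nonneg (measurableSet_column L) fun x hx => excess_nonneg (h.rho_mem hL ht hx)
  set Z : ℝ → ℝ := fun t => ∫ x in column n L, excess rhoM rhoP (ρ t) x with hZ
  set K := ∫ x in column n L, 1 / 2 * ρ 1 x * ‖u 1 x‖ ^ 2
  have hK : 0 ≤ K := setIntegral_nonneg (measurableSet_column L) fun x hx => by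
    have := (h.rho_mem hL one_pos hx).1
    have : 0 < ρ 1 x := by linarith
    positivity
  set c := 24 * chiBound * rhoP * L ^ n with hc
  have hc0 : 0 ≤ c := by positivity
  -- `α` makes the kinetic term containing `S` equal to `S / 4` when `lam = α * T`; then `β` does
  -- the same for the gradient term when `δ = β * T`.
  set α := 4 * D * g / rhoM with hα
  set β := D * (rhoP - rhoM) * α with hβ
  have hα0 : 0 < α := by positivity
  have hβ0 : 0 < β := by positivity
  set C := Z 1 + c + D / 2 * (α * (1 / 2 * ((rhoP - rhoM) * ((rhoP - rhoM) * (2 * β * L ^ n))))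
    + α⁻¹ * (2 / rhoM * (K + g * c))) with hC
  refine ⟨2 * C, fun T hT => ?_⟩
  have hT0 : 0 < T := by linarith
  have hTT : T ∈ Icc 1 T := ⟨hT, le_rfl⟩
  obtain ⟨S₀, hS₀⟩ := h.exists_bound_excess hL h0 T
  have hIoc : ∀ t ∈ Icc 1 T, t ∈ Ioc 0 T := fun t ht => ⟨one_pos.trans_le ht.1, ht.2⟩
  set S := sSup (Z '' Icc 1 T) with hS
  have hbdd : BddAbove (Z '' Icc 1 T) := ⟨S₀, by
    rintro _ ⟨t, ht, rfl⟩; exact (hS₀ t (hIoc t ht)).2⟩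
  have hle : ∀ t ∈ Icc 1 T, Z t ≤ S := fun t ht => le_csSup hbdd ⟨t, ht, rfl⟩
  have hS0 : 0 ≤ S := (hnn T hT0).trans (hle T hTT)
  have main : S ≤ C * T ^ 2 + S / 2 := by
    refine csSup_le ⟨_, T, hTT, rfl⟩ ?_
    rintro _ ⟨t, ht, rfl⟩
    have hb := h.integral_excess_le hL hg hrho ht.1 hD.le hDb (S := S) (lam := α * T) (δ := β * T)
      (fun s hs => ⟨(hS₀ s (hIoc s ⟨hs.1, hs.2.trans ht.2⟩)).1, hle s ⟨hs.1, hs.2.trans ht.2⟩⟩)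
      (by positivity) (by positivity)
    have ht1 : 0 ≤ t - 1 := by linarith [ht.1]
    have htT : t - 1 ≤ T := by linarith [ht.2]
    have e1 : D / 2 * (α * T * (1 / 2 * ((rhoP - rhoM) * (S / (β * T))))) = S / 4 := by
      rw [hβ]
      field_simp
      ring
    have e2 : D / 2 * ((α * T)⁻¹ * (2 / rhoM * (T * (g * S)))) = S / 4 := by
      rw [hα]
      field_simp
    have hT2 : T ≤ T ^ 2 := by nlinarith
    have h1T2 : 1 ≤ T ^ 2 := one_le_pow₀ hT
    have hZ1 : 0 ≤ Z 1 := hnn 1 one_pos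
    have k1 : Z 1 ≤ Z 1 * T ^ 2 := le_mul_of_one_le_right hZ1 h1T2
    have k2 : T * c ≤ c * T ^ 2 := by rw [mul_comm]; gcongr
    have k3 : D / 2 * ((α * T)⁻¹ * (2 / rhoM * (T * (K + g * T * c))))
        ≤ D / 2 * (α⁻¹ * (2 / rhoM * (K + g * c))) * T ^ 2 := by
      have : D / 2 * ((α * T)⁻¹ * (2 / rhoM * (T * (K + g * T * c))))
          = D / 2 * (α⁻¹ * (2 / rhoM * (K + g * T * c))) := by
        field_simp
      rw [this]
      have : K + g * T * c ≤ (K + g * c) * T ^ 2 := by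
        have a1 : K ≤ K * T ^ 2 := le_mul_of_one_le_right hK h1T2
        have a2 : g * c * T ≤ g * c * T ^ 2 := by gcongr
        linarith
      calc _ ≤ D / 2 * (α⁻¹ * (2 / rhoM * ((K + g * c) * T ^ 2))) := by gcongr
        _ = _ := by ring
    calc Z t ≤ Z 1 + (t - 1) * c + D / 2 * (α * T * (1 / 2 * ((rhoP - rhoM) *
            ((rhoP - rhoM) * (2 * (β * T) * L ^ n) + S / (β * T))))
          + (α * T)⁻¹ * (2 / rhoM * ((t - 1) * (K + g * S + g * (t - 1) * c)))) := hb
      _ ≤ Z 1 + T * c + D / 2 * (α * T * (1 / 2 * ((rhoP - rhoM) *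
            ((rhoP - rhoM) * (2 * (β * T) * L ^ n) + S / (β * T))))
          + (α * T)⁻¹ * (2 / rhoM * (T * (K + g * S + g * T * c)))) := by gcongr
      _ = Z 1 + T * c + D / 2 * (α * (1 / 2 * ((rhoP - rhoM) *
            ((rhoP - rhoM) * (2 * β * L ^ n))))) * T ^ 2
          + D / 2 * ((α * T)⁻¹ * (2 / rhoM * (T * (K + g * T * c))))
          + D / 2 * (α * T * (1 / 2 * ((rhoP - rhoM) * (S / (β * T)))))
          + D / 2 * ((α * T)⁻¹ * (2 / rhoM * (T * (g * S)))) := by ring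
      _ ≤ C * T ^ 2 + S / 2 := by
          rw [e1, e2, hC]
          linarith
  have := hle T hTT
  change Z T ≤ _
  linarith

theorem limsup_toEReal_le_of_tendsto_zero {f : ℝ → ℝ} (hf : Tendsto f atTop (𝓝 0)) {c : ℝ}
    (hc : 0 ≤ c) : limsup (fun t => Real.toEReal (f t)) atTop ≤ Real.toEReal c := by
  have : Tendsto (fun t => Real.toEReal (f t)) atTop (𝓝 (Real.toEReal 0)) :=
    (continuous_coe_real_ereal.tendsto 0).comp hf
  rw [this.limsup_eq]
  exact EReal.coe_le_coe_iff.2 hc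

end

end RayleighTaylor

/-! ### The theorem -/

open RayleighTaylor

theorem mainTheorem3 :
    ∃ C : ℝ, 0 < C ∧
      ∀ (n : ℕ) (_ : 1 ≤ n) (L g rhoM rhoP : ℝ)
        (_ : 0 < L) (_ : 0 < g) (_ : 0 < rhoM) (_ : rhoM < rhoP)
        (ρ : ℝ → RayleighTaylor.Space n → ℝ)
        (u : ℝ → RayleighTaylor.Space n → RayleighTaylor.Space n)
        (p : ℝ → RayleighTaylor.Space n → ℝ)
        (_ : RayleighTaylor.IsClassicalSolution L g rhoM rhoP ρ u p)
        (_ : IntegrableOn (RayleighTaylor.potentialDensity g rhoM rhoP (ρ 0))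
          (RayleighTaylor.column n L))
        (_ : IntegrableOn (RayleighTaylor.mixingDensity rhoM rhoP (ρ 0))
          (RayleighTaylor.column n L))
        (_ : RayleighTaylor.meanPerimeter L rhoM rhoP (ρ 0) < ⊤),
        (∀ t : ℝ, 0 ≤ t →
          IntegrableOn (RayleighTaylor.potentialDensity g rhoM rhoP (ρ t))
              (RayleighTaylor.column n L) ∧
            IntegrableOn (RayleighTaylor.mixingDensity rhoM rhoP (ρ t))
              (RayleighTaylor.column n L)) ∧
        limsup (fun t : ℝ => Real.toEReal
            (RayleighTaylor.potentialEnergy L g rhoM rhoP (ρ t) /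
              (RayleighTaylor.atwood rhoM rhoP ^ (2 : ℕ) * g ^ (3 : ℕ) * t ^ (3 : ℕ)))) atTop
          ≤ Real.toEReal (C * (L ^ (2 : ℕ) / (1 - RayleighTaylor.atwood rhoM rhoP) ^ (3 / 2 : ℝ))) ∧
        limsup (fun t : ℝ => Real.toEReal
            (RayleighTaylor.mixingEntropy L rhoM rhoP (ρ t) /
              (RayleighTaylor.atwood rhoM rhoP * g * t ^ (3 / 2 : ℝ)))) atTop
          ≤ Real.toEReal (C * (L / (1 - RayleighTaylor.atwood rhoM rhoP) ^ (3 / 4 : ℝ))) := by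
  -- Both upper limits turn out to be at most zero, so any positive constant will do.
  refine ⟨1, one_pos, ?_⟩
  intro n _ L g rhoM rhoP hL hg hrho hlt ρ u p h hp hmix _
  have hΔ : 0 < rhoP - rhoM := by linarith
  have h0 : IntegrableOn (excess rhoM rhoP (ρ 0)) (column n L) := by
    rw [potentialDensity_eq] at hp
    exact (hp.const_mul g⁻¹).congr (Eventually.of_forall fun x => by
      simp only; field_simp)
  have hex : ∀ t, 0 < t → IntegrableOn (excess rhoM rhoP (ρ t)) (column n L) := fun t ht => by
    obtain ⟨S, hS⟩ := h.exists_bound_excess hL h0 t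
    exact (hS t ⟨ht, le_rfl⟩).1
  have hr : ∀ t, 0 < t → ∀ x ∈ column n L, ρ t x ∈ Icc rhoM rhoP := fun t ht x hx =>
    h.rho_mem hL ht hx
  -- The interpolation is used with `δ = t`, which balances `δ` against `t ^ 2 / δ` and makes the
  -- mixing entropy O(t).
  have hH : ∀ t : ℝ, 0 < t → _ := fun t ht => integrableOn_mixingDensity hL.le (hr t ht)
    (h.continuous_rho ht).measurable (hex t ht) ht
  have hA : 0 < atwood rhoM rhoP := div_pos hΔ (by linarith)
  have hA1 : 0 ≤ 1 - atwood rhoM rhoP := by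
    rw [sub_nonneg, atwood, div_le_one (by linarith)]
    linarith
  obtain ⟨C, hC⟩ := h.exists_integral_excess_le_sq hL hg hrho hlt h0
  have hZ : ∀ t, 0 < t → 0 ≤ ∫ x in column n L, excess rhoM rhoP (ρ t) x := fun t ht =>
    setIntegral_nonneg (measurableSet_column L) fun x hx => excess_nonneg (hr t ht x hx)
  refine ⟨fun t ht => ?_, limsup_toEReal_le_of_tendsto_zero ?_ (by positivity),
    limsup_toEReal_le_of_tendsto_zero ?_ (by positivity)⟩
  · rcases ht.eq_or_lt with rfl | ht
    · exact ⟨hp, hmix⟩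
    · refine ⟨?_, (hH t ht).1⟩
      rw [potentialDensity_eq]
      exact (hex t ht).const_mul g
  · have hA2 : 0 < atwood rhoM rhoP ^ 2 * g ^ 3 := by positivity
    set B := 1 / (rhoP - rhoM) * ((L ^ n)⁻¹ * (g * C)) / (atwood rhoM rhoP ^ 2 * g ^ 3) with hB
    refine squeeze_zero' (g := fun t => B / t) ?_ ?_ (tendsto_const_nhds.div_atTop tendsto_id)
    · filter_upwards [eventually_gt_atTop 0] with t ht
      have := hZ t ht
      rw [potentialEnergy, normalizedIntegral, potentialDensity_eq, integral_const_mul]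
      positivity
    · filter_upwards [eventually_ge_atTop 1] with t ht
      have ht0 : 0 < t := by linarith
      rw [potentialEnergy, normalizedIntegral, potentialDensity_eq, integral_const_mul]
      calc _ ≤ 1 / (rhoP - rhoM) * ((L ^ n)⁻¹ * (g * (C * t ^ 2)))
            / (atwood rhoM rhoP ^ 2 * g ^ 3 * t ^ 3) := by
            have := hC t ht
            gcongr
        _ = B / t := by rw [hB]; field_simp
  · set B := 1 / (rhoP - rhoM) ^ 2 * ((L ^ n)⁻¹ * ((rhoP - rhoM) *
      ((rhoP - rhoM) * (2 * L ^ n) + C))) / (atwood rhoM rhoP * g) with hB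
    refine squeeze_zero' (g := fun t => B / t ^ (1 / 2 : ℝ)) ?_ ?_
      (tendsto_const_nhds.div_atTop (tendsto_rpow_atTop (by norm_num)))
    · filter_upwards [eventually_gt_atTop 0] with t ht
      have : 0 ≤ ∫ x in column n L, mixingDensity rhoM rhoP (ρ t) x :=
        setIntegral_nonneg (measurableSet_column L) fun x hx => mixingDensity_nonneg (hr t ht x hx)
      rw [mixingEntropy, normalizedIntegral]
      positivity
    · filter_upwards [eventually_ge_atTop 1] with t ht
      have ht0 : 0 < t := by linarith
      have hpow : t ^ (3 / 2 : ℝ) = t * t ^ (1 / 2 : ℝ) := by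
        rw [← Real.rpow_one_add' ht0.le (by norm_num)]
        norm_num
      have hs : 0 < t ^ (1 / 2 : ℝ) := Real.rpow_pos_of_pos ht0 _
      have hb : ∫ x in column n L, mixingDensity rhoM rhoP (ρ t) x
          ≤ (rhoP - rhoM) * ((rhoP - rhoM) * (2 * t * L ^ n) + C * t ^ 2 / t) := by
        refine (hH t ht0).2.trans ?_
        have := hC t ht
        gcongr
      rw [mixingEntropy, normalizedIntegral, hpow]
      calc _ ≤ 1 / (rhoP - rhoM) ^ 2 * ((L ^ n)⁻¹ *
              ((rhoP - rhoM) * ((rhoP - rhoM) * (2 * t * L ^ n) + C * t ^ 2 / t)))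
            / (atwood rhoM rhoP * g * (t * t ^ (1 / 2 : ℝ))) := by gcongr
        _ = B / t ^ (1 / 2 : ℝ) := by rw [hB]; field_simp
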